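/- Let $d,n\ge 1$ be integers. The framed blob monoid $Bl_{d,n}$ is the monoid presented by generators $u_0,u_1,\dots,u_{n-1}$ and $z_1,\dots,z_n$ and the following relations, for all values of the indices for which the generators are defined and all integers $k\ge 0$: - $u_i^2=u_i$; $\ u_iu_j=u_ju_i$ if $|i-j|>1$; $\ u_1u_0u_1=u_1$; $\ u_iu_ju_i=u_i$ if $|i-j|=1$ and $i,j\neq 0$; - $z_i^d=1$; $\ z_iz_j=z_jz_i$; - $z_iu_i=z_{i+1}u_i$ and $u_iz_i=u_iz_{i+1}$ for $i\ge 1$; - $u_0z_i=z_iu_0$ if $i\neq 1$; $\ u_iz_j=z_ju_i$ if $i\ge 1$ and $j\neq i,i+1$; - $u_iz_i^ku_i=u_i$ for $i\ge 1$; $\ u_0z_1^ku_0=u_0$; $\ u_1z_1^ku_0u_1=u_1$; $\ u_1u_0z_1^ku_1=u_1$. A *$d$-abacus blob diagram* on $n$ points is a non-crossing perfect matching (by arcs in a rectangular frame) of $n$ top points and $n$ bottom points, in which some of the arcs that are exposed to the left side of the diagram carry one blob each, and in which every component of an arc carries a number of beads counted modulo $d$; an arc without a blob is a single component, and a blob divides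 its arc into two components. Two such diagrams are equal if they have the same arcs, the same arcs with blobs, and the same number of beads modulo $d$ on each component. The *abacus blob monoid* $\mathfrak{Bl}_{d,n}$ is the set of all these diagrams. The product $DD'$ is obtained by placing $D$ on top of $D'$ and gluing the bottom points of $D$ to the top points of $D'$; loops are erased together with their decorations, beads slide freely along a component and add up modulo $d$, and two blobs on the same arc, together with all the beads between them, are replaced by one blob. The identity is the diagram of $n$ vertical arcs without decorations. Let $\mathfrak z_i$ be the identity diagram with one bead added on the $i$-th strand, let $\mathfrak u_0$ be the identity diagram with a blob added on the first strand, and for $1\le i\le n-1$ let $\mathfrak u_i$ be the undecorated diagram with an arc joining the top points $i,i+1$, an arc joining the bottom points $i,i+1$, and vertical arcs elsewhere. **Theorem.** The assignment $u_i\mapsto\mathfrak u_i$ $(0\le i\le n-1)$, $z_i\mapsto\mathfrak z_i$ $(1\le i\le n)$ defines an isomorphism of monoids $\Phi: Bl_{d,n}\to\mathfrak{Bl}_{d,n}$. -/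

import Mathlib

/-! ### The framed blob monoid, by generators and relations -/

/-- Generators of the framed blob monoid: `u i` for `0 ≤ i ≤ n - 1` and `z i` for `1 ≤ i ≤ n`. -/
inductive FramedBlobGen (n : ℕ) : Type
  | u (i : ℕ) (h : i < n)
  | z (i : ℕ) (h1 : 1 ≤ i) (h2 : i ≤ n)

namespace FramedBlobGen

/-- The generator `u i` as a one-letter word. -/
def wu {n : ℕ} (i : ℕ) (h : i < n) : FreeMonoid (FramedBlobGen n) := FreeMonoid.of (u i h)

/-- The generator `z i` as a one-letter word. -/
def wz {n : ℕ} (i : ℕ) (h1 : 1 ≤ i) (h2 : i ≤ n) : FreeMonoid (FramedBlobGen n) :=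
  FreeMonoid.of (z i h1 h2)

end FramedBlobGen

open FramedBlobGen in
/-- The defining relations of the framed blob monoid. -/
inductive FramedBlobRel (d n : ℕ) :
    FreeMonoid (FramedBlobGen n) → FreeMonoid (FramedBlobGen n) → Prop
  -- the relations of the blob monoid
  | u_idem (i : ℕ) (hi : i < n) : FramedBlobRel d n (wu i hi * wu i hi) (wu i hi)
  | u_comm (i j : ℕ) (hi : i < n) (hj : j < n) (h : i + 1 < j ∨ j + 1 < i) :
      FramedBlobRel d n (wu i hi * wu j hj) (wu j hj * wu i hi)
  | u_one_zero_one (h0 : 0 < n) (h1 : 1 < n) :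
      FramedBlobRel d n (wu 1 h1 * wu 0 h0 * wu 1 h1) (wu 1 h1)
  | u_braid (i j : ℕ) (hi : i < n) (hj : j < n) (i0 : i ≠ 0) (j0 : j ≠ 0)
      (h : i + 1 = j ∨ j + 1 = i) :
      FramedBlobRel d n (wu i hi * wu j hj * wu i hi) (wu i hi)
  -- the framing relations
  | z_pow (i : ℕ) (h1 : 1 ≤ i) (h2 : i ≤ n) : FramedBlobRel d n (wz i h1 h2 ^ d) 1
  | z_comm (i j : ℕ) (hi1 : 1 ≤ i) (hi2 : i ≤ n) (hj1 : 1 ≤ j) (hj2 : j ≤ n) :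
      FramedBlobRel d n (wz i hi1 hi2 * wz j hj1 hj2) (wz j hj1 hj2 * wz i hi1 hi2)
  | z_u (i : ℕ) (h1 : 1 ≤ i) (hi : i < n) :
      FramedBlobRel d n (wz i h1 hi.le * wu i hi)
        (wz (i + 1) (Nat.le_add_left 1 i) hi * wu i hi)
  | u_z (i : ℕ) (h1 : 1 ≤ i) (hi : i < n) :
      FramedBlobRel d n (wu i hi * wz i h1 hi.le)
        (wu i hi * wz (i + 1) (Nat.le_add_left 1 i) hi)
  | u_zero_z_comm (i : ℕ) (h0 : 0 < n) (hi1 : 1 ≤ i) (hi2 : i ≤ n) (h : i ≠ 1) :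
      FramedBlobRel d n (wu 0 h0 * wz i hi1 hi2) (wz i hi1 hi2 * wu 0 h0)
  | u_z_comm (i j : ℕ) (h1 : 1 ≤ i) (hi : i < n) (hj1 : 1 ≤ j) (hj2 : j ≤ n)
      (h : j ≠ i) (h' : j ≠ i + 1) :
      FramedBlobRel d n (wu i hi * wz j hj1 hj2) (wz j hj1 hj2 * wu i hi)
  | u_z_u (i k : ℕ) (h1 : 1 ≤ i) (hi : i < n) :
      FramedBlobRel d n (wu i hi * wz i h1 hi.le ^ k * wu i hi) (wu i hi)
  | u_zero_z_u_zero (k : ℕ) (h0 : 0 < n) :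
      FramedBlobRel d n (wu 0 h0 * wz 1 le_rfl h0 ^ k * wu 0 h0) (wu 0 h0)
  | u_z_u_zero_u (k : ℕ) (h0 : 0 < n) (h1 : 1 < n) :
      FramedBlobRel d n (wu 1 h1 * wz 1 le_rfl h0 ^ k * wu 0 h0 * wu 1 h1) (wu 1 h1)
  | u_u_zero_z_u (k : ℕ) (h0 : 0 < n) (h1 : 1 < n) :
      FramedBlobRel d n (wu 1 h1 * wu 0 h0 * wz 1 le_rfl h0 ^ k * wu 1 h1) (wu 1 h1)

/-- The framed blob monoid `Bl_{d,n}`. -/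
abbrev FramedBlobMonoid (d n : ℕ) : Type := PresentedMonoid (FramedBlobRel d n)

namespace FramedBlobMonoid

/-- The element `u i` of the framed blob monoid, `0 ≤ i ≤ n - 1`. -/
def u (d : ℕ) {n : ℕ} (i : ℕ) (h : i < n) : FramedBlobMonoid d n :=
  PresentedMonoid.of _ (FramedBlobGen.u i h)

/-- The element `z i` of the framed blob monoid, `1 ≤ i ≤ n`. -/
def z (d : ℕ) {n : ℕ} (i : ℕ) (h1 : 1 ≤ i) (h2 : i ≤ n) : FramedBlobMonoid d n :=
  PresentedMonoid.of _ (FramedBlobGen.z i h1 h2)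

end FramedBlobMonoid

/-! ### Decorations of a single arc -/

/-- The decoration of an arc, read along the arc from one of its ends. `plain k`: no blob and `k`
beads. `blob a b`: one blob, `a` beads before it and `b` beads after it. Beads are counted
modulo `d`. -/
inductive Deco (d : ℕ) : Type
  | plain (k : ZMod d)
  | blob (a b : ZMod d)

namespace Deco

variable {d : ℕ}

/-- The same decoration, read from the other end. -/
def rev : Deco d → Deco d
  | plain k => plain k
  | blob a b => blob b a

/-- The decoration contains a blob. -/
def HasBlob : Deco d → Prop
  | plain _ => False
  | blob _ _ => True

/-- Decoration of two arcs glued end to end: beads on a common component add up, and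
blob - beads - blob becomes one blob. -/
instance : Mul (Deco d) where
  mul
    | plain k, plain l => plain (k + l)
    | plain k, blob a b => blob (k + a) b
    | blob a b, plain k => blob a (b + k)
    | blob a _, blob _ b => blob a b

instance : One (Deco d) where
  one := plain 0

theorem one_def : (1 : Deco d) = plain 0 := rfl
theorem plain_mul_plain (k l : ZMod d) : plain k * plain l = plain (k + l) := rfl
theorem plain_mul_blob (k a b : ZMod d) : plain k * blob a b = blob (k + a) b := rfl
theorem blob_mul_plain (a b k : ZMod d) : blob a b * plain k = blob a (b + k) := rfl
theorem blob_mul_blob (a b a' b' : ZMod d) : blob a b * blob a' b' = blob a b' := rfl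

instance : Monoid (Deco d) where
  mul_assoc x y w := by
    cases x <;> cases y <;> cases w <;>
      simp [plain_mul_plain, plain_mul_blob, blob_mul_plain, blob_mul_blob, add_assoc]
  one_mul x := by
    cases x <;> simp [one_def, plain_mul_plain, plain_mul_blob]
  mul_one x := by
    cases x <;> simp [one_def, plain_mul_plain, blob_mul_plain]

theorem rev_one : (1 : Deco d).rev = 1 := rfl

theorem rev_mul (x y : Deco d) : (x * y).rev = y.rev * x.rev := by
  cases x <;> cases y <;>
    simp [rev, plain_mul_plain, plain_mul_blob, blob_mul_plain, blob_mul_blob, add_comm]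

theorem hasBlob_one : ¬ (1 : Deco d).HasBlob := fun h => h

theorem hasBlob_mul {x y : Deco d} (h : (x * y).HasBlob) : x.HasBlob ∨ y.HasBlob := by
  cases x <;> cases y <;>
    first
    | exact Or.inl trivial
    | exact Or.inr trivial
    | exact h.elim

end Deco

/-! ### Abacus blob diagrams -/

/-- The `2 n` boundary points: `inl i` is the `i`-th top point and `inr i` the `i`-th bottom point,
both counted from the left, from `0` to `n - 1`. -/
abbrev BPt (n : ℕ) : Type := Fin n ⊕ Fin n

namespace BPt

variable {n : ℕ}

/-- Position of a boundary point on the boundary of the frame, walked clockwise and starting on the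
left side: the top points from left to right, then the bottom points from right to left. -/
def pos : BPt n → ℕ
  | .inl i => i
  | .inr i => 2 * n - 1 - i

theorem pos_inl (i : Fin n) : pos (.inl i) = i := rfl

theorem pos_inr (i : Fin n) : pos (.inr i) = 2 * n - 1 - i := rfl

theorem pos_injective : Function.Injective (pos (n := n)) := by
  rintro (i | i) (j | j) h <;> simp only [pos] at h
  · congr 1; ext; exact h
  · have := i.2; have := j.2; omega
  · have := i.2; have := j.2; omega
  · congr 1; ext; have := i.2; have := j.2; omega

end BPt

/-- A `d`-abacus blob diagram on `n` points. The arcs are the pairs `{p, arc p}`, and `deco p` is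
the decoration of the arc through `p`, read from `p`. -/
@[ext]
structure AbacusDiagram (d n : ℕ) where
  /-- the other end of the arc through a boundary point -/
  arc : BPt n → BPt n
  /-- the decoration of the arc through a boundary point, read from that point -/
  deco : BPt n → Deco d
  arc_arc : ∀ p, arc (arc p) = p
  arc_ne : ∀ p, arc p ≠ p
  deco_arc : ∀ p, deco (arc p) = (deco p).rev
  /-- Arcs do not cross: no two arcs interlace on the boundary of the frame. -/
  noncrossing : ∀ p q, ¬ (BPt.pos p < BPt.pos q ∧ BPt.pos q < BPt.pos (arc p) ∧
    BPt.pos (arc p) < BPt.pos (arc q))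
  /-- An arc with a blob is exposed to the left side: no arc `{q, arc q}` separates it from the
  left side, that is, encloses it in the order of the boundary that starts on the left side. -/
  exposed : ∀ p, (deco p).HasBlob → ∀ q, ¬ (BPt.pos q < BPt.pos p ∧ BPt.pos q < BPt.pos (arc p) ∧
    BPt.pos p < BPt.pos (arc q) ∧ BPt.pos (arc p) < BPt.pos (arc q))

/-! ### Walks along glued arcs -/

/-- Boxes are stacked; `X` is the set of all their boundary points, `arc` and `deco` give the arcs
inside the boxes, and `glue` matches the points that are glued to one another and fixes the points
on the boundary of the stack. `ArcWalk arc deco glue x m y`: the curve that starts with the arc at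
`x` arrives at the boundary point `y` of the stack, and `m` is its decoration, read from `x`. -/
inductive ArcWalk {X : Type} {d : ℕ} (arc : X → X) (deco : X → Deco d) (glue : X → X) :
    X → Deco d → X → Prop
  | last (x : X) (h : glue (arc x) = arc x) : ArcWalk arc deco glue x (deco x) (arc x)
  | step (x : X) (m : Deco d) (y : X) (h : glue (arc x) ≠ arc x)
      (w : ArcWalk arc deco glue (glue (arc x)) m y) : ArcWalk arc deco glue x (deco x * m) y

namespace ArcWalk

variable {X : Type} {d : ℕ} {arc : X → X} {deco : X → Deco d} {glue : X → X}

theorem last' {x y : X} {m : Deco d} (hy : arc x = y) (hm : deco x = m) (h : glue y = y) :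
    ArcWalk arc deco glue x m y := by
  subst hy hm; exact last x h

theorem step' {x y y' v : X} {m k : Deco d} (hy : arc x = y) (hg : glue y = y') (hne : y' ≠ y)
    (w : ArcWalk arc deco glue y' k v) (hm : deco x * k = m) :
    ArcWalk arc deco glue x m v := by
  subst hy hg hm; exact step x k v hne w

theorem det {x y y' : X} {m m' : Deco d} (w : ArcWalk arc deco glue x m y)
    (w' : ArcWalk arc deco glue x m' y') : m = m' ∧ y = y' := by
  induction w generalizing m' y' with
  | last x h =>
    cases w' with
    | last _ _ => exact ⟨rfl, rfl⟩
    | step _ _ _ h' _ => exact absurd h h'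
  | step x m y h w ih =>
    cases w' with
    | last _ h' => exact absurd h' h
    | step _ _ _ _ w' =>
      obtain ⟨h1, h2⟩ := ih w'
      exact ⟨by rw [h1], h2⟩

theorem end_boundary {x y : X} {m : Deco d} (w : ArcWalk arc deco glue x m y) : glue y = y := by
  induction w with
  | last x h => exact h
  | step x m y h w ih => exact ih

theorem reverse_aux (harc : ∀ x, arc (arc x) = x) (hglue : ∀ x, glue (glue x) = x)
    (hdeco : ∀ x, deco (arc x) = (deco x).rev)
    {x y : X} {m : Deco d} (w : ArcWalk arc deco glue x m y) :
    (glue x = x → ArcWalk arc deco glue y m.rev x) ∧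
    (glue x ≠ x → ∀ k v, ArcWalk arc deco glue (glue x) k v →
      ArcWalk arc deco glue y (m.rev * k) v) := by
  induction w with
  | last x h =>
    refine ⟨fun hx => last' (harc x) (hdeco x) hx, fun hx k v w => ?_⟩
    exact step' (harc x) rfl hx w (by rw [hdeco])
  | step x m y h w ih =>
    have key : ∀ k v, ArcWalk arc deco glue (arc x) k v →
        ArcWalk arc deco glue y (m.rev * k) v := by
      intro k v w'
      refine ih.2 ?_ k v ?_
      · rw [hglue]; exact fun e => h e.symm
      · rw [hglue]; exact w'
    refine ⟨fun hx => ?_, fun hx k v w' => ?_⟩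
    · rw [Deco.rev_mul]
      exact key _ _ (last' (harc x) (hdeco x) hx)
    · rw [Deco.rev_mul, mul_assoc]
      exact key _ _ (step' (harc x) rfl hx w' (by rw [hdeco]))

theorem reverse (harc : ∀ x, arc (arc x) = x) (hglue : ∀ x, glue (glue x) = x)
    (hdeco : ∀ x, deco (arc x) = (deco x).rev)
    {x y : X} {m : Deco d} (w : ArcWalk arc deco glue x m y) (hx : glue x = x) :
    ArcWalk arc deco glue y m.rev x :=
  (reverse_aux harc hglue hdeco w).1 hx

theorem exists_of_iterate (hglue : ∀ x, glue (glue x) = x) (k : ℕ) :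
    ∀ x : X, glue ((fun v => glue (arc v))^[k + 1] x) = (fun v => glue (arc v))^[k + 1] x →
      ∃ m y, ArcWalk arc deco glue x m y := by
  induction k with
  | zero =>
    intro x hx
    refine ⟨_, _, last x ?_⟩
    simpa [hglue, eq_comm] using hx
  | succ k ih =>
    intro x hx
    by_cases h : glue (arc x) = arc x
    · exact ⟨_, _, last x h⟩
    · obtain ⟨m, y, w⟩ := ih (glue (arc x)) hx
      exact ⟨_, _, step x m y h w⟩

theorem exists_walk [Finite X] (harc : ∀ x, arc (arc x) = x) (hglue : ∀ x, glue (glue x) = x)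
    (x : X) (hx : glue x = x) : ∃ m y, ArcWalk arc deco glue x m y := by
  have hinj : Function.Injective (fun v => glue (arc v)) := by
    intro a b h
    have h' := congrArg glue h
    simp only [hglue] at h'
    rw [← harc a, h', harc]
  obtain ⟨k, hk, hp⟩ := (hinj.mem_periodicPts x)
  obtain ⟨k, rfl⟩ := Nat.exists_eq_succ_of_ne_zero (Nat.pos_iff_ne_zero.mp hk)
  refine exists_of_iterate hglue k x ?_
  have hp' : (fun v => glue (arc v))^[k + 1] x = x := hp
  rw [hp', hx]

/-- Transport of walks from a stack in which some neighbouring boxes have been merged. -/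
theorem expand {Y : Type} {arc' : Y → Y} {deco' : Y → Deco d} {glue' : Y → Y} (f : X → Y)
    (hf : ∀ x, f (glue x) = glue' (f x)) (finj : Function.Injective f)
    (h1 : ∀ x, glue' (f (arc x)) = f (arc x) →
      ArcWalk arc' deco' glue' (f x) (deco x) (f (arc x)))
    (h2 : ∀ x, glue' (f (arc x)) ≠ f (arc x) → ∀ m y,
      ArcWalk arc' deco' glue' (glue' (f (arc x))) m y →
      ArcWalk arc' deco' glue' (f x) (deco x * m) y)
    {x y : X} {m : Deco d} (w : ArcWalk arc deco glue x m y) :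
    ArcWalk arc' deco' glue' (f x) m (f y) := by
  induction w with
  | last x h => exact h1 x (by rw [← hf, h])
  | step x m y h w ih =>
    refine h2 x ?_ m (f y) ?_
    · rw [← hf]; exact fun e => h (finj e)
    · rw [← hf]; exact ih

/-- Transport of walks from a part of a stack to the whole stack. -/
theorem embed {Y : Type} {arc' : Y → Y} {deco' : Y → Deco d} {glue' : Y → Y} (f : X → Y)
    (hf : ∀ x, glue x ≠ x → f (glue x) = glue' (f x)) (finj : Function.Injective f)
    (harc : ∀ x, arc' (f x) = f (arc x)) (hdeco : ∀ x, deco' (f x) = deco x)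
    {x y : X} {m : Deco d} (w : ArcWalk arc deco glue x m y) :
    (glue' (f y) = f y → ArcWalk arc' deco' glue' (f x) m (f y)) ∧
    (glue' (f y) ≠ f y → ∀ k v, ArcWalk arc' deco' glue' (glue' (f y)) k v →
      ArcWalk arc' deco' glue' (f x) (m * k) v) := by
  induction w with
  | last x h =>
    exact ⟨fun hy => last' (harc x) (hdeco x) hy,
      fun hy k v w => step' (harc x) rfl hy w (by rw [hdeco])⟩
  | step x m y h w ih =>
    have hne : f (glue (arc x)) ≠ f (arc x) := fun e => h (finj e)
    refine ⟨fun hy => ?_, fun hy k v w' => ?_⟩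
    · exact step' (harc x) (hf _ h).symm hne (ih.1 hy) (by rw [hdeco])
    · exact step' (harc x) (hf _ h).symm hne (ih.2 hy k v w') (by rw [hdeco, mul_assoc])

/-- The boundary points met by the curve that ends at `e`. -/
def Meets (arc : X → X) (deco : X → Deco d) (glue : X → X) (e : X) (x : X) : Prop :=
  (∃ m, ArcWalk arc deco glue x m e) ∨ ∃ m, ArcWalk arc deco glue (arc x) m e

theorem meets_arc (harc : ∀ x, arc (arc x) = x) (e x : X) :
    Meets arc deco glue e (arc x) ↔ Meets arc deco glue e x := by
  unfold Meets
  rw [harc]; exact or_comm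

theorem meets_glue_of (harc : ∀ x, arc (arc x) = x) (hglue : ∀ x, glue (glue x) = x) (e x : X)
    (h : Meets arc deco glue e x) : Meets arc deco glue e (glue x) := by
  by_cases hx : glue x = x
  · rwa [hx]
  rcases h with ⟨m, w⟩ | ⟨m, w⟩
  · refine Or.inr ⟨_, step' (harc _) (hglue x) (Ne.symm hx) w rfl⟩
  · left
    cases w with
    | last _ h' => rw [harc] at h'; exact absurd h' hx
    | step _ k _ h' w' => rw [harc] at w'; exact ⟨_, w'⟩

theorem meets_glue (harc : ∀ x, arc (arc x) = x) (hglue : ∀ x, glue (glue x) = x) (e x : X) :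
    Meets arc deco glue e (glue x) ↔ Meets arc deco glue e x := by
  refine ⟨fun h => ?_, meets_glue_of harc hglue e x⟩
  have := meets_glue_of harc hglue e _ h
  rwa [hglue] at this

theorem meets_boundary (harc : ∀ x, arc (arc x) = x) (hglue : ∀ x, glue (glue x) = x)
    (hdeco : ∀ x, deco (arc x) = (deco x).rev) {s e : X} {m : Deco d}
    (w : ArcWalk arc deco glue s m e) (hs : glue s = s) (x : X) (hx : glue x = x) :
    Meets arc deco glue e x ↔ x = s ∨ x = e := by
  constructor
  · rintro (⟨k, w'⟩ | ⟨k, w'⟩)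
    · left
      exact (det (reverse harc hglue hdeco w' hx) (reverse harc hglue hdeco w hs)).2
    · right
      cases w' with
      | last _ _ => rw [harc]
      | step _ _ _ h' _ => rw [harc] at h'; exact absurd hx h'
  · rintro (rfl | rfl)
    · exact Or.inl ⟨m, w⟩
    · exact Or.inr ⟨_, last' (harc x) rfl hx⟩

theorem end_ne [Finite X] (harc : ∀ x, arc (arc x) = x) (hne : ∀ x, arc x ≠ x)
    (hglue : ∀ x, glue (glue x) = x) (hdeco : ∀ x, deco (arc x) = (deco x).rev) {s e : X}
    {m : Deco d} (w : ArcWalk arc deco glue s m e) (hs : glue s = s) : e ≠ s := by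
  classical
  rintro rfl
  have := Fintype.ofFinite X
  let W := Finset.univ.filter (Meets arc deco glue e)
  have hW : ∀ x, x ∈ W ↔ Meets arc deco glue e x := fun x => by simp [W]
  have h1 : ∑ x ∈ W, (1 : ZMod 2) = 0 := by
    refine Finset.sum_involution (fun x _ => arc x) (fun _ _ => by decide)
      (fun x _ _ => hne x) (fun x hx => ?_) (fun x _ => harc x)
    rw [hW] at hx ⊢; exact (meets_arc harc e x).2 hx
  have h2 : ∑ x ∈ W.filter (fun x => ¬ glue x = x), (1 : ZMod 2) = 0 := by
    refine Finset.sum_involution (fun x _ => glue x) (fun _ _ => by decide)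
      (fun x hx _ => (Finset.mem_filter.1 hx).2) (fun x hx => ?_) (fun x _ => hglue x)
    rw [Finset.mem_filter, hW] at hx ⊢
    refine ⟨(meets_glue harc hglue e x).2 hx.1, ?_⟩
    rw [hglue]; exact fun h => hx.2 h.symm
  have h3 : W.filter (fun x => glue x = x) = {e} := by
    ext x
    rw [Finset.mem_filter, hW, Finset.mem_singleton]
    constructor
    · rintro ⟨hx, hb⟩
      simpa using (meets_boundary harc hglue hdeco w hs x hb).1 hx
    · rintro rfl
      exact ⟨(meets_boundary harc hglue hdeco w hs x hs).2 (Or.inl rfl), hs⟩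
  rw [← Finset.sum_filter_add_sum_filter_not W (fun x => glue x = x), h2, h3] at h1
  simp at h1

/-- An arc-wise and glue-wise constant function is constant along a curve that avoids `W`. -/
theorem invariant {W : X → Prop} {f : X → ZMod 2}
    (hWa : ∀ x, W (arc x) ↔ W x) (hWg : ∀ x, W (glue x) ↔ W x)
    (hfa : ∀ x, ¬ W x → f (arc x) = f x) (hfg : ∀ x, f (glue x) = f x)
    (hfb : ∀ x, ¬ W x → (deco x).HasBlob → f x = 0)
    {x y : X} {m : Deco d} (w : ArcWalk arc deco glue x m y) (hx : ¬ W x) :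
    f y = f x ∧ (m.HasBlob → f x = 0) := by
  induction w with
  | last x h => exact ⟨hfa x hx, hfb x hx⟩
  | step x m y h w ih =>
    obtain ⟨h1, h2⟩ := ih (by rwa [hWg, hWa])
    rw [hfg, hfa x hx] at h1 h2
    refine ⟨h1, fun hb => ?_⟩
    rcases Deco.hasBlob_mul hb with hb | hb
    · exact hfb x hx hb
    · exact h2 hb

end ArcWalk

/-! ### Concatenation of diagrams -/

namespace AbacusDiagram

variable {d n : ℕ}

/-- Gluing of two boxes, the upper one `false` and the lower one `true`. -/
def glueTwo : Bool × BPt n → Bool × BPt n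
  | (false, .inr i) => (true, .inl i)
  | (true, .inl i) => (false, .inr i)
  | (false, .inl i) => (false, .inl i)
  | (true, .inr i) => (true, .inr i)

/-- The boundary points of the stack of two boxes. -/
def outTwo : BPt n → Bool × BPt n
  | .inl i => (false, .inl i)
  | .inr i => (true, .inr i)

/-- The arcs in a family of boxes. -/
def arcs {ι : Type} (D : ι → AbacusDiagram d n) (x : ι × BPt n) : ι × BPt n :=
  (x.1, (D x.1).arc x.2)

/-- The decorations in a family of boxes. -/
def decos {ι : Type} (D : ι → AbacusDiagram d n) (x : ι × BPt n) : Deco d := (D x.1).deco x.2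

/-- `D` on top of `E`. -/
def pair (D E : AbacusDiagram d n) : Bool → AbacusDiagram d n
  | false => D
  | true => E

/-- With `D` stacked on top of `E`, the curve from the boundary point `p` of the stack ends at the
boundary point `q` of the stack and carries the decoration `m`. -/
def Curve (D E : AbacusDiagram d n) (p : BPt n) (m : Deco d) (q : BPt n) : Prop :=
  ArcWalk (arcs (pair D E)) (decos (pair D E)) glueTwo (outTwo p) m (outTwo q)

theorem glueTwo_glueTwo (x : Bool × BPt n) : glueTwo (glueTwo x) = x := by
  rcases x with ⟨_ | _, _ | _⟩ <;> rfl

theorem glueTwo_outTwo (p : BPt n) : glueTwo (outTwo p) = outTwo p := by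
  rcases p with _ | _ <;> rfl

theorem outTwo_injective : Function.Injective (outTwo (n := n)) := by
  rintro (i | i) (j | j) h <;> simp_all [outTwo]

theorem exists_outTwo (x : Bool × BPt n) (h : glueTwo x = x) : ∃ p, outTwo p = x := by
  rcases x with ⟨_ | _, i | i⟩
  · exact ⟨.inl i, rfl⟩
  · simp [glueTwo] at h
  · simp [glueTwo] at h
  · exact ⟨.inr i, rfl⟩

theorem arcs_arcs {ι : Type} (D : ι → AbacusDiagram d n) (x : ι × BPt n) :
    arcs D (arcs D x) = x := by
  simp [arcs, (D x.1).arc_arc]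

theorem decos_arcs {ι : Type} (D : ι → AbacusDiagram d n) (x : ι × BPt n) :
    decos D (arcs D x) = (decos D x).rev := by
  simp [arcs, decos, (D x.1).deco_arc]

theorem exists_curve (D E : AbacusDiagram d n) (p : BPt n) : ∃ r : Deco d × BPt n,
    Curve D E p r.1 r.2 := by
  obtain ⟨m, y, w⟩ := ArcWalk.exists_walk (deco := decos (pair D E)) (arcs_arcs (pair D E))
    glueTwo_glueTwo (outTwo p) (glueTwo_outTwo p)
  obtain ⟨q, rfl⟩ := exists_outTwo y w.end_boundary
  exact ⟨(m, q), w⟩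

theorem Curve.det {D E : AbacusDiagram d n} {p q q' : BPt n} {m m' : Deco d}
    (h : Curve D E p m q) (h' : Curve D E p m' q') : m = m' ∧ q = q' := by
  obtain ⟨h1, h2⟩ := ArcWalk.det h h'
  exact ⟨h1, outTwo_injective h2⟩

theorem Curve.symm {D E : AbacusDiagram d n} {p q : BPt n} {m : Deco d}
    (h : Curve D E p m q) : Curve D E q m.rev p :=
  ArcWalk.reverse (arcs_arcs _) glueTwo_glueTwo (decos_arcs _) h (glueTwo_outTwo p)

/-- `1` if `q` lies on the same horizontal line as `p` and to the left of `p`, and `0` otherwise. -/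
def leftOf : BPt n → BPt n → ZMod 2
  | .inl j, .inl i => if j < i then 1 else 0
  | .inr j, .inr i => if j < i then 1 else 0
  | _, _ => 0

theorem leftOf_eq (q p : BPt n) (h : q ≠ p) : leftOf q p =
    if p.isLeft then (if q.pos < p.pos then 1 else 0) else (if p.pos < q.pos then 1 else 0) := by
  rcases p with i | i <;> rcases q with j | j
  · simp [leftOf, BPt.pos_inl]
  · have hl : ¬ BPt.pos (.inr j : BPt n) < BPt.pos (.inl i : BPt n) := by
      simp only [BPt.pos_inl, BPt.pos_inr]; omega
    simp [leftOf, hl]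
  · have hl : ¬ BPt.pos (.inr i : BPt n) < BPt.pos (.inl j : BPt n) := by
      simp only [BPt.pos_inl, BPt.pos_inr]; omega
    simp [leftOf, hl]
  · have hl : BPt.pos (.inr i : BPt n) < BPt.pos (.inr j : BPt n) ↔ j < i := by
      simp only [BPt.pos_inr, Fin.lt_def]; omega
    simp [leftOf, hl]

/-- The number modulo `2` of ends of `{q, q'}` that precede `p` on the boundary. -/
theorem leftOf_add (p q q' : BPt n) (h : q ≠ p) (h' : q' ≠ p) :
    leftOf q p + leftOf q' p =
      (if q.pos < p.pos then 1 else 0) + (if q'.pos < p.pos then 1 else 0) := by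
  have e : q.pos ≠ p.pos := fun e => h (BPt.pos_injective e)
  have e' : q'.pos ≠ p.pos := fun e => h' (BPt.pos_injective e)
  rw [leftOf_eq q p h, leftOf_eq q' p h']
  cases p.isLeft
  · simp only [Bool.false_eq_true, if_false]
    rcases lt_or_gt_of_ne e with a | a <;> rcases lt_or_gt_of_ne e' with b | b <;>
      simp [a, b, a.not_gt, b.not_gt] <;> decide
  · simp only [if_true]

/-- `{p, p'}` and `{q, q'}` do not interlace. -/
def Unlinked (p p' q q' : BPt n) : Prop :=
  leftOf q p + leftOf q' p = leftOf q p' + leftOf q' p'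

theorem arc_ne_of_ne (D : AbacusDiagram d n) {p q : BPt n} (h : q ≠ p) : D.arc q ≠ D.arc p :=
  fun e => h (by rw [← D.arc_arc q, e, D.arc_arc])

theorem unlinked (D : AbacusDiagram d n) (p q : BPt n) (h : q ≠ p) (h' : q ≠ D.arc p) :
    Unlinked p (D.arc p) q (D.arc q) := by
  have h2 : D.arc q ≠ p := fun e => h' (by rw [← e, D.arc_arc])
  have h3 : D.arc q ≠ D.arc p := D.arc_ne_of_ne h
  have e1 : q.pos ≠ p.pos := fun e => h (BPt.pos_injective e)
  have e2 : q.pos ≠ (D.arc p).pos := fun e => h' (BPt.pos_injective e)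
  have e3 : (D.arc q).pos ≠ p.pos := fun e => h2 (BPt.pos_injective e)
  have e4 : (D.arc q).pos ≠ (D.arc p).pos := fun e => h3 (BPt.pos_injective e)
  unfold Unlinked
  rw [leftOf_add _ _ _ h h2, leftOf_add _ _ _ h' h3]
  have n1 := D.noncrossing p q
  have n2 := D.noncrossing p (D.arc q)
  have n3 := D.noncrossing (D.arc p) q
  have n4 := D.noncrossing (D.arc p) (D.arc q)
  have n5 := D.noncrossing q p
  have n6 := D.noncrossing q (D.arc p)
  have n7 := D.noncrossing (D.arc q) p
  have n8 := D.noncrossing (D.arc q) (D.arc p)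
  simp only [D.arc_arc] at n1 n2 n3 n4 n5 n6 n7 n8
  split_ifs <;> first | rfl | decide | (exfalso; omega)

theorem unlinked_blob (D : AbacusDiagram d n) (p q : BPt n) (h : q ≠ p) (h' : q ≠ D.arc p)
    (hb : (D.deco p).HasBlob) : leftOf q p + leftOf (D.arc q) p = 0 := by
  have h2 : D.arc q ≠ p := fun e => h' (by rw [← e, D.arc_arc])
  have h3 : D.arc q ≠ D.arc p := D.arc_ne_of_ne h
  have hu := D.unlinked p q h h'
  unfold Unlinked at hu
  have e1 : q.pos ≠ p.pos := fun e => h (BPt.pos_injective e)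
  have e2 : q.pos ≠ (D.arc p).pos := fun e => h' (BPt.pos_injective e)
  have e3 : (D.arc q).pos ≠ p.pos := fun e => h2 (BPt.pos_injective e)
  have e4 : (D.arc q).pos ≠ (D.arc p).pos := fun e => h3 (BPt.pos_injective e)
  have n1 := D.exposed p hb q
  have n2 := D.exposed p hb (D.arc q)
  rw [D.arc_arc] at n2
  rw [leftOf_add _ _ _ h h2, leftOf_add _ _ _ h' h3] at hu
  rw [leftOf_add _ _ _ h h2]
  split_ifs at hu ⊢ <;> first | rfl | decide | (exfalso; omega) | (exfalso; revert hu; decide)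

open scoped Classical in
/-- The number modulo `2` of points of `W` to the left of `p` on its horizontal line. -/
noncomputable def leftCount (W : BPt n → Prop) (p : BPt n) : ZMod 2 :=
  ∑ q ∈ Finset.univ.filter W, leftOf q p

theorem leftCount_arc (D : AbacusDiagram d n) (W : BPt n → Prop) (hW : ∀ q, W (D.arc q) ↔ W q)
    (p : BPt n) (hp : ¬ W p) : leftCount W (D.arc p) = leftCount W p := by
  classical
  rw [← sub_eq_zero, leftCount, leftCount, ← Finset.sum_sub_distrib]
  refine Finset.sum_involution (fun q _ => D.arc q) ?_ ?_ ?_ ?_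
  · intro q hq
    have hq' : W q := by simpa using hq
    have h1 : q ≠ p := fun e => hp (e ▸ hq')
    have h2 : q ≠ D.arc p := fun e => hp ((hW p).1 (e ▸ hq'))
    have hu := D.unlinked p q h1 h2
    unfold Unlinked at hu
    linear_combination -hu
  · intro q _ _; exact D.arc_ne q
  · intro q hq
    simpa [hW] using hq
  · intro q _; exact D.arc_arc q

theorem leftCount_blob (D : AbacusDiagram d n) (W : BPt n → Prop) (hW : ∀ q, W (D.arc q) ↔ W q)
    (p : BPt n) (hp : ¬ W p) (hb : (D.deco p).HasBlob) : leftCount W p = 0 := by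
  classical
  rw [leftCount]
  refine Finset.sum_involution (fun q _ => D.arc q) ?_ ?_ ?_ ?_
  · intro q hq
    have hq' : W q := by simpa using hq
    have h1 : q ≠ p := fun e => hp (e ▸ hq')
    have h2 : q ≠ D.arc p := fun e => hp ((hW p).1 (e ▸ hq'))
    exact D.unlinked_blob p q h1 h2 hb
  · intro q _ _; exact D.arc_ne q
  · intro q hq
    simpa [hW] using hq
  · intro q _; exact D.arc_arc q

theorem leftCount_pair (q q' p : BPt n) (h : q ≠ q') :
    leftCount (fun r => r = q ∨ r = q') p = leftOf q p + leftOf q' p := by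
  classical
  have hs : (Finset.univ.filter fun r => r = q ∨ r = q') = ({q, q'} : Finset (BPt n)) := by
    ext; simp
  rw [← Finset.sum_pair (f := fun r => leftOf r p) h, ← hs, leftCount]
  congr!

open scoped Classical in
theorem leftCount_inl (W : BPt n → Prop) (i : Fin n) :
    leftCount W (.inl i) = ∑ j : Fin n, if W (.inl j) then leftOf (.inl j) (.inl i) else 0 := by
  rw [leftCount, Finset.sum_filter, Fintype.sum_sum_type]
  simp only [leftOf, ite_self, Finset.sum_const_zero, add_zero]

open scoped Classical in
theorem leftCount_inr (W : BPt n → Prop) (i : Fin n) :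
    leftCount W (.inr i) = ∑ j : Fin n, if W (.inr j) then leftOf (.inr j) (.inr i) else 0 := by
  rw [leftCount, Finset.sum_filter, Fintype.sum_sum_type]
  simp only [leftOf, ite_self, Finset.sum_const_zero, zero_add]

theorem leftCount_congr_inl {W W' : BPt n → Prop} (h : ∀ j, W (.inl j) ↔ W' (.inl j))
    (i : Fin n) : leftCount W (.inl i) = leftCount W' (.inl i) := by
  classical
  rw [leftCount_inl, leftCount_inl]; simp only [h]

theorem leftCount_congr_inr {W W' : BPt n → Prop} (h : ∀ j, W (.inr j) ↔ W' (.inr j))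
    (i : Fin n) : leftCount W (.inr i) = leftCount W' (.inr i) := by
  classical
  rw [leftCount_inr, leftCount_inr]; simp only [h]

theorem leftCount_congr_inl_inr {W W' : BPt n → Prop} (h : ∀ j, W (.inl j) ↔ W' (.inr j))
    (i : Fin n) : leftCount W (.inl i) = leftCount W' (.inr i) := by
  classical
  rw [leftCount_inl, leftCount_inr]; simp only [h]; rfl

theorem Curve.unlinked {D E : AbacusDiagram d n} {p p' q q' : BPt n} {m k : Deco d}
    (hp : Curve D E p m p') (hq : Curve D E q k q') (hqq : q ≠ q') (h : p ≠ q) (h' : p ≠ q') :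
    Unlinked p p' q q' ∧ (m.HasBlob → leftOf q p + leftOf q' p = 0) := by
  set B := pair D E with hB
  let W : Bool × BPt n → Prop := ArcWalk.Meets (arcs B) (decos B) glueTwo (outTwo q')
  have hWa : ∀ x, W (arcs B x) ↔ W x := ArcWalk.meets_arc (arcs_arcs B) _
  have hWg : ∀ x, W (glueTwo x) ↔ W x := ArcWalk.meets_glue (arcs_arcs B) glueTwo_glueTwo _
  have hWo : ∀ r, W (outTwo r) ↔ r = q ∨ r = q' := by
    intro r
    refine (ArcWalk.meets_boundary (arcs_arcs B) glueTwo_glueTwo (decos_arcs B) hq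
      (glueTwo_outTwo q) (outTwo r) (glueTwo_outTwo r)).trans ?_
    rw [outTwo_injective.eq_iff, outTwo_injective.eq_iff]
  let f : Bool × BPt n → ZMod 2 := fun x => leftCount (fun r => W (x.1, r)) x.2
  have hfo : ∀ r, f (outTwo r) = leftOf q r + leftOf q' r := by
    intro r
    rw [← leftCount_pair q q' r hqq]
    rcases r with i | i
    · exact leftCount_congr_inl (fun j => hWo (.inl j)) i
    · exact leftCount_congr_inr (fun j => hWo (.inr j)) i
  have key := ArcWalk.invariant (W := W) (f := f) hWa hWg
    (fun x hx => leftCount_arc (B x.1) (fun r => W (x.1, r)) (fun r => hWa (x.1, r)) x.2 hx)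
    (by
      rintro ⟨_ | _, i | i⟩
      · rfl
      · exact leftCount_congr_inl_inr (fun j => hWg (false, .inr j)) i
      · exact (leftCount_congr_inl_inr (fun j => (hWg (true, .inl j)).symm) i).symm
      · rfl)
    (fun x hx hb => leftCount_blob (B x.1) (fun r => W (x.1, r)) (fun r => hWa (x.1, r)) x.2 hx hb)
    hp (by rw [hWo]; tauto)
  rw [hfo, hfo] at key
  exact ⟨key.1.symm, key.2⟩

theorem Curve.ne {D E : AbacusDiagram d n} {p q : BPt n} {m : Deco d} (h : Curve D E p m q) :
    q ≠ p := by
  rintro rfl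
  refine ArcWalk.end_ne (arcs_arcs (pair D E)) ?_ glueTwo_glueTwo (decos_arcs (pair D E)) h
    (glueTwo_outTwo q) rfl
  intro x hx
  exact (pair D E x.1).arc_ne x.2 (congrArg Prod.snd hx)

theorem Curve.noncrossing {D E : AbacusDiagram d n} {p p' q q' : BPt n} {m k : Deco d}
    (hp : Curve D E p m p') (hq : Curve D E q k q') :
    ¬ (p.pos < q.pos ∧ q.pos < p'.pos ∧ p'.pos < q'.pos) := by
  rintro ⟨h1, h2, h3⟩
  have npq : q ≠ p := by rintro rfl; omega
  have npq' : q' ≠ p := by rintro rfl; omega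
  have np'q : q ≠ p' := by rintro rfl; omega
  have np'q' : q' ≠ p' := by rintro rfl; omega
  have hu := (hp.unlinked hq hq.ne.symm npq.symm npq'.symm).1
  unfold Unlinked at hu
  rw [leftOf_add _ _ _ npq npq', leftOf_add _ _ _ np'q np'q', if_neg (by omega), if_neg (by omega),
    if_pos (by omega), if_neg (by omega)] at hu
  revert hu; decide

theorem Curve.exposed {D E : AbacusDiagram d n} {p p' q q' : BPt n} {m k : Deco d}
    (hp : Curve D E p m p') (hq : Curve D E q k q') (hb : m.HasBlob) :
    ¬ (q.pos < p.pos ∧ q.pos < p'.pos ∧ p.pos < q'.pos ∧ p'.pos < q'.pos) := by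
  rintro ⟨h1, h2, h3, h4⟩
  have npq : q ≠ p := by rintro rfl; omega
  have npq' : q' ≠ p := by rintro rfl; omega
  have hu := (hp.unlinked hq hq.ne.symm npq.symm npq'.symm).2 hb
  rw [leftOf_add _ _ _ npq npq', if_pos (by omega), if_neg (by omega)] at hu
  revert hu; decide

/-- The product `D E` of abacus blob diagrams: `D` is placed on top of `E`, the bottom points of `D`
are glued to the top points of `E`, the decorations along each curve of the result are multiplied,
and loops are dropped. -/
noncomputable instance : Mul (AbacusDiagram d n) where
  mul D E :=
    have spec : ∀ p, Curve D E p (exists_curve D E p).choose.1 (exists_curve D E p).choose.2 :=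
      fun p => (exists_curve D E p).choose_spec
    { arc := fun p => (exists_curve D E p).choose.2
      deco := fun p => (exists_curve D E p).choose.1
      arc_arc := fun p => ((spec _).det (spec p).symm).2
      arc_ne := fun p => (spec p).ne
      deco_arc := fun p => ((spec _).det (spec p).symm).1
      noncrossing := fun p q => (spec p).noncrossing (spec q)
      exposed := fun p hb q => (spec p).exposed (spec q) hb }

theorem mul_curve (D E : AbacusDiagram d n) (p : BPt n) :
    Curve D E p ((D * E).deco p) ((D * E).arc p) :=
  (exists_curve D E p).choose_spec

/-- The identity diagram: `n` vertical arcs without blobs and beads. -/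
instance : One (AbacusDiagram d n) where
  one :=
    { arc := Sum.swap
      deco := fun _ => 1
      arc_arc := Sum.swap_swap
      arc_ne := by rintro (i | i) h <;> simp at h
      deco_arc := fun _ => Deco.rev_one.symm
      noncrossing := by
        rintro (i | i) (j | j) <;> simp only [Sum.swap_inl, Sum.swap_inr, BPt.pos_inl, BPt.pos_inr] <;> omega
      exposed := fun _ h => absurd h Deco.hasBlob_one }

theorem one_arc_inl (i : Fin n) : (1 : AbacusDiagram d n).arc (.inl i) = .inr i := rfl
theorem one_arc_inr (i : Fin n) : (1 : AbacusDiagram d n).arc (.inr i) = .inl i := rfl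
theorem one_deco (p : BPt n) : (1 : AbacusDiagram d n).deco p = 1 := rfl

theorem mul_eq_of_curve {D E F : AbacusDiagram d n}
    (h : ∀ p, Curve D E p (F.deco p) (F.arc p)) : D * E = F := by
  ext p : 2
  · exact ((mul_curve D E p).det (h p)).2
  · exact ((mul_curve D E p).det (h p)).1

theorem mul_one' (D : AbacusDiagram d n) : D * 1 = D := by
  refine mul_eq_of_curve fun p => ?_
  have main : ∀ p, ArcWalk (arcs (pair D 1)) (decos (pair D 1)) glueTwo (false, p)
      (D.deco p) (outTwo (D.arc p)) := by
    intro p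
    rcases h : D.arc p with j | j
    · exact ArcWalk.last' (by simp [arcs, pair, h, outTwo]) (by simp [decos, pair]) rfl
    · refine ArcWalk.step' (y := (false, .inr j)) (y' := (true, .inl j)) (k := 1)
        (by simp [arcs, pair, h]) rfl (by simp) ?_ (by simp [decos, pair])
      exact ArcWalk.last' (by simp [arcs, pair, one_arc_inl, outTwo])
        (by simp [decos, pair, one_deco]) rfl
  rcases p with i | i
  · exact main _
  · exact ArcWalk.step' (y := (true, .inl i)) (y' := (false, .inr i)) (k := D.deco (.inr i))
      (by simp [arcs, pair, outTwo, one_arc_inr]) rfl (by simp) (main _)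
      (by simp [decos, pair, outTwo, one_deco])

theorem one_mul' (D : AbacusDiagram d n) : 1 * D = D := by
  refine mul_eq_of_curve fun p => ?_
  have main : ∀ p, ArcWalk (arcs (pair 1 D)) (decos (pair 1 D)) glueTwo (true, p)
      (D.deco p) (outTwo (D.arc p)) := by
    intro p
    rcases h : D.arc p with j | j
    · refine ArcWalk.step' (y := (true, .inl j)) (y' := (false, .inr j)) (k := 1)
        (by simp [arcs, pair, h]) rfl (by simp) ?_ (by simp [decos, pair])
      exact ArcWalk.last' (by simp [arcs, pair, one_arc_inr, outTwo])
        (by simp [decos, pair, one_deco]) rfl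
    · exact ArcWalk.last' (by simp [arcs, pair, h, outTwo]) (by simp [decos, pair]) rfl
  rcases p with i | i
  · exact ArcWalk.step' (y := (false, .inr i)) (y' := (true, .inl i)) (k := D.deco (.inl i))
      (by simp [arcs, pair, outTwo, one_arc_inl]) rfl (by simp) (main _)
      (by simp [decos, pair, outTwo, one_deco])
  · exact main _

/-- Gluing of three boxes, numbered from top to bottom. -/
def glueThree : Fin 3 × BPt n → Fin 3 × BPt n
  | (0, .inl i) => (0, .inl i)
  | (0, .inr i) => (1, .inl i)
  | (1, .inl i) => (0, .inr i)
  | (1, .inr i) => (2, .inl i)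
  | (2, .inl i) => (1, .inr i)
  | (2, .inr i) => (2, .inr i)

/-- The two upper ones of three boxes. -/
def upper : Bool × BPt n → Fin 3 × BPt n
  | (false, p) => (0, p)
  | (true, p) => (1, p)

/-- The two lower ones of three boxes. -/
def lower : Bool × BPt n → Fin 3 × BPt n
  | (false, p) => (1, p)
  | (true, p) => (2, p)

/-- Of three boxes, the two upper ones are merged. -/
def mergeUpper : Bool × BPt n → Fin 3 × BPt n
  | (false, p) => upper (outTwo p)
  | (true, p) => (2, p)

/-- Of three boxes, the two lower ones are merged. -/
def mergeLower : Bool × BPt n → Fin 3 × BPt n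
  | (false, p) => (0, p)
  | (true, p) => lower (outTwo p)

theorem upper_injective : Function.Injective (upper (n := n)) := by
  rintro ⟨_ | _, i | i⟩ ⟨_ | _, j | j⟩ h <;>
    first
    | (cases h; rfl)
    | (exfalso; simp [upper] at h)

theorem lower_injective : Function.Injective (lower (n := n)) := by
  rintro ⟨_ | _, i | i⟩ ⟨_ | _, j | j⟩ h <;>
    first
    | (cases h; rfl)
    | (exfalso; simp [lower] at h)

theorem mergeUpper_injective : Function.Injective (mergeUpper (n := n)) := by
  rintro ⟨_ | _, i | i⟩ ⟨_ | _, j | j⟩ h <;>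
    first
    | (cases h; rfl)
    | (exfalso; simp [upper, mergeUpper, outTwo] at h)

theorem mergeLower_injective : Function.Injective (mergeLower (n := n)) := by
  rintro ⟨_ | _, i | i⟩ ⟨_ | _, j | j⟩ h <;>
    first
    | (cases h; rfl)
    | (exfalso; simp [lower, mergeLower, outTwo] at h)

theorem mul_assoc' (D E F : AbacusDiagram d n) : D * E * F = D * (E * F) := by
  set B : Fin 3 → AbacusDiagram d n := ![D, E, F] with hB
  have up : ∀ {x y : Bool × BPt n} {m : Deco d},
      ArcWalk (arcs (pair D E)) (decos (pair D E)) glueTwo x m y →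
      (glueThree (upper y) = upper y →
        ArcWalk (arcs B) (decos B) glueThree (upper x) m (upper y)) ∧
      (glueThree (upper y) ≠ upper y → ∀ k v,
        ArcWalk (arcs B) (decos B) glueThree (glueThree (upper y)) k v →
        ArcWalk (arcs B) (decos B) glueThree (upper x) (m * k) v) := by
    intro x y m w
    refine ArcWalk.embed upper ?_ ?_ ?_ ?_ w
    · rintro ⟨_ | _, i | i⟩ h <;> first | rfl | exact absurd rfl h
    · exact upper_injective
    · rintro ⟨_ | _, p⟩ <;> rfl
    · rintro ⟨_ | _, p⟩ <;> rfl
  have low : ∀ {x y : Bool × BPt n} {m : Deco d},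
      ArcWalk (arcs (pair E F)) (decos (pair E F)) glueTwo x m y →
      (glueThree (lower y) = lower y →
        ArcWalk (arcs B) (decos B) glueThree (lower x) m (lower y)) ∧
      (glueThree (lower y) ≠ lower y → ∀ k v,
        ArcWalk (arcs B) (decos B) glueThree (glueThree (lower y)) k v →
        ArcWalk (arcs B) (decos B) glueThree (lower x) (m * k) v) := by
    intro x y m w
    refine ArcWalk.embed lower ?_ ?_ ?_ ?_ w
    · rintro ⟨_ | _, i | i⟩ h <;> first | rfl | exact absurd rfl h
    · exact lower_injective
    · rintro ⟨_ | _, p⟩ <;> rfl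
    · rintro ⟨_ | _, p⟩ <;> rfl
  have left : ∀ {x y : Bool × BPt n} {m : Deco d},
      ArcWalk (arcs (pair (D * E) F)) (decos (pair (D * E) F)) glueTwo x m y →
      ArcWalk (arcs B) (decos B) glueThree (mergeUpper x) m (mergeUpper y) := by
    intro x y m w
    refine ArcWalk.expand mergeUpper ?_ ?_ ?_ ?_ w
    · rintro ⟨_ | _, i | i⟩ <;> rfl
    · exact mergeUpper_injective
    · rintro ⟨_ | _, p⟩ h
      · exact (up (mul_curve D E p)).1 h
      · exact ArcWalk.last (2, p) h
    · rintro ⟨_ | _, p⟩ h k v w'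
      · exact (up (mul_curve D E p)).2 h k v w'
      · exact ArcWalk.step (2, p) k v h w'
  have right : ∀ {x y : Bool × BPt n} {m : Deco d},
      ArcWalk (arcs (pair D (E * F))) (decos (pair D (E * F))) glueTwo x m y →
      ArcWalk (arcs B) (decos B) glueThree (mergeLower x) m (mergeLower y) := by
    intro x y m w
    refine ArcWalk.expand mergeLower ?_ ?_ ?_ ?_ w
    · rintro ⟨_ | _, i | i⟩ <;> rfl
    · exact mergeLower_injective
    · rintro ⟨_ | _, p⟩ h
      · exact ArcWalk.last (0, p) h
      · exact (low (mul_curve E F p)).1 h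
    · rintro ⟨_ | _, p⟩ h k v w'
      · exact ArcWalk.step (0, p) k v h w'
      · exact (low (mul_curve E F p)).2 h k v w'
  have hout : ∀ p : BPt n, mergeUpper (outTwo p) = mergeLower (outTwo p) := by
    rintro (i | i) <;> rfl
  have inj : ∀ p q : BPt n, mergeLower (outTwo p) = mergeLower (outTwo q) → p = q :=
    fun p q h => outTwo_injective (mergeLower_injective h)
  have key : ∀ p, (D * E * F).deco p = (D * (E * F)).deco p ∧
      (D * E * F).arc p = (D * (E * F)).arc p := by
    intro p
    have h1 := left (mul_curve (D * E) F p)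
    have h2 := right (mul_curve D (E * F) p)
    rw [hout, hout] at h1
    obtain ⟨h3, h4⟩ := h1.det h2
    exact ⟨h3, inj _ _ h4⟩
  ext p : 2
  · exact (key p).2
  · exact (key p).1

/-- The abacus blob monoid: the set of all `d`-abacus blob diagrams on `n` points, with
concatenation as its product. -/
noncomputable instance : Monoid (AbacusDiagram d n) where
  mul_assoc := mul_assoc'
  one_mul := one_mul'
  mul_one := mul_one'

/-! ### The diagrams of the generators -/

/-- All arcs are vertical, the arc at the strand `j` carries the decoration `c j`, and only the
leftmost strand may carry a blob. -/
def strands (c : Fin n → Deco d) (hc : ∀ j, (c j).HasBlob → (j : ℕ) = 0) : AbacusDiagram d n where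
  arc := Sum.swap
  deco := Sum.elim c fun j => (c j).rev
  arc_arc := Sum.swap_swap
  arc_ne := by rintro (i | i) h <;> simp at h
  deco_arc := by
    rintro (i | i)
    · rfl
    · rcases h : c i <;> simp [h, Deco.rev]
  noncrossing := by
    rintro (i | i) (j | j) <;> simp only [Sum.swap_inl, Sum.swap_inr, BPt.pos_inl, BPt.pos_inr] <;> omega
  exposed := by
    have hr : ∀ x : Deco d, x.rev.HasBlob → x.HasBlob := by
      rintro (_ | _) h <;> exact h
    rintro (i | i) h (j | j)
    · have := hc i h; simp only [Sum.swap_inl, BPt.pos_inl, BPt.pos_inr]; omega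
    · have := hc i h; simp only [Sum.swap_inl, BPt.pos_inl, BPt.pos_inr]; omega
    · have := hc i (hr _ h); simp only [Sum.swap_inr, BPt.pos_inl, BPt.pos_inr]; omega
    · have := hc i (hr _ h); simp only [Sum.swap_inr, BPt.pos_inl, BPt.pos_inr]; omega

/-- The diagram `𝔷 i`, `1 ≤ i ≤ n`: vertical arcs, with a single bead, on the `i`-th strand from
the left. -/
def z (d : ℕ) {n : ℕ} (i : ℕ) (_h1 : 1 ≤ i) (_h2 : i ≤ n) : AbacusDiagram d n :=
  strands (fun j => if (j : ℕ) + 1 = i then .plain 1 else .plain 0) (by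
    intro j h
    split_ifs at h <;> exact h.elim)

/-- The diagram `𝔲 0`: vertical arcs without beads, with a blob on the first strand. -/
def uZero (d n : ℕ) : AbacusDiagram d n :=
  strands (fun j => if (j : ℕ) = 0 then .blob 0 0 else .plain 0) (by
    intro j h
    split_ifs at h with h'
    · exact h'
    · exact h.elim)

/-- The diagram `𝔲 i`, `1 ≤ i ≤ n - 1`: no blobs and beads, one arc joins the `i`-th and the
`(i + 1)`-st top point, one arc joins the `i`-th and the `(i + 1)`-st bottom point, the other arcs
are vertical. -/
def uSucc (d : ℕ) {n : ℕ} (i : ℕ) (h1 : 1 ≤ i) (h : i < n) : AbacusDiagram d n where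
  arc
    | .inl j => if (j : ℕ) + 1 = i then .inl ⟨i, h⟩
        else if (j : ℕ) = i then .inl ⟨i - 1, by omega⟩ else .inr j
    | .inr j => if (j : ℕ) + 1 = i then .inr ⟨i, h⟩
        else if (j : ℕ) = i then .inr ⟨i - 1, by omega⟩ else .inl j
  deco _ := .plain 0
  arc_arc := by
    have key : ∀ j : Fin n, (j : ℕ) + 1 = i → (⟨i - 1, by omega⟩ : Fin n) = j := by
      rintro ⟨j, hj⟩ e; ext; simp only at e ⊢; omega
    have key' : ∀ j : Fin n, (j : ℕ) = i → (⟨i, h⟩ : Fin n) = j := by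
      rintro ⟨j, hj⟩ e; ext; simp only at e ⊢; omega
    rintro (j | j) <;> dsimp only
    · by_cases ha : (j : ℕ) + 1 = i
      · simp [ha, key j ha]
      · by_cases hb : (j : ℕ) = i
        · simp [hb, Nat.sub_add_cancel h1, key' j hb]
        · simp [ha, hb]
    · by_cases ha : (j : ℕ) + 1 = i
      · simp [ha, key j ha]
      · by_cases hb : (j : ℕ) = i
        · simp [hb, Nat.sub_add_cancel h1, key' j hb]
        · simp [ha, hb]
  arc_ne := by
    rintro (j | j) <;> dsimp only <;> split_ifs <;>
      simp [Fin.ext_iff] <;> omega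
  deco_arc _ := rfl
  noncrossing := by
    rintro (j | j) (k | k) <;> dsimp only <;> split_ifs <;>
      simp only [BPt.pos_inl, BPt.pos_inr] <;> omega
  exposed := fun _ h => h.elim

/-- The diagram `𝔲 i`, `0 ≤ i ≤ n - 1`. -/
def u (d : ℕ) {n : ℕ} (i : ℕ) (h : i < n) : AbacusDiagram d n :=
  if h1 : 1 ≤ i then uSucc d i h1 h else uZero d n

end AbacusDiagram

/-!
The relations of the framed blob monoid hold for diagrams, which is checked with formulas for the
product of a diagram with vertical arcs (`mul_strands_arc`, `mul_strands_deco`) and with a generator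
`u i`, `i ≥ 1` (`mul_uSucc_arc`, `mul_uSucc_deco`). So there is a homomorphism `toDiagram`, and it
has to be bijective. Both halves are inductions on the number of strands, in which `Bl_{d,n}` is
compared with `Bl_{d,n+1}` by adding a vertical arc on the right (`succHom`, `addStrand`).

*Injectivity.* Write `desc k` for `u n ⋯ u (k + 1) u k` and `asc k` for its reverse (the length is
an argument of `desc` and `asc` below). Every element of `Bl_{d,n+1}` is a product
of an element of `Bl_{d,n}` and a tail, which is `desc k` with beads at its bottom arc, or `desc 0`
with beads on both sides of its blob (`exists_tail`): these products are closed under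
multiplication by generators from the right. The word `desc k` has a one-sided inverse up to `u n`,
namely `desc k * asc k = u n` (`desc_mul_asc`), and multiplication by `u n` on the right is
injective on diagrams with an added strand, since it only bends the end of the last of the other
strands to the top (`addStrand_mul_uSucc`). Hence if `x * desc l` and `y * desc k` have the same
diagram, then `x` can be expressed by `y` and vice versa: multiply by `asc l`, or by `asc k`, move
the words to the left of `u n`, and use the induction hypothesis. For `l = k` this gives `x = y`,
and for `l < k` it gives enough to transform one of the two products into the other one
(`succHom_mul_desc_eq`). The remaining configurations, and different beads on the tails, are
excluded by the arcs at the bottom points that the tails join (`toDiagram_cup`,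
`toDiagram_tail_blob`). Beads never
matter otherwise, because they are invertible.

*Surjectivity.* In a diagram on `n + 1` strands there is an arc without a blob that joins two
neighbours among the last `n + 2` boundary points, or the last two boundary points are joined
(`exists_adjacent`). If that arc is vertical, then it can be split off. Otherwise it lies at the
bottom, and the diagram equals `D * u k` up to decorations of that arc. Now
`D * u k = (D * asc k) * desc k`, and `D * asc k`, which ends with `u n`, is obtained from a diagram
on `n` strands by bending.
-/

namespace AbacusDiagram

variable {d n : ℕ}

/-! ### Products with elementary diagrams -/

/-- The decoration that `D * strands c hc` adds at the end `p` of an arc, read towards `p`. -/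
def belowDeco (c : Fin n → Deco d) : BPt n → Deco d
  | .inl _ => 1
  | .inr j => c j

theorem mul_strands_curve (D : AbacusDiagram d n) (c : Fin n → Deco d)
    (hc : ∀ j, (c j).HasBlob → (j : ℕ) = 0) (p : BPt n) :
    Curve D (strands c hc) p ((belowDeco c p).rev * D.deco p * belowDeco c (D.arc p))
      (D.arc p) := by
  have main : ∀ p, ArcWalk (arcs (pair D (strands c hc))) (decos (pair D (strands c hc))) glueTwo
      (false, p) (D.deco p * belowDeco c (D.arc p)) (outTwo (D.arc p)) := by
    intro p
    rcases h : D.arc p with j | j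
    · exact ArcWalk.last' (by simp [arcs, pair, h, outTwo]) (by simp [decos, pair, belowDeco]) rfl
    · refine ArcWalk.step' (y := (false, .inr j)) (y' := (true, .inl j)) (k := c j)
        (by simp [arcs, pair, h]) rfl (by simp) ?_ (by simp [decos, pair, belowDeco])
      exact ArcWalk.last' (by simp [arcs, pair, strands, outTwo])
        (by simp [decos, pair, strands]) rfl
  rcases p with i | i
  · rw [show (belowDeco c (.inl i)).rev = 1 from rfl, one_mul]
    exact main (.inl i)
  · exact ArcWalk.step' (y := (true, .inl i)) (y' := (false, .inr i))
      (by simp [arcs, pair, outTwo, strands]) rfl (by simp) (main _)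
      (by simp [decos, pair, outTwo, strands, belowDeco, mul_assoc])

theorem mul_strands_arc (D : AbacusDiagram d n) (c : Fin n → Deco d)
    (hc : ∀ j, (c j).HasBlob → (j : ℕ) = 0) (p : BPt n) :
    (D * strands c hc).arc p = D.arc p :=
  ((mul_curve _ _ p).det (mul_strands_curve D c hc p)).2

theorem mul_strands_deco (D : AbacusDiagram d n) (c : Fin n → Deco d)
    (hc : ∀ j, (c j).HasBlob → (j : ℕ) = 0) (p : BPt n) :
    (D * strands c hc).deco p = (belowDeco c p).rev * D.deco p * belowDeco c (D.arc p) :=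
  ((mul_curve _ _ p).det (mul_strands_curve D c hc p)).1

/-- The left one of the two bottom points joined in `uSucc d i h1 h`. -/
def botL {i : ℕ} (h : i < n) : BPt n := .inr ⟨i - 1, by omega⟩

/-- The right one of the two bottom points joined in `uSucc d i h1 h`. -/
def botR {i : ℕ} (h : i < n) : BPt n := .inr ⟨i, h⟩

theorem inr_eq_botL {i : ℕ} (h1 : 1 ≤ i) (h : i < n) (j : Fin n) :
    (.inr j : BPt n) = botL h ↔ (j : ℕ) + 1 = i := by
  simp only [botL, Sum.inr.injEq, Fin.ext_iff]; omega

theorem inr_eq_botR {i : ℕ} (h : i < n) (j : Fin n) :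
    (.inr j : BPt n) = botR h ↔ (j : ℕ) = i := by
  simp only [botR, Sum.inr.injEq, Fin.ext_iff]

theorem botL_ne_botR {i : ℕ} (h1 : 1 ≤ i) (h : i < n) : botL h ≠ botR h := by
  simp only [botL, botR, ne_eq, Sum.inr.injEq, Fin.ext_iff]; omega

section uSucc

variable (D : AbacusDiagram d n) {i : ℕ} (h1 : 1 ≤ i) (h : i < n)

/-- A curve in `D * uSucc d i h1 h` that leaves `D` outside of the two joined bottom points. -/
theorem mul_uSucc_exit {p : BPt n} (hl : D.arc p ≠ botL h) (hr : D.arc p ≠ botR h) :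
    ArcWalk (arcs (pair D (uSucc d i h1 h))) (decos (pair D (uSucc d i h1 h))) glueTwo
      (false, p) (D.deco p) (outTwo (D.arc p)) := by
  rcases e : D.arc p with j | j
  · exact ArcWalk.last' (by simp [arcs, pair, e, outTwo]) (by simp [decos, pair]) rfl
  · rw [e, Ne, inr_eq_botL h1] at hl
    rw [e, Ne, inr_eq_botR] at hr
    refine ArcWalk.step' (y := (false, .inr j)) (y' := (true, .inl j)) (k := 1)
      (by simp [arcs, pair, e]) rfl (by simp) ?_ (by simp [decos, pair])
    exact ArcWalk.last' (by simp [arcs, pair, uSucc, outTwo, hl, hr])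
      (by simp [decos, pair, uSucc, Deco.one_def]) rfl

/-- A curve in `D * uSucc d i h1 h` that leaves `D` at `botL h` re-enters `D` at `botR h`. -/
theorem mul_uSucc_turnL {p : BPt n} (e : D.arc p = botL h) (hp : p ≠ botR h) :
    ArcWalk (arcs (pair D (uSucc d i h1 h))) (decos (pair D (uSucc d i h1 h))) glueTwo
      (false, p) (D.deco p * D.deco (botR h)) (outTwo (D.arc (botR h))) := by
  have hl : D.arc (botR h) ≠ botL h := fun e' => hp (by
    rw [← D.arc_arc p, e, ← e', D.arc_arc])
  refine ArcWalk.step' (y := (false, botL h)) (y' := (true, .inl ⟨i - 1, by omega⟩))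
    (k := D.deco (botR h)) (by simp [arcs, pair, e]) rfl (by simp) ?_ (by simp [decos, pair])
  exact ArcWalk.step' (y := (true, .inl ⟨i, h⟩)) (y' := (false, botR h)) (k := D.deco (botR h))
    (by simp [arcs, pair, uSucc, Nat.sub_add_cancel h1]) rfl (by simp)
    (mul_uSucc_exit D h1 h hl (D.arc_ne _)) (by simp [decos, pair, uSucc, ← Deco.one_def])

/-- A curve in `D * uSucc d i h1 h` that leaves `D` at `botR h` re-enters `D` at `botL h`. -/
theorem mul_uSucc_turnR {p : BPt n} (e : D.arc p = botR h) (hp : p ≠ botL h) :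
    ArcWalk (arcs (pair D (uSucc d i h1 h))) (decos (pair D (uSucc d i h1 h))) glueTwo
      (false, p) (D.deco p * D.deco (botL h)) (outTwo (D.arc (botL h))) := by
  have hr : D.arc (botL h) ≠ botR h := fun e' => hp (by
    rw [← D.arc_arc p, e, ← e', D.arc_arc])
  have hi : i ≠ i - 1 := by omega
  refine ArcWalk.step' (y := (false, botR h)) (y' := (true, .inl ⟨i, h⟩))
    (k := D.deco (botL h)) (by simp [arcs, pair, e]) rfl (by simp) ?_ (by simp [decos, pair])
  exact ArcWalk.step' (y := (true, .inl ⟨i - 1, by omega⟩)) (y' := (false, botL h))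
    (k := D.deco (botL h))
    (by simp [arcs, pair, uSucc]) rfl (by simp)
    (mul_uSucc_exit D h1 h (D.arc_ne _) hr) (by simp [decos, pair, uSucc, ← Deco.one_def])

/-- A curve in `D * uSucc d i h1 h` that does not start at the lower arc enters `D` at once. -/
theorem mul_uSucc_enter {p q : BPt n} {m : Deco d} (hl : p ≠ botL h) (hr : p ≠ botR h)
    (w : ArcWalk (arcs (pair D (uSucc d i h1 h))) (decos (pair D (uSucc d i h1 h))) glueTwo
      (false, p) m (outTwo q)) : Curve D (uSucc d i h1 h) p m q := by
  rcases p with j | j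
  · exact w
  · rw [Ne, inr_eq_botL h1] at hl
    rw [Ne, inr_eq_botR] at hr
    exact ArcWalk.step' (y := (true, .inl j)) (y' := (false, .inr j))
      (by simp [arcs, pair, outTwo, uSucc, hl, hr]) rfl (by simp) w
      (by simp [decos, pair, uSucc, outTwo, ← Deco.one_def])

theorem mul_uSucc_botL :
    (D * uSucc d i h1 h).arc (botL h) = botR h ∧ (D * uSucc d i h1 h).deco (botL h) = 1 := by
  have w : Curve D (uSucc d i h1 h) (botL h) 1 (botR h) :=
    ArcWalk.last' (by simp [arcs, pair, uSucc, outTwo, botL, botR, Nat.sub_add_cancel h1])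
      (by simp [decos, pair, uSucc, ← Deco.one_def, outTwo, botL]) rfl
  exact (((mul_curve _ _ _).det w)).symm

theorem mul_uSucc_botR :
    (D * uSucc d i h1 h).arc (botR h) = botL h ∧ (D * uSucc d i h1 h).deco (botR h) = 1 := by
  obtain ⟨h2, h3⟩ := D.mul_uSucc_botL h1 h
  rw [← h2, arc_arc, deco_arc, h3]
  exact ⟨rfl, rfl⟩

theorem mul_uSucc_of_ne {p : BPt n} (hl : p ≠ botL h) (hr : p ≠ botR h)
    (hl' : D.arc p ≠ botL h) (hr' : D.arc p ≠ botR h) :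
    (D * uSucc d i h1 h).arc p = D.arc p ∧ (D * uSucc d i h1 h).deco p = D.deco p :=
  ((mul_curve _ _ _).det (D.mul_uSucc_enter h1 h hl hr (D.mul_uSucc_exit h1 h hl' hr'))).symm

theorem mul_uSucc_of_eq_botL {p : BPt n} (hr : p ≠ botR h) (e : D.arc p = botL h) :
    (D * uSucc d i h1 h).arc p = D.arc (botR h) ∧
      (D * uSucc d i h1 h).deco p = D.deco p * D.deco (botR h) :=
  ((mul_curve _ _ _).det (D.mul_uSucc_enter h1 h (fun e' => D.arc_ne p (e.trans e'.symm)) hr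
    (D.mul_uSucc_turnL h1 h e hr))).symm

theorem mul_uSucc_of_eq_botR {p : BPt n} (hl : p ≠ botL h) (e : D.arc p = botR h) :
    (D * uSucc d i h1 h).arc p = D.arc (botL h) ∧
      (D * uSucc d i h1 h).deco p = D.deco p * D.deco (botL h) :=
  ((mul_curve _ _ _).det (D.mul_uSucc_enter h1 h hl (fun e' => D.arc_ne p (e.trans e'.symm))
    (D.mul_uSucc_turnR h1 h e hl))).symm

theorem mul_uSucc_arc (p : BPt n) : (D * uSucc d i h1 h).arc p =
    if p = botL h then botR h else if p = botR h then botL h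
    else if D.arc p = botL h then D.arc (botR h)
    else if D.arc p = botR h then D.arc (botL h) else D.arc p := by
  split_ifs with a b e f
  · rw [a]; exact (D.mul_uSucc_botL h1 h).1
  · rw [b]; exact (D.mul_uSucc_botR h1 h).1
  · exact (D.mul_uSucc_of_eq_botL h1 h b e).1
  · exact (D.mul_uSucc_of_eq_botR h1 h a f).1
  · exact (D.mul_uSucc_of_ne h1 h a b e f).1

theorem mul_uSucc_deco (p : BPt n) : (D * uSucc d i h1 h).deco p =
    if p = botL h then 1 else if p = botR h then 1
    else if D.arc p = botL h then D.deco p * D.deco (botR h)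
    else if D.arc p = botR h then D.deco p * D.deco (botL h) else D.deco p := by
  split_ifs with a b e f
  · rw [a]; exact (D.mul_uSucc_botL h1 h).2
  · rw [b]; exact (D.mul_uSucc_botR h1 h).2
  · exact (D.mul_uSucc_of_eq_botL h1 h b e).2
  · exact (D.mul_uSucc_of_eq_botR h1 h a f).2
  · exact (D.mul_uSucc_of_ne h1 h a b e f).2

/-- Multiplication by `uSucc` fixes a diagram that has its lower arc. -/
theorem mul_uSucc_eq_self (e : D.arc (botL h) = botR h) (e' : D.deco (botL h) = 1) :
    D * uSucc d i h1 h = D := by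
  have e2 : D.arc (botR h) = botL h := by rw [← e, D.arc_arc]
  have e3 : D.deco (botR h) = 1 := by rw [← e, D.deco_arc, e']; rfl
  ext p : 2
  · rw [mul_uSucc_arc]
    split_ifs with a b f g
    · rw [a, e]
    · rw [b, e2]
    · exact absurd (by rw [← D.arc_arc p, f, e]) b
    · exact absurd (by rw [← D.arc_arc p, g, e2]) a
    · rfl
  · rw [mul_uSucc_deco]
    split_ifs with a b f g
    · rw [a, e']
    · rw [b, e3]
    · exact absurd (by rw [← D.arc_arc p, f, e]) b
    · exact absurd (by rw [← D.arc_arc p, g, e2]) a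
    · rfl

end uSucc

/-! ### The defining relations hold for diagrams -/

theorem uSucc_deco {i : ℕ} (h1 : 1 ≤ i) (h : i < n) (p : BPt n) :
    (uSucc d i h1 h).deco p = 1 := rfl

theorem uSucc_arc_inl {i : ℕ} (h1 : 1 ≤ i) (h : i < n) (j : Fin n) :
    (uSucc d i h1 h).arc (.inl j) = if (j : ℕ) + 1 = i then .inl ⟨i, h⟩
        else if (j : ℕ) = i then .inl ⟨i - 1, by omega⟩ else .inr j := rfl

theorem uSucc_arc_inr {i : ℕ} (h1 : 1 ≤ i) (h : i < n) (j : Fin n) :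
    (uSucc d i h1 h).arc (.inr j) = if (j : ℕ) + 1 = i then .inr ⟨i, h⟩
        else if (j : ℕ) = i then .inr ⟨i - 1, by omega⟩ else .inl j := rfl

theorem uSucc_mul_deco {i j : ℕ} (hi1 : 1 ≤ i) (hi : i < n) (hj1 : 1 ≤ j) (hj : j < n)
    (p : BPt n) : (uSucc d i hi1 hi * uSucc d j hj1 hj).deco p = 1 := by
  simp [mul_uSucc_deco, uSucc_deco]

set_option linter.unusedSimpArgs false in
theorem uSucc_comm {i j : ℕ} (hi1 : 1 ≤ i) (hi : i < n) (hj1 : 1 ≤ j) (hj : j < n)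
    (hij : i + 1 < j) :
    uSucc d i hi1 hi * uSucc d j hj1 hj = uSucc d j hj1 hj * uSucc d i hi1 hi := by
  obtain ⟨i, rfl⟩ := Nat.exists_eq_add_of_le' hi1
  obtain ⟨j, rfl⟩ := Nat.exists_eq_add_of_le' hj1
  have a1 : i ≠ j := by omega
  have a2 : i + 1 ≠ j := by omega
  have a3 : i ≠ j + 1 := by omega
  ext p : 2
  · rw [mul_uSucc_arc, mul_uSucc_arc]
    rcases p with ⟨x, hx⟩ | ⟨x, hx⟩ <;>
    ( by_cases x1 : x = i
      · subst x1
        simp [uSucc_arc_inl, uSucc_arc_inr, botL, botR, a1, a2, a3, a1.symm, a2.symm, a3.symm]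
      by_cases x2 : x = i + 1
      · subst x2
        simp [uSucc_arc_inl, uSucc_arc_inr, botL, botR, a1, a2, a3, a1.symm, a2.symm, a3.symm]
      by_cases x3 : x = j
      · subst x3
        simp [uSucc_arc_inl, uSucc_arc_inr, botL, botR, a1, a2, a3, a1.symm, a2.symm, a3.symm]
      by_cases x4 : x = j + 1
      · subst x4
        simp [uSucc_arc_inl, uSucc_arc_inr, botL, botR, a1, a2, a3, a1.symm, a2.symm, a3.symm]
      simp [uSucc_arc_inl, uSucc_arc_inr, botL, botR, x1, x2, x3, x4])
  · rw [uSucc_mul_deco, uSucc_mul_deco]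

set_option linter.unusedSimpArgs false in
theorem uSucc_braid {i j : ℕ} (hi1 : 1 ≤ i) (hi : i < n) (hj1 : 1 ≤ j) (hj : j < n)
    (hij : i + 1 = j ∨ j + 1 = i) :
    uSucc d i hi1 hi * uSucc d j hj1 hj * uSucc d i hi1 hi = uSucc d i hi1 hi := by
  obtain ⟨i, rfl⟩ := Nat.exists_eq_add_of_le' hi1
  obtain ⟨j, rfl⟩ := Nat.exists_eq_add_of_le' hj1
  ext p : 2
  · rw [mul_uSucc_arc]
    simp only [mul_uSucc_arc]
    rcases hij with hij | hij 
    · obtain rfl : j = i + 1 := by omega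
      have a : i + 1 + 1 ≠ i := by omega
      rcases p with ⟨x, hx⟩ | ⟨x, hx⟩ <;>
      ( by_cases x1 : x = i
        · subst x1; simp [uSucc_arc_inl, uSucc_arc_inr, botL, botR]
        by_cases x2 : x = i + 1
        · subst x2; simp [uSucc_arc_inl, uSucc_arc_inr, botL, botR]
        by_cases x3 : x = i + 1 + 1
        · subst x3; simp [uSucc_arc_inl, uSucc_arc_inr, botL, botR, a, a.symm]
        simp [uSucc_arc_inl, uSucc_arc_inr, botL, botR, x1, x2, x3])
    · obtain rfl : i = j + 1 := by omega
      have a : j + 1 + 1 ≠ j := by omega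
      rcases p with ⟨x, hx⟩ | ⟨x, hx⟩ <;>
      ( by_cases x1 : x = j
        · subst x1; simp [uSucc_arc_inl, uSucc_arc_inr, botL, botR, a, a.symm]
        by_cases x2 : x = j + 1
        · subst x2; simp [uSucc_arc_inl, uSucc_arc_inr, botL, botR, a, a.symm]
        by_cases x3 : x = j + 1 + 1
        · subst x3; simp [uSucc_arc_inl, uSucc_arc_inr, botL, botR, a, a.symm]
        simp [uSucc_arc_inl, uSucc_arc_inr, botL, botR, x1, x2, x3])
  · simp only [mul_uSucc_deco, uSucc_deco]; simp

set_option linter.unusedSimpArgs false in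
/-- The decorated loop between the two generators is dropped. -/
theorem uSucc_mul_strands_mul_uSucc {i : ℕ} (h1 : 1 ≤ i) (h : i < n) (c : Fin n → Deco d)
    (hc : ∀ j, (c j).HasBlob → (j : ℕ) = 0)
    (hc' : ∀ j : Fin n, (j : ℕ) + 1 ≠ i → (j : ℕ) ≠ i → c j = 1) :
    uSucc d i h1 h * strands c hc * uSucc d i h1 h = uSucc d i h1 h := by
  have ha : (uSucc d i h1 h * strands c hc).arc = (uSucc d i h1 h).arc :=
    funext fun p => mul_strands_arc _ _ _ _
  obtain ⟨i, rfl⟩ := Nat.exists_eq_add_of_le' h1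
  ext p : 2
  · rw [mul_uSucc_arc, ha]
    rcases p with ⟨x, hx⟩ | ⟨x, hx⟩ <;>
    ( by_cases x1 : x = i
      · subst x1; simp [uSucc_arc_inl, uSucc_arc_inr, botL, botR]
      by_cases x2 : x = i + 1
      · subst x2; simp [uSucc_arc_inl, uSucc_arc_inr, botL, botR]
      simp [uSucc_arc_inl, uSucc_arc_inr, botL, botR, x1, x2])
  · rw [mul_uSucc_deco, ha]
    simp only [mul_strands_deco]
    rcases p with ⟨x, hx⟩ | ⟨x, hx⟩ <;>
    ( by_cases x1 : x = i
      · subst x1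
        simp [uSucc_arc_inl, uSucc_arc_inr, botL, botR, uSucc_deco, belowDeco, Deco.rev_one]
      by_cases x2 : x = i + 1
      · subst x2
        simp [uSucc_arc_inl, uSucc_arc_inr, botL, botR, uSucc_deco, belowDeco, Deco.rev_one]
      have := hc' ⟨x, hx⟩ (by simpa using x1) x2
      simp [uSucc_arc_inl, uSucc_arc_inr, botL, botR, x1, x2, uSucc_deco, belowDeco, this,
        Deco.rev_one])

theorem strands_arc (c : Fin n → Deco d) (hc : ∀ j, (c j).HasBlob → (j : ℕ) = 0) (p : BPt n) :
    (strands c hc).arc p = p.swap := rfl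

theorem strands_mul_uSucc_arc {i : ℕ} (h1 : 1 ≤ i) (h : i < n) (c : Fin n → Deco d)
    (hc : ∀ j, (c j).HasBlob → (j : ℕ) = 0) (p : BPt n) :
    (strands c hc * uSucc d i h1 h).arc p = (uSucc d i h1 h).arc p := by
  obtain ⟨i, rfl⟩ := Nat.exists_eq_add_of_le' h1
  rw [mul_uSucc_arc]
  rcases p with ⟨x, hx⟩ | ⟨x, hx⟩ <;>
  ( by_cases x1 : x = i
    · subst x1; simp [uSucc_arc_inl, uSucc_arc_inr, strands_arc, botL, botR]
    by_cases x2 : x = i + 1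
    · subst x2; simp [uSucc_arc_inl, uSucc_arc_inr, strands_arc, botL, botR]
    simp [uSucc_arc_inl, uSucc_arc_inr, strands_arc, botL, botR, x1, x2])

theorem strands_mul_strands (c c' : Fin n → Deco d) (hc : ∀ j, (c j).HasBlob → (j : ℕ) = 0)
    (hc' : ∀ j, (c' j).HasBlob → (j : ℕ) = 0) :
    strands c hc * strands c' hc' = strands (c * c')
      fun j h => (Deco.hasBlob_mul h).elim (hc j) (hc' j) := by
  ext p : 2
  · rw [mul_strands_arc]; rfl
  · rw [mul_strands_deco]
    rcases p with j | j
    · simp [strands, belowDeco, Deco.rev_one]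
    · simp [strands, belowDeco, Deco.rev_mul]

theorem strands_congr {c c' : Fin n → Deco d} (h : c = c')
    (hc : ∀ j, (c j).HasBlob → (j : ℕ) = 0) (hc' : ∀ j, (c' j).HasBlob → (j : ℕ) = 0) :
    strands c hc = strands c' hc' := by
  subst h; rfl

theorem strands_one (hc : ∀ j : Fin n, ((1 : Fin n → Deco d) j).HasBlob → (j : ℕ) = 0) :
    strands 1 hc = 1 := by
  ext p : 2
  · rfl
  · rcases p with j | j <;> rfl

theorem z_pow_eq {i : ℕ} (h1 : 1 ≤ i) (h2 : i ≤ n) (k : ℕ) :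
    z d i h1 h2 ^ k =
      strands (fun j => if (j : ℕ) + 1 = i then .plain (k : ZMod d) else 1) (by
        intro j h
        split_ifs at h <;> exact h.elim) := by
  induction k with
  | zero =>
    rw [pow_zero, ← strands_one fun j h => h.elim]
    refine strands_congr ?_ _ _
    ext j
    simp [← Deco.one_def]
  | succ k ih =>
    rw [pow_succ, ih, z, strands_mul_strands]
    refine strands_congr ?_ _ _
    ext j
    simp only [Pi.mul_apply]
    split_ifs
    · rw [Deco.plain_mul_plain, Nat.cast_succ]
    · exact mul_one _

theorem strands_mul_uSucc_comm {i : ℕ} (h1 : 1 ≤ i) (h : i < n) (c : Fin n → Deco d)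
    (hc : ∀ j, (c j).HasBlob → (j : ℕ) = 0)
    (hc' : ∀ j : Fin n, (j : ℕ) + 1 = i ∨ (j : ℕ) = i → c j = 1) :
    uSucc d i h1 h * strands c hc = strands c hc * uSucc d i h1 h := by
  ext p : 2
  · rw [mul_strands_arc, strands_mul_uSucc_arc]
  · obtain ⟨i, rfl⟩ := Nat.exists_eq_add_of_le' h1
    have e1 := hc' ⟨i, by omega⟩ (Or.inl rfl)
    have e2 := hc' ⟨i + 1, h⟩ (Or.inr rfl)
    rw [mul_strands_deco, mul_uSucc_deco]
    rcases p with ⟨x, hx⟩ | ⟨x, hx⟩ <;>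
    ( by_cases x1 : x = i
      · subst x1
        simp [uSucc_arc_inl, uSucc_arc_inr, strands, botL, botR, belowDeco, Deco.rev_one,
          uSucc_deco, e1, e2]
      by_cases x2 : x = i + 1
      · subst x2
        simp [uSucc_arc_inl, uSucc_arc_inr, strands, botL, botR, belowDeco, Deco.rev_one,
          uSucc_deco, e1, e2]
      simp [uSucc_arc_inl, uSucc_arc_inr, strands, botL, botR, belowDeco, Deco.rev_one,
          uSucc_deco, x1, x2])

theorem z_mul_uSucc {i : ℕ} (h1 : 1 ≤ i) (h : i < n) :
    z d i h1 h.le * uSucc d i h1 h =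
      z d (i + 1) (Nat.le_add_left 1 i) h * uSucc d i h1 h := by
  ext p : 2
  · rw [z, z, strands_mul_uSucc_arc, strands_mul_uSucc_arc]
  · obtain ⟨i, rfl⟩ := Nat.exists_eq_add_of_le' h1
    rw [mul_uSucc_deco, mul_uSucc_deco]
    rcases p with ⟨x, hx⟩ | ⟨x, hx⟩ <;>
    ( by_cases x1 : x = i
      · subst x1
        simp [z, strands, botL, botR, Deco.rev, Deco.plain_mul_plain]
      by_cases x2 : x = i + 1
      · subst x2
        simp [z, strands, botL, botR, Deco.rev, Deco.plain_mul_plain]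
      simp [z, strands, botL, botR, x1, x2])

theorem uSucc_mul_z {i : ℕ} (h1 : 1 ≤ i) (h : i < n) :
    uSucc d i h1 h * z d i h1 h.le =
      uSucc d i h1 h * z d (i + 1) (Nat.le_add_left 1 i) h := by
  ext p : 2
  · rw [z, z, mul_strands_arc, mul_strands_arc]
  · obtain ⟨i, rfl⟩ := Nat.exists_eq_add_of_le' h1
    rw [z, z, mul_strands_deco, mul_strands_deco]
    rcases p with ⟨x, hx⟩ | ⟨x, hx⟩ <;>
    ( by_cases x1 : x = i
      · subst x1
        simp [uSucc_arc_inl, uSucc_arc_inr, uSucc_deco, belowDeco, Deco.rev, ← Deco.one_def]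
      by_cases x2 : x = i + 1
      · subst x2
        simp [uSucc_arc_inl, uSucc_arc_inr, uSucc_deco, belowDeco, Deco.rev, ← Deco.one_def]
      simp [uSucc_arc_inl, uSucc_arc_inr, uSucc_deco, belowDeco, Deco.rev, x1, x2])

theorem u_of_pos {i : ℕ} (h1 : 1 ≤ i) (h : i < n) : u d i h = uSucc d i h1 h := dif_pos h1

theorem u_zero (h : 0 < n) : u d 0 h = uZero d n := dif_neg (by omega)

end AbacusDiagram

open FramedBlobGen AbacusDiagram in
/-- The diagram of a generator. -/
def FramedBlobGen.diagram (d : ℕ) {n : ℕ} : FramedBlobGen n → AbacusDiagram d n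
  | u i h => AbacusDiagram.u d i h
  | z i h1 h2 => AbacusDiagram.z d i h1 h2

namespace FramedBlobMonoid

open AbacusDiagram

variable {d n : ℕ}

theorem lift_diagram_eq_of_rel {x y : FreeMonoid (FramedBlobGen n)} (h : FramedBlobRel d n x y) :
    FreeMonoid.lift (FramedBlobGen.diagram d) x = FreeMonoid.lift (FramedBlobGen.diagram d) y := by
  cases h <;> simp only [FramedBlobGen.wu, FramedBlobGen.wz, map_mul, map_pow, map_one,
    FreeMonoid.lift_eval_of, FramedBlobGen.diagram]
  case u_idem i hi =>
    rcases Nat.eq_zero_or_pos i with rfl | h1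
    · rw [u_zero, uZero, strands_mul_strands]
      refine strands_congr ?_ _ _
      ext j
      simp only [Pi.mul_apply]
      split_ifs
      · rfl
      · exact mul_one _
    · rw [u_of_pos h1]
      exact mul_uSucc_eq_self _ _ _ (by simp [botL, botR, uSucc_arc_inr, Nat.sub_add_cancel h1]) rfl
  case u_comm i j hi hj hij =>
    rcases Nat.eq_zero_or_pos i with rfl | h1
    · rw [u_zero, uZero, u_of_pos (by omega), ← strands_mul_uSucc_comm]
      intro k hk
      rw [if_neg (by omega)]; rfl
    · rcases Nat.eq_zero_or_pos j with rfl | h2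
      · rw [u_zero, uZero, u_of_pos (by omega), ← strands_mul_uSucc_comm]
        intro k hk
        rw [if_neg (by omega)]; rfl
      · rw [u_of_pos h1, u_of_pos h2]
        rcases hij with hij | hij
        · exact uSucc_comm _ _ _ _ hij
        · exact (uSucc_comm _ _ _ _ hij).symm
  case u_one_zero_one h0 h1 =>
    rw [u_of_pos le_rfl, u_zero, uZero]
    refine uSucc_mul_strands_mul_uSucc _ _ _ _ fun j hj hj' => ?_
    rw [if_neg (by omega)]; rfl
  case u_braid i j hi hj i0 j0 hij =>
    rw [u_of_pos (Nat.pos_of_ne_zero i0), u_of_pos (Nat.pos_of_ne_zero j0)]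
    exact uSucc_braid _ _ _ _ hij
  case z_pow i h1 h2 =>
    rw [z_pow_eq, ← strands_one fun j h => h.elim]
    refine strands_congr ?_ _ _
    ext j
    simp [← Deco.one_def]
  case z_comm i j hi1 hi2 hj1 hj2 =>
    rw [AbacusDiagram.z, AbacusDiagram.z, strands_mul_strands, strands_mul_strands]
    refine strands_congr ?_ _ _
    ext k
    simp only [Pi.mul_apply, ← Deco.one_def]
    split_ifs <;> simp
  case z_u i h1 hi =>
    rw [u_of_pos h1]; exact z_mul_uSucc h1 hi
  case u_z i h1 hi =>
    rw [u_of_pos h1]; exact uSucc_mul_z h1 hi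
  case u_zero_z_comm i h0 hi1 hi2 hi =>
    rw [u_zero, uZero, AbacusDiagram.z, strands_mul_strands, strands_mul_strands]
    refine strands_congr ?_ _ _
    ext k
    simp only [Pi.mul_apply, ← Deco.one_def]
    split_ifs
    · omega
    all_goals simp
  case u_z_comm i j h1 hi hj1 hj2 h h' =>
    rw [u_of_pos h1]
    refine strands_mul_uSucc_comm _ _ _ _ fun k hk => if_neg (by omega)
  case u_z_u i k h1 hi =>
    rw [u_of_pos h1, z_pow_eq]
    exact uSucc_mul_strands_mul_uSucc _ _ _ _ fun j hj hj' => if_neg hj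
  case u_zero_z_u_zero k h0 =>
    rw [u_zero, uZero, z_pow_eq, strands_mul_strands, strands_mul_strands]
    refine strands_congr ?_ _ _
    ext j
    simp only [Pi.mul_apply]
    split_ifs
    · rfl
    · omega
    · omega
    · simp [← Deco.one_def]
  case u_z_u_zero_u k h0 h1 =>
    rw [u_zero, uZero, z_pow_eq, u_of_pos le_rfl, mul_assoc (uSucc d 1 _ _), strands_mul_strands]
    refine uSucc_mul_strands_mul_uSucc _ _ _ _ fun j hj hj' => ?_
    simp only [Pi.mul_apply]
    rw [if_neg (by omega), if_neg (by omega), ← Deco.one_def, one_mul]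
  case u_u_zero_z_u k h0 h1 =>
    rw [u_zero, uZero, z_pow_eq, u_of_pos le_rfl, mul_assoc (uSucc d 1 _ _), strands_mul_strands]
    refine uSucc_mul_strands_mul_uSucc _ _ _ _ fun j hj hj' => ?_
    simp only [Pi.mul_apply]
    rw [if_neg (by omega), if_neg (by omega), ← Deco.one_def, one_mul]

/-- The homomorphism from the framed blob monoid to the abacus blob monoid that maps each generator
to its diagram. -/
noncomputable def toDiagram (d n : ℕ) : FramedBlobMonoid d n →* AbacusDiagram d n :=
  PresentedMonoid.lift (FramedBlobGen.diagram d) fun _ _ h => lift_diagram_eq_of_rel h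

theorem toDiagram_u (i : ℕ) (h : i < n) : toDiagram d n (u d i h) = AbacusDiagram.u d i h :=
  PresentedMonoid.lift_of _ _

theorem toDiagram_z (i : ℕ) (h1 : 1 ≤ i) (h2 : i ≤ n) :
    toDiagram d n (z d i h1 h2) = AbacusDiagram.z d i h1 h2 :=
  PresentedMonoid.lift_of _ _

/-! ### Words in the framed blob monoid -/

/-- The generator `u i`, with the value `1` if the index is out of range. -/
def gu (i : ℕ) : FramedBlobMonoid d n := if h : i < n then u d i h else 1

/-- The generator `z i`, with the value `1` if the index is out of range. -/
def gz (i : ℕ) : FramedBlobMonoid d n := if h : 1 ≤ i ∧ i ≤ n then z d i h.1 h.2 else 1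

theorem gu_eq {i : ℕ} (h : i < n) : (gu i : FramedBlobMonoid d n) = u d i h := dif_pos h

theorem gz_eq {i : ℕ} (h1 : 1 ≤ i) (h2 : i ≤ n) : (gz i : FramedBlobMonoid d n) = z d i h1 h2 :=
  dif_pos ⟨h1, h2⟩

theorem gu_eq_one {i : ℕ} (h : n ≤ i) : (gu i : FramedBlobMonoid d n) = 1 := dif_neg (by omega)

theorem gz_eq_one {i : ℕ} (h : ¬ (1 ≤ i ∧ i ≤ n)) : (gz i : FramedBlobMonoid d n) = 1 := dif_neg h

theorem closure_gens : Submonoid.closure (Set.range gu ∪ Set.range gz) =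
    (⊤ : Submonoid (FramedBlobMonoid d n)) := by
  rw [eq_top_iff, ← PresentedMonoid.closure_range_of, Submonoid.closure_le]
  rintro _ ⟨i | i, rfl⟩
  · exact Submonoid.subset_closure (Or.inl ⟨_, gu_eq _⟩)
  · exact Submonoid.subset_closure (Or.inr ⟨_, gz_eq _ _⟩)

theorem gu_mul_self (i : ℕ) : (gu i * gu i : FramedBlobMonoid d n) = gu i := by
  by_cases h : i < n
  · rw [gu_eq h]
    exact PresentedMonoid.mk_eq_mk_of_rel (FramedBlobRel.u_idem i h)
  · rw [gu_eq_one (by omega), one_mul]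

theorem gu_commute {i j : ℕ} (h : i + 1 < j) : Commute (gu i : FramedBlobMonoid d n) (gu j) := by
  by_cases hj : j < n
  · rw [gu_eq hj, gu_eq (show i < n by omega)]
    exact PresentedMonoid.mk_eq_mk_of_rel (FramedBlobRel.u_comm i j _ _ (Or.inl h))
  · rw [gu_eq_one (i := j) (by omega)]; exact Commute.one_right _

theorem gz_commute (i j : ℕ) : Commute (gz i : FramedBlobMonoid d n) (gz j) := by
  by_cases hi : 1 ≤ i ∧ i ≤ n
  · by_cases hj : 1 ≤ j ∧ j ≤ n
    · rw [gz_eq hi.1 hi.2, gz_eq hj.1 hj.2]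
      exact PresentedMonoid.mk_eq_mk_of_rel (FramedBlobRel.z_comm i j _ _ _ _)
    · rw [gz_eq_one hj]; exact Commute.one_right _
  · rw [gz_eq_one hi]; exact Commute.one_left _

theorem gu_gz_commute {i j : ℕ} (h : j ≠ i) (h' : j ≠ i + 1) :
    Commute (gu i : FramedBlobMonoid d n) (gz j) := by
  by_cases hi : i < n
  · by_cases hj : 1 ≤ j ∧ j ≤ n
    · rw [gu_eq hi, gz_eq hj.1 hj.2]
      rcases Nat.eq_zero_or_pos i with rfl | h1
      · exact PresentedMonoid.mk_eq_mk_of_rel (FramedBlobRel.u_zero_z_comm j hi _ _ h')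
      · exact PresentedMonoid.mk_eq_mk_of_rel (FramedBlobRel.u_z_comm i j h1 hi _ _ h h')
    · rw [gz_eq_one hj]; exact Commute.one_right _
  · rw [gu_eq_one (by omega)]; exact Commute.one_left _

theorem gz_pow (i : ℕ) : (gz i : FramedBlobMonoid d n) ^ d = 1 := by
  by_cases hi : 1 ≤ i ∧ i ≤ n
  · rw [gz_eq hi.1 hi.2]
    exact PresentedMonoid.mk_eq_mk_of_rel (FramedBlobRel.z_pow i hi.1 hi.2)
  · rw [gz_eq_one hi, one_pow]

theorem gz_mul_gu {i : ℕ} (h1 : 1 ≤ i) (h : i < n) :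
    (gz i * gu i : FramedBlobMonoid d n) = gz (i + 1) * gu i := by
  rw [gu_eq h, gz_eq h1 h.le, gz_eq (Nat.le_add_left 1 i) h]
  exact PresentedMonoid.mk_eq_mk_of_rel (FramedBlobRel.z_u i h1 h)

theorem gu_mul_gz {i : ℕ} (h1 : 1 ≤ i) (h : i < n) :
    (gu i * gz i : FramedBlobMonoid d n) = gu i * gz (i + 1) := by
  rw [gu_eq h, gz_eq h1 h.le, gz_eq (Nat.le_add_left 1 i) h]
  exact PresentedMonoid.mk_eq_mk_of_rel (FramedBlobRel.u_z i h1 h)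

theorem gz_pow_mul_gu {i : ℕ} (h1 : 1 ≤ i) (h : i < n) (c : ℕ) :
    (gz i ^ c * gu i : FramedBlobMonoid d n) = gz (i + 1) ^ c * gu i := by
  induction c with
  | zero => simp
  | succ c ih =>
    rw [pow_succ, mul_assoc, gz_mul_gu h1 h, ← mul_assoc, ((gz_commute i (i + 1)).pow_left c).eq,
      mul_assoc, ih, ← mul_assoc, ← pow_succ']

theorem gu_mul_gz_pow {i : ℕ} (h1 : 1 ≤ i) (h : i < n) (c : ℕ) :
    (gu i * gz i ^ c : FramedBlobMonoid d n) = gu i * gz (i + 1) ^ c := by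
  induction c with
  | zero => simp
  | succ c ih =>
    rw [pow_succ', ← mul_assoc, gu_mul_gz h1 h, mul_assoc, ((gz_commute (i + 1) i).pow_right c).eq,
      ← mul_assoc, ih, mul_assoc, ← pow_succ]

theorem gu_mul_gz_pow_mul_gu {i : ℕ} (h1 : 1 ≤ i) (h : i < n) (c : ℕ) :
    (gu i * gz i ^ c * gu i : FramedBlobMonoid d n) = gu i := by
  rw [gu_eq h, gz_eq h1 h.le]
  exact PresentedMonoid.mk_eq_mk_of_rel (FramedBlobRel.u_z_u i c h1 h)

theorem gu_mul_gu_succ_mul_gu {i : ℕ} (h1 : 1 ≤ i) :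
    (gu i * gu (i + 1) * gu i : FramedBlobMonoid d n) = gu i := by
  by_cases h : i + 1 < n
  · rw [gu_eq h, gu_eq (show i < n by omega)]
    exact PresentedMonoid.mk_eq_mk_of_rel
      (FramedBlobRel.u_braid i (i + 1) _ h (by omega) (by omega) (Or.inl rfl))
  · rw [gu_eq_one (i := i + 1) (by omega), mul_one, gu_mul_self]

theorem gu_succ_mul_gu_mul_gu_succ {i : ℕ} (h : i + 1 < n) :
    (gu (i + 1) * gu i * gu (i + 1) : FramedBlobMonoid d n) = gu (i + 1) := by
  rw [gu_eq h, gu_eq (show i < n by omega)]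
  rcases Nat.eq_zero_or_pos i with rfl | h1
  · exact PresentedMonoid.mk_eq_mk_of_rel (FramedBlobRel.u_one_zero_one _ h)
  · exact PresentedMonoid.mk_eq_mk_of_rel
      (FramedBlobRel.u_braid (i + 1) i h _ (by omega) (by omega) (Or.inr rfl))

theorem gu_zero_mul_gz_pow_mul_gu_zero (h : 0 < n) (c : ℕ) :
    (gu 0 * gz 1 ^ c * gu 0 : FramedBlobMonoid d n) = gu 0 := by
  rw [gu_eq h, gz_eq le_rfl h]
  exact PresentedMonoid.mk_eq_mk_of_rel (FramedBlobRel.u_zero_z_u_zero c h)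

theorem gu_one_mul_gz_pow_mul_gu_zero_mul_gu_one (h : 1 < n) (c : ℕ) :
    (gu 1 * gz 1 ^ c * gu 0 * gu 1 : FramedBlobMonoid d n) = gu 1 := by
  rw [gu_eq h, gz_eq le_rfl h.le, gu_eq (show 0 < n by omega)]
  exact PresentedMonoid.mk_eq_mk_of_rel (FramedBlobRel.u_z_u_zero_u c _ h)

/-- A closed curve with one blob, and beads on both sides of it, can be dropped: the beads slide
across `u 1` to one side of the blob. -/
theorem gu_one_mul_blob_mul_gu_one (h : 1 < n) (a b : ℕ) :
    (gu 1 * (gz 1 ^ a * gu 0 * gz 1 ^ b) * gu 1 : FramedBlobMonoid d n) = gu 1 := by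
  have e : Commute (gu 0 : FramedBlobMonoid d n) (gz 2 ^ b) :=
    (gu_gz_commute (by omega) (by omega)).pow_right b
  calc gu 1 * (gz 1 ^ a * gu 0 * gz 1 ^ b) * gu 1
      = gu 1 * gz 1 ^ a * gu 0 * (gz 1 ^ b * gu 1) := by simp only [mul_assoc]
    _ = gu 1 * (gz 1 ^ a * gz 2 ^ b) * gu 0 * gu 1 := by
      rw [gz_pow_mul_gu le_rfl h, ← mul_assoc, mul_assoc _ (gu 0), e.eq]; simp only [mul_assoc]
    _ = gu 1 * gz 1 ^ (b + a) * gu 0 * gu 1 := by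
      rw [((gz_commute 1 2).pow_pow a b).eq, ← mul_assoc, ← gu_mul_gz_pow le_rfl h, mul_assoc (gu 1),
        ← pow_add]
    _ = gu 1 := gu_one_mul_gz_pow_mul_gu_zero_mul_gu_one h _

/-- The inverse of a power of a bead. -/
theorem gz_pow_mul_gz_pow_inv (hd : 1 ≤ d) (i c : ℕ) :
    (gz i ^ c * gz i ^ ((d - 1) * c) : FramedBlobMonoid d n) = 1 := by
  have e : c + (d - 1) * c = d * c := by
    obtain ⟨d, rfl⟩ := Nat.exists_eq_add_of_le' hd
    rw [Nat.add_sub_cancel]; ring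
  rw [← pow_add, e, pow_mul, gz_pow, one_pow]

theorem isUnit_gz (hd : 1 ≤ d) (i : ℕ) : IsUnit (gz i : FramedBlobMonoid d n) :=
  IsUnit.of_pow_eq_one (gz_pow i) (by omega)

/-! ### Descending words -/

/-- The word `u (k + r - 1) ⋯ u (k + 1) u k`. -/
def desc (k : ℕ) : ℕ → FramedBlobMonoid d n
  | 0 => 1
  | r + 1 => gu (k + r) * desc k r

/-- The word `u k u (k + 1) ⋯ u (k + r - 1)`. -/
def asc (k : ℕ) : ℕ → FramedBlobMonoid d n
  | 0 => 1
  | r + 1 => asc k r * gu (k + r)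

theorem desc_zero (k : ℕ) : (desc k 0 : FramedBlobMonoid d n) = 1 := rfl

theorem desc_succ (k r : ℕ) : (desc k (r + 1) : FramedBlobMonoid d n) = gu (k + r) * desc k r := rfl

theorem asc_succ (k r : ℕ) : (asc k (r + 1) : FramedBlobMonoid d n) = asc k r * gu (k + r) := rfl

theorem desc_one (k : ℕ) : (desc k 1 : FramedBlobMonoid d n) = gu k := mul_one _

theorem desc_add (k r s : ℕ) :
    (desc k (r + s) : FramedBlobMonoid d n) = desc (k + r) s * desc k r := by
  induction s with
  | zero => rw [desc_zero, one_mul, add_zero]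
  | succ s ih => rw [← add_assoc, desc_succ, ih, desc_succ, mul_assoc, add_assoc]

theorem asc_add (k r s : ℕ) :
    (asc k (r + s) : FramedBlobMonoid d n) = asc k r * asc (k + r) s := by
  induction s with
  | zero => exact (mul_one _).symm
  | succ s ih => rw [← add_assoc, asc_succ, ih, asc_succ, mul_assoc, add_assoc]

theorem desc_succ' (k r : ℕ) :
    (desc k (r + 1) : FramedBlobMonoid d n) = desc (k + 1) r * gu k := by
  rw [add_comm, desc_add, desc_one]

theorem asc_succ' (k r : ℕ) :
    (asc k (r + 1) : FramedBlobMonoid d n) = gu k * asc (k + 1) r := by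
  rw [add_comm, asc_add]; congr 1; exact one_mul _

theorem commute_desc {x : FramedBlobMonoid d n} {k r : ℕ}
    (h : ∀ i, k ≤ i → i < k + r → Commute x (gu i)) : Commute x (desc k r) := by
  induction r with
  | zero => exact Commute.one_right _
  | succ r ih =>
    exact (h _ (by omega) (by omega)).mul_right (ih fun i hi hi' => h i hi (by omega))

theorem commute_asc {x : FramedBlobMonoid d n} {k r : ℕ}
    (h : ∀ i, k ≤ i → i < k + r → Commute x (gu i)) : Commute x (asc k r) := by
  induction r with
  | zero => exact Commute.one_right _
  | succ r ih =>
    exact (ih fun i hi hi' => h i hi (by omega)).mul_right (h _ (by omega) (by omega))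

theorem gu_commute_desc {j k r : ℕ} (h : j + 1 < k ∨ k + r < j) :
    Commute (gu j : FramedBlobMonoid d n) (desc k r) :=
  commute_desc fun i hi hi' => by
    rcases h with h | h
    · exact gu_commute (by omega)
    · exact (gu_commute (by omega)).symm

theorem gz_commute_desc {j k r : ℕ} (h : j < k ∨ k + r < j) :
    Commute (gz j : FramedBlobMonoid d n) (desc k r) :=
  commute_desc fun _ _ _ => (gu_gz_commute (by omega) (by omega)).symm

/-- Strands to the right of the last arc are shifted by two places, and so are the beads on
them. -/
theorem desc_mul_gz {j k r : ℕ} (hk : 1 ≤ k) (hj : k ≤ j) (hr : j + 2 ≤ k + r) (hn : k + r ≤ n) :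
    (desc k r * gz (j + 2) : FramedBlobMonoid d n) = gz j * desc k r := by
  obtain ⟨a, rfl⟩ := Nat.exists_eq_add_of_le hj
  obtain ⟨s, rfl⟩ : ∃ s, r = a + 2 + s := ⟨r - (a + 2), by omega⟩
  have h1 : Commute (gz (k + a + 2) : FramedBlobMonoid d n) (desc k a) :=
    gz_commute_desc (by omega)
  have h2 : Commute (gz (k + a) : FramedBlobMonoid d n) (desc (k + (a + 2)) s) :=
    gz_commute_desc (by omega)
  have h3 : Commute (gu (k + a) : FramedBlobMonoid d n) (gz (k + a + 2)) :=
    gu_gz_commute (by omega) (by omega)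
  have h4 : Commute (gu (k + a + 1) : FramedBlobMonoid d n) (gz (k + a)) :=
    gu_gz_commute (by omega) (by omega)
  calc (desc k (a + 2 + s) * gz (k + a + 2) : FramedBlobMonoid d n)
      = desc (k + (a + 2)) s * gu (k + a + 1) * gu (k + a) * (desc k a * gz (k + a + 2)) := by
        rw [desc_add, desc_succ, desc_succ]; simp only [mul_assoc, add_assoc]
    _ = desc (k + (a + 2)) s * gu (k + a + 1) * (gu (k + a) * gz (k + a + 2)) * desc k a := by
        rw [← h1.eq]; simp only [mul_assoc]
    _ = desc (k + (a + 2)) s * (gu (k + a + 1) * gz (k + a + 1 + 1)) * gu (k + a) * desc k a := by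
        rw [h3.eq]; simp only [mul_assoc]
    _ = desc (k + (a + 2)) s * gu (k + a + 1) * (gz (k + a + 1) * gu (k + a)) * desc k a := by
        rw [← gu_mul_gz (by omega) (by omega)]; simp only [mul_assoc]
    _ = desc (k + (a + 2)) s * (gu (k + a + 1) * gz (k + a)) * gu (k + a) * desc k a := by
        rw [← gz_mul_gu (by omega) (by omega)]; simp only [mul_assoc]
    _ = (desc (k + (a + 2)) s * gz (k + a)) * gu (k + a + 1) * gu (k + a) * desc k a := by
        rw [h4.eq]; simp only [mul_assoc]
    _ = gz (k + a) * desc k (a + 2 + s) := by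
        rw [← h2.eq, desc_add, desc_succ, desc_succ]; simp only [mul_assoc, add_assoc]

theorem desc_mul_gz_pow {j k r : ℕ} (hk : 1 ≤ k) (hj : k ≤ j) (hr : j + 2 ≤ k + r) (hn : k + r ≤ n)
    (c : ℕ) : (desc k r * gz (j + 2) ^ c : FramedBlobMonoid d n) = gz j ^ c * desc k r :=
  SemiconjBy.pow_right (desc_mul_gz hk hj hr hn) c

/-- Strands to the right of the last arc are shifted by two places, and so are generators on
them. -/
theorem desc_mul_gu {j k r : ℕ} (hk : 1 ≤ k) (hj : k ≤ j) (hr : j + 2 < k + r) (hn : k + r ≤ n) :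
    (desc k r * gu (j + 2) : FramedBlobMonoid d n) = gu j * desc k r := by
  obtain ⟨a, rfl⟩ := Nat.exists_eq_add_of_le hj
  obtain ⟨s, rfl⟩ : ∃ s, r = a + 3 + s := ⟨r - (a + 3), by omega⟩
  have h1 : Commute (gu (k + a + 2) : FramedBlobMonoid d n) (desc k a) :=
    gu_commute_desc (by omega)
  have h2 : Commute (gu (k + a) : FramedBlobMonoid d n) (desc (k + (a + 3)) s) :=
    gu_commute_desc (by omega)
  have h3 : Commute (gu (k + a) : FramedBlobMonoid d n) (gu (k + a + 2)) :=
    gu_commute (by omega)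
  calc (desc k (a + 3 + s) * gu (k + a + 2) : FramedBlobMonoid d n)
      = desc (k + (a + 3)) s * gu (k + a + 2) * gu (k + a + 1) * gu (k + a) *
          (desc k a * gu (k + a + 2)) := by
        rw [desc_add, desc_succ, desc_succ, desc_succ]; simp only [mul_assoc, add_assoc]
    _ = desc (k + (a + 3)) s * (gu (k + a + 2) * gu (k + a + 1) * (gu (k + a) * gu (k + a + 2))) *
          desc k a := by
        rw [← h1.eq]; simp only [mul_assoc]
    _ = desc (k + (a + 3)) s * (gu (k + a + 1 + 1) * gu (k + a + 1) * gu (k + a + 1 + 1)) *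
          gu (k + a) * desc k a := by
        rw [h3.eq]; simp only [mul_assoc]
    _ = desc (k + (a + 3)) s * gu (k + a + 2) * (gu (k + a) * gu (k + a + 1) * gu (k + a)) *
          desc k a := by
        rw [gu_succ_mul_gu_mul_gu_succ (by omega), gu_mul_gu_succ_mul_gu (by omega)]
    _ = desc (k + (a + 3)) s * (gu (k + a + 2) * gu (k + a)) * gu (k + a + 1) * gu (k + a) *
          desc k a := by simp only [mul_assoc]
    _ = (desc (k + (a + 3)) s * gu (k + a)) * gu (k + a + 2) * gu (k + a + 1) * gu (k + a) *
          desc k a := by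
        rw [← h3.eq]; simp only [mul_assoc]
    _ = gu (k + a) * desc k (a + 3 + s) := by
        rw [← h2.eq, desc_add, desc_succ, desc_succ, desc_succ]; simp only [mul_assoc, add_assoc]

/-- The next generator to the right of the last one of a descending word removes the latter. -/
theorem desc_mul_gz_pow_mul_gu_succ {k r : ℕ} (hn : k + r + 2 ≤ n) (c : ℕ) :
    (desc k (r + 2) * gz k ^ c * gu (k + 1) : FramedBlobMonoid d n) =
      gz k ^ c * desc (k + 1) (r + 1) := by
  have h1 : Commute (gz k ^ c : FramedBlobMonoid d n) (gu (k + 1)) :=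
    ((gu_gz_commute (by omega) (by omega)).symm).pow_left c
  have h2 : Commute (gz k ^ c : FramedBlobMonoid d n) (desc (k + 1) (r + 1)) :=
    (gz_commute_desc (by omega)).pow_left c
  have h3 := gu_succ_mul_gu_mul_gu_succ (d := d) (n := n) (i := k) (by omega)
  rw [mul_assoc, h1.eq, ← mul_assoc, h2.eq, desc_succ', desc_succ' (k + 1)]
  simp only [mul_assoc] at h3 ⊢
  rw [← mul_assoc (gu k), ← mul_assoc (gu (k + 1)) (gu k * gu (k + 1)), h3]

theorem desc_mul_asc {k r : ℕ} (hn : k + r < n) :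
    (desc k (r + 1) * asc k (r + 1) : FramedBlobMonoid d n) = gu (k + r) := by
  induction r with
  | zero => rw [desc_one, asc_succ, asc, one_mul, add_zero, gu_mul_self]
  | succ r ih =>
    rw [desc_succ, asc_succ, mul_assoc, ← mul_assoc (desc k (r + 1)), ih (by omega), ← mul_assoc]
    exact gu_succ_mul_gu_mul_gu_succ (by omega)

theorem asc_mul_desc {k r : ℕ} (hk : 1 ≤ k) :
    (asc k (r + 1) * desc k (r + 1) : FramedBlobMonoid d n) = gu k := by
  induction r generalizing k with
  | zero => rw [desc_one, asc_succ, asc, one_mul, add_zero, gu_mul_self]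
  | succ r ih =>
    rw [desc_succ', asc_succ', mul_assoc, ← mul_assoc (asc (k + 1) (r + 1)), ih (by omega),
      ← mul_assoc]
    exact gu_mul_gu_succ_mul_gu hk

/-! ### Adding a strand on the right -/

/-- The generator with the same name for one more strand. -/
def _root_.FramedBlobGen.succ : FramedBlobGen n → FramedBlobGen (n + 1)
  | .u i h => .u i (by omega)
  | .z i h1 h2 => .z i h1 (by omega)

open FramedBlobGen in
theorem rel_succ {x y : FreeMonoid (FramedBlobGen n)} (h : FramedBlobRel d n x y) :
    FramedBlobRel d (n + 1) (FreeMonoid.map FramedBlobGen.succ x)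
      (FreeMonoid.map FramedBlobGen.succ y) := by
  cases h <;> simp only [wu, wz, map_mul, map_pow, map_one, FreeMonoid.map_of,
    FramedBlobGen.succ]
  case u_idem i hi => exact .u_idem i _
  case u_comm i j hi hj hij => exact .u_comm i j _ _ hij
  case u_one_zero_one h0 h1 => exact .u_one_zero_one _ _
  case u_braid i j hi hj i0 j0 hij => exact .u_braid i j _ _ i0 j0 hij
  case z_pow i h1 h2 => exact .z_pow i _ _
  case z_comm i j hi1 hi2 hj1 hj2 => exact .z_comm i j _ _ _ _
  case z_u i h1 hi => exact .z_u i h1 _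
  case u_z i h1 hi => exact .u_z i h1 _
  case u_zero_z_comm i h0 hi1 hi2 hi => exact .u_zero_z_comm i _ _ _ hi
  case u_z_comm i j h1 hi hj1 hj2 h h' => exact .u_z_comm i j h1 _ _ _ h h'
  case u_z_u i k h1 hi => exact .u_z_u i k h1 _
  case u_zero_z_u_zero k h0 => exact .u_zero_z_u_zero k _
  case u_z_u_zero_u k h0 h1 => exact .u_z_u_zero_u k _ _
  case u_u_zero_z_u k h0 h1 => exact .u_u_zero_z_u k _ _

/-- The homomorphism `Bl_{d,n} → Bl_{d,n+1}` that adds a strand on the right. -/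
def succHom (d n : ℕ) : FramedBlobMonoid d n →* FramedBlobMonoid d (n + 1) :=
  PresentedMonoid.lift (fun g => PresentedMonoid.of _ g.succ) (by
    intro x y h
    have key : ∀ w : FreeMonoid (FramedBlobGen n),
        FreeMonoid.lift (fun g => PresentedMonoid.of (FramedBlobRel d (n + 1)) g.succ) w =
          PresentedMonoid.mk _ (FreeMonoid.map FramedBlobGen.succ w) := by
      intro w
      induction w with
      | one => rfl
      | of x => rfl
      | mul x y hx hy => simp only [map_mul, hx, hy]
    rw [key, key]
    exact PresentedMonoid.mk_eq_mk_of_rel (rel_succ h))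

theorem succHom_gu {i : ℕ} (h : i < n) : succHom d n (gu i) = gu i := by
  rw [gu_eq h, gu_eq (by omega)]; rfl

theorem succHom_gz {i : ℕ} (h : i ≤ n) : succHom d n (gz i) = gz i := by
  rcases Nat.eq_zero_or_pos i with rfl | h1
  · rw [gz_eq_one (by omega), gz_eq_one (by omega), map_one]
  · rw [gz_eq h1 h, gz_eq h1 (by omega)]; rfl

theorem succHom_desc {k r : ℕ} (h : k + r ≤ n) : succHom d n (desc k r) = desc k r := by
  induction r with
  | zero => exact map_one _
  | succ r ih => rw [desc_succ, desc_succ, map_mul, ih (by omega), succHom_gu (by omega)]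

theorem succHom_asc {k r : ℕ} (h : k + r ≤ n) : succHom d n (asc k r) = asc k r := by
  induction r with
  | zero => exact map_one _
  | succ r ih => rw [asc_succ, asc_succ, map_mul, ih (by omega), succHom_gu (by omega)]

/-- The right factors of the elements of `Bl_{d,n+1}` over `Bl_{d,n}`. In diagrams, `cup k r c` joins
the bottom points `k` and `k + 1` by an arc with `c` beads, or is the last strand with `c` beads if
`k = n + 1`; `blob a b` joins the first two bottom points by an arc with a blob, or is the only
strand, with a blob, if `n = 0`. -/
inductive Tail : FramedBlobMonoid d (n + 1) → Prop
  | cup (k r c : ℕ) (hk : 1 ≤ k) (h : k + r = n + 1) : Tail (desc k r * gz k ^ c)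
  | blob (a b : ℕ) : Tail (desc 1 n * (gz 1 ^ a * gu 0 * gz 1 ^ b))

/-- A bead below a tail is either added to those of the tail or slides through to a strand above
it. -/
theorem Tail.mul_gz {t : FramedBlobMonoid d (n + 1)} (ht : Tail t) (j : ℕ) :
    ∃ y t', Tail t' ∧ t * gz j = succHom d n y * t' := by
  by_cases hj : 1 ≤ j ∧ j ≤ n + 1
  swap
  · exact ⟨1, t, ht, by rw [gz_eq_one hj]; simp⟩
  obtain ⟨hj1, hj2⟩ := hj
  cases ht with
  | cup k r c hk h =>
    rcases Nat.lt_or_ge j k with hjk | hjk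
    · refine ⟨gz j, _, .cup k r c hk h, ?_⟩
      rw [succHom_gz (by omega), mul_assoc, ((gz_commute k j).pow_left c).eq, ← mul_assoc,
        ← (gz_commute_desc (Or.inl hjk)).eq, mul_assoc]
    obtain ⟨j, rfl⟩ := Nat.exists_eq_add_of_le hjk
    match j with
    | 0 =>
      refine ⟨1, _, .cup k r (c + 1) hk h, ?_⟩
      rw [add_zero, mul_assoc, ← pow_succ, map_one, one_mul]
    | 1 =>
      refine ⟨1, _, .cup k r (c + 1) hk h, ?_⟩
      obtain ⟨r, rfl⟩ : ∃ s, r = s + 1 := ⟨r - 1, by omega⟩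
      rw [desc_succ', mul_assoc, ((gz_commute k (k + 1)).pow_left c).eq, mul_assoc,
        ← mul_assoc (gu k), ← gu_mul_gz hk (by omega), pow_succ']
      simp only [map_one, one_mul, mul_assoc]
    | j + 2 =>
      refine ⟨gz (k + j), _, .cup k r c hk h, ?_⟩
      rw [succHom_gz (by omega), mul_assoc, ((gz_commute k _).pow_left c).eq, ← mul_assoc,
        ← add_assoc, desc_mul_gz hk (by omega) (by omega) (by omega), mul_assoc]
  | blob a b =>
    have e : gz 1 ^ a * gu 0 * gz 1 ^ b * gz j =
        gz 1 ^ a * (gu 0 * gz j) * (gz 1 ^ b : FramedBlobMonoid d (n + 1)) := by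
      simp only [mul_assoc]; rw [((gz_commute 1 j).pow_left b).eq]
    match j with
    | 0 => omega
    | 1 =>
      refine ⟨1, _, .blob a (b + 1), ?_⟩
      rw [mul_assoc, mul_assoc _ _ (gz 1), ← pow_succ, map_one, one_mul]
    | 2 =>
      refine ⟨1, _, .blob (a + 1) b, ?_⟩
      rw [mul_assoc, e, (gu_gz_commute (i := 0) (j := 2) (by omega) (by omega)).eq]
      obtain ⟨n, rfl⟩ : ∃ s, n = s + 1 := ⟨n - 1, by omega⟩
      have e' := gu_mul_gz (d := d) (n := n + 1 + 1) (i := 1) le_rfl (by omega)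
      rw [desc_succ', mul_assoc, ← mul_assoc _ _ (gz 1 ^ b), ← mul_assoc _ (gz 2),
        ((gz_commute 1 2).pow_left a).eq]
      simp only [mul_assoc]
      rw [← mul_assoc (gu 1), ← e', pow_succ', map_one, one_mul]
      simp only [mul_assoc]
    | j + 3 =>
      refine ⟨gz (j + 1), _, .blob a b, ?_⟩
      rw [succHom_gz (by omega), mul_assoc, e, (gu_gz_commute (by omega) (by omega)).eq,
        ← mul_assoc (gz 1 ^ a) (gz (j + 3)), ((gz_commute 1 (j + 3)).pow_left a).eq,
        ← mul_assoc (gz (j + 1)), ← desc_mul_gz le_rfl (by omega) (by omega) (by omega)]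
      simp only [mul_assoc]

theorem Tail.mul_gu {t : FramedBlobMonoid d (n + 1)} (ht : Tail t) (j : ℕ) :
    ∃ y t', Tail t' ∧ t * gu j = succHom d n y * t' := by
  by_cases hj : j < n + 1
  swap
  · exact ⟨1, t, ht, by rw [gu_eq_one (by omega)]; simp⟩
  cases ht with
  | cup k r c hk h =>
    rcases Nat.lt_or_ge (j + 1) k with hjk | hjk
    · refine ⟨gu j, _, .cup k r c hk h, ?_⟩
      rw [succHom_gu (by omega), mul_assoc,
        ((gu_gz_commute (i := j) (j := k) (by omega) (by omega)).pow_right c).eq.symm, ← mul_assoc,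
        ← (gu_commute_desc (Or.inl hjk)).eq, mul_assoc]
    rcases Nat.lt_or_ge j k with hjk' | hjk'
    · obtain rfl : k = j + 1 := by omega
      rcases Nat.eq_zero_or_pos j with rfl | hj0
      · refine ⟨1, _, .blob c 0, ?_⟩
        obtain rfl : r = n := by omega
        rw [map_one, one_mul, pow_zero, mul_one, mul_assoc]
      · refine ⟨gz j ^ c, _, .cup j (r + 1) 0 hj0 (by omega), ?_⟩
        rw [map_pow, succHom_gz (by omega), mul_assoc, ← gz_pow_mul_gu hj0 hj, ← mul_assoc,
          ← ((gz_commute_desc (Or.inl (by omega))).pow_left c).eq, desc_succ', pow_zero, mul_one,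
          mul_assoc]
    have hc : j ≠ k → j ≠ k - 1 →
        (gz k ^ c * gu j : FramedBlobMonoid d (n + 1)) = gu j * gz k ^ c := fun e e' =>
      ((gu_gz_commute (i := j) (j := k) (by omega) (by omega)).pow_right c).eq.symm
    obtain ⟨j, rfl⟩ := Nat.exists_eq_add_of_le hjk'
    match j with
    | 0 =>
      refine ⟨1, _, .cup k r 0 hk h, ?_⟩
      obtain ⟨r, rfl⟩ : ∃ s, r = s + 1 := ⟨r - 1, by omega⟩
      rw [desc_succ', mul_assoc, mul_assoc, add_zero, ← mul_assoc (gu k),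
        gu_mul_gz_pow_mul_gu hk (by omega)]
      simp
    | 1 =>
      obtain ⟨r, rfl⟩ : ∃ s, r = s + 2 := ⟨r - 2, by omega⟩
      refine ⟨gz k ^ c, _, .cup (k + 1) (r + 1) 0 (by omega) (by omega), ?_⟩
      rw [desc_mul_gz_pow_mul_gu_succ (by omega), map_pow, succHom_gz (by omega), pow_zero,
        mul_one]
    | j + 2 =>
      refine ⟨gu (k + j), _, .cup k r c hk h, ?_⟩
      rw [mul_assoc, hc (by omega) (by omega), ← mul_assoc, succHom_gu (by omega), ← add_assoc,
        desc_mul_gu hk (by omega) (by omega) (by omega), mul_assoc]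
  | blob a b =>
    have e : ∀ j, 2 ≤ j →
        Commute (gz 1 ^ a * gu 0 * gz 1 ^ b : FramedBlobMonoid d (n + 1)) (gu j) :=
      fun j hj => (((gu_gz_commute (by omega) (by omega)).symm.pow_left a).mul_left
        (gu_commute (by omega))).mul_left ((gu_gz_commute (by omega) (by omega)).symm.pow_left b)
    match j with
    | 0 =>
      refine ⟨1, _, .blob a 0, ?_⟩
      have e' := gu_zero_mul_gz_pow_mul_gu_zero (d := d) (n := n + 1) (by omega) b
      rw [map_one, one_mul, pow_zero, mul_one, mul_assoc, mul_assoc, mul_assoc, ← mul_assoc (gu 0),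
        e']
    | 1 =>
      refine ⟨1, _, .cup 1 n 0 le_rfl (by omega), ?_⟩
      obtain ⟨n, rfl⟩ : ∃ s, n = s + 1 := ⟨n - 1, by omega⟩
      rw [map_one, one_mul, pow_zero, mul_one, desc_succ', mul_assoc, mul_assoc, ← mul_assoc (gu 1),
        gu_one_mul_blob_mul_gu_one (by omega)]
    | 2 =>
      obtain ⟨n, rfl⟩ : ∃ s, n = s + 2 := ⟨n - 2, by omega⟩
      refine ⟨gz 1 ^ a * gu 0 * gz 1 ^ b, _, .cup 2 (n + 1) 0 (by omega) (by omega), ?_⟩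
      have e' := desc_mul_gz_pow_mul_gu_succ (d := d) (n := n + 2 + 1) (k := 1) (r := n)
        (by omega) 0
      rw [pow_zero, mul_one, one_mul] at e'
      rw [mul_assoc, (e 2 le_rfl).eq, ← mul_assoc, e', pow_zero, mul_one, map_mul, map_mul,
        map_pow, map_pow, succHom_gz (by omega), succHom_gu (by omega)]
      refine (Commute.eq ?_).symm
      exact (((gz_commute_desc (by omega)).pow_left a).mul_left
        (gu_commute_desc (by omega))).mul_left ((gz_commute_desc (by omega)).pow_left b)
    | j + 3 =>
      refine ⟨gu (j + 1), _, .blob a b, ?_⟩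
      rw [succHom_gu (by omega), mul_assoc, (e _ (by omega)).eq, ← mul_assoc,
        desc_mul_gu le_rfl (by omega) (by omega) (by omega), mul_assoc]

/-- Every element of `Bl_{d,n+1}` is a product of an element of `Bl_{d,n}` and a tail. -/
theorem exists_tail (x : FramedBlobMonoid d (n + 1)) :
    ∃ y t, Tail t ∧ x = succHom d n y * t := by
  have hx : x ∈ Submonoid.closure (Set.range gu ∪ Set.range gz) := by
    rw [closure_gens]; trivial
  induction hx using Submonoid.closure_induction_right with
  | one => exact ⟨1, _, .cup (n + 1) 0 0 (by omega) rfl, by simp [desc_zero]⟩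
  | mul_right x _ g hg ih =>
    obtain ⟨y, t, ht, rfl⟩ := ih
    have : ∃ y t', Tail t' ∧ t * g = succHom d n y * t' := by
      rcases hg with ⟨j, rfl⟩ | ⟨j, rfl⟩
      · exact ht.mul_gu j
      · exact ht.mul_gz j
    obtain ⟨y', t', ht', e⟩ := this
    exact ⟨y * y', t', ht', by rw [mul_assoc, e, map_mul, mul_assoc]⟩

end FramedBlobMonoid

namespace AbacusDiagram

variable {d n : ℕ}

/-! ### Adding a vertical arc and bending -/

/-- The boundary points of the first `n` of `n + 1` strands. -/
def liftPt : BPt n → BPt (n + 1) := Sum.map Fin.castSucc Fin.castSucc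

/-- The upper end of the last strand. -/
def topLast (n : ℕ) : BPt (n + 1) := .inl (Fin.last n)

/-- The lower end of the last strand. -/
def botLast (n : ℕ) : BPt (n + 1) := .inr (Fin.last n)

theorem pos_liftPt (p : BPt n) : (liftPt p).pos = if p.pos < n then p.pos else p.pos + 2 := by
  rcases p with ⟨j, hj⟩ | ⟨j, hj⟩ <;> split_ifs with h <;>
    simp only [liftPt, Sum.map_inl, Sum.map_inr, BPt.pos_inl, BPt.pos_inr, Fin.castSucc_mk]
      at h ⊢ <;>
    omega

theorem pos_topLast : (topLast n).pos = n := by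
  simp [topLast, BPt.pos_inl]

theorem pos_botLast : (botLast n).pos = n + 1 := by
  simp only [botLast, BPt.pos_inr, Fin.val_last]; omega

theorem liftPt_injective : Function.Injective (liftPt (n := n)) :=
  Sum.map_injective.2 ⟨Fin.castSucc_injective n, Fin.castSucc_injective n⟩

theorem liftPt_ne_topLast (p : BPt n) : liftPt p ≠ topLast n := fun h => by
  have := congrArg BPt.pos h
  rw [pos_liftPt, pos_topLast] at this
  split_ifs at this <;> omega

theorem liftPt_ne_botLast (p : BPt n) : liftPt p ≠ botLast n := fun h => by
  have := congrArg BPt.pos h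
  rw [pos_liftPt, pos_botLast] at this
  split_ifs at this <;> omega

theorem topLast_ne_botLast : topLast n ≠ botLast n := by simp [topLast, botLast]

theorem eq_liftPt_or (p : BPt (n + 1)) : (∃ q, p = liftPt q) ∨ p = topLast n ∨ p = botLast n := by
  rcases p with j | j
  · induction j using Fin.lastCases with
    | last => exact Or.inr (Or.inl rfl)
    | cast j => exact Or.inl ⟨.inl j, rfl⟩
  · induction j using Fin.lastCases with
    | last => exact Or.inr (Or.inr rfl)
    | cast j => exact Or.inl ⟨.inr j, rfl⟩

/-- A function on the boundary points of `n + 1` strands, given by its values on those of the first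
`n` strands and at the two ends of the last strand. -/
def liftCases {α : Type} (f : BPt n → α) (a b : α) : BPt (n + 1) → α
  | .inl j => Fin.lastCases (motive := fun _ => α) a (fun j => f (.inl j)) j
  | .inr j => Fin.lastCases (motive := fun _ => α) b (fun j => f (.inr j)) j

theorem liftCases_liftPt {α : Type} (f : BPt n → α) (a b : α) (p : BPt n) :
    liftCases f a b (liftPt p) = f p := by
  rcases p with j | j <;> simp [liftCases, liftPt]

theorem liftCases_topLast {α : Type} (f : BPt n → α) (a b : α) :
    liftCases f a b (topLast n) = a := by
  simp [liftCases, topLast]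

theorem liftCases_botLast {α : Type} (f : BPt n → α) (a b : α) :
    liftCases f a b (botLast n) = b := by
  simp [liftCases, botLast]

/-- The diagram with an undecorated vertical arc added on the right. -/
def addStrand (D : AbacusDiagram d n) : AbacusDiagram d (n + 1) where
  arc := liftCases (fun p => liftPt (D.arc p)) (botLast n) (topLast n)
  deco := liftCases D.deco 1 1
  arc_arc p := by
    rcases eq_liftPt_or p with ⟨q, rfl⟩ | rfl | rfl
    · rw [liftCases_liftPt, liftCases_liftPt, D.arc_arc]
    · rw [liftCases_topLast, liftCases_botLast]
    · rw [liftCases_botLast, liftCases_topLast]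
  arc_ne p := by
    rcases eq_liftPt_or p with ⟨q, rfl⟩ | rfl | rfl
    · rw [liftCases_liftPt]; exact fun h => D.arc_ne q (liftPt_injective h)
    · rw [liftCases_topLast]; exact topLast_ne_botLast.symm
    · rw [liftCases_botLast]; exact topLast_ne_botLast
  deco_arc p := by
    rcases eq_liftPt_or p with ⟨q, rfl⟩ | rfl | rfl
    · rw [liftCases_liftPt, liftCases_liftPt, liftCases_liftPt, D.deco_arc]
    · rw [liftCases_topLast, liftCases_botLast, liftCases_topLast]; rfl
    · rw [liftCases_botLast, liftCases_topLast, liftCases_botLast]; rfl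
  noncrossing p q := by
    rcases eq_liftPt_or p with ⟨p, rfl⟩ | rfl | rfl <;>
      rcases eq_liftPt_or q with ⟨q, rfl⟩ | rfl | rfl <;>
      simp only [liftCases_liftPt, liftCases_topLast, liftCases_botLast, pos_liftPt, pos_topLast,
        pos_botLast] <;> (try have := D.noncrossing p q) <;> (try split_ifs) <;> omega
  exposed p hb q := by
    rcases eq_liftPt_or p with ⟨p, rfl⟩ | rfl | rfl
    · rw [liftCases_liftPt] at hb
      have := D.exposed p hb
      rcases eq_liftPt_or q with ⟨q, rfl⟩ | rfl | rfl <;>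
      simp only [liftCases_liftPt, liftCases_topLast, liftCases_botLast, pos_liftPt, pos_topLast,
        pos_botLast] <;> (try have := this q) <;> (try split_ifs) <;> omega
    · rw [liftCases_topLast] at hb; exact hb.elim
    · rw [liftCases_botLast] at hb; exact hb.elim

theorem addStrand_arc_liftPt (D : AbacusDiagram d n) (p : BPt n) :
    D.addStrand.arc (liftPt p) = liftPt (D.arc p) :=
  liftCases_liftPt (fun p => liftPt (D.arc p)) (botLast n) (topLast n) p

theorem addStrand_arc_topLast (D : AbacusDiagram d n) :
    D.addStrand.arc (topLast n) = botLast n :=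
  liftCases_topLast (fun p => liftPt (D.arc p)) (botLast n) (topLast n)

theorem addStrand_arc_botLast (D : AbacusDiagram d n) :
    D.addStrand.arc (botLast n) = topLast n :=
  liftCases_botLast (fun p => liftPt (D.arc p)) (botLast n) (topLast n)

theorem addStrand_deco_liftPt (D : AbacusDiagram d n) (p : BPt n) :
    D.addStrand.deco (liftPt p) = D.deco p := liftCases_liftPt D.deco 1 1 p

theorem addStrand_deco_topLast (D : AbacusDiagram d n) :
    D.addStrand.deco (topLast n) = 1 := liftCases_topLast D.deco 1 1

theorem addStrand_deco_botLast (D : AbacusDiagram d n) :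
    D.addStrand.deco (botLast n) = 1 := liftCases_botLast D.deco 1 1

theorem ext_liftPt {D E : AbacusDiagram d (n + 1)}
    (h : ∀ p : BPt n, D.arc (liftPt p) = E.arc (liftPt p) ∧ D.deco (liftPt p) = E.deco (liftPt p))
    (ht : D.arc (topLast n) = E.arc (topLast n) ∧ D.deco (topLast n) = E.deco (topLast n))
    (hb : D.arc (botLast n) = E.arc (botLast n) ∧ D.deco (botLast n) = E.deco (botLast n)) :
    D = E := by
  ext p : 2
  all_goals rcases eq_liftPt_or p with ⟨p, rfl⟩ | rfl | rfl
  exacts [(h p).1, ht.1, hb.1, (h p).2, ht.2, hb.2]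

/-- If `D` has an undecorated vertical arc at the last strand, then it comes from the rest of it. -/
theorem eq_addStrand_of {D : AbacusDiagram d (n + 1)} {E : AbacusDiagram d n}
    (h : ∀ p : BPt n, D.arc (liftPt p) = liftPt (E.arc p) ∧ D.deco (liftPt p) = E.deco p)
    (ht : D.arc (topLast n) = botLast n) (ht' : D.deco (topLast n) = 1) : D = E.addStrand := by
  refine ext_liftPt (fun p => ?_) ?_ ?_
  · rw [addStrand_arc_liftPt, addStrand_deco_liftPt]; exact h p
  · rw [addStrand_arc_topLast, addStrand_deco_topLast]; exact ⟨ht, ht'⟩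
  · rw [addStrand_arc_botLast, addStrand_deco_botLast, ← ht, D.arc_arc, D.deco_arc, ht']
    exact ⟨rfl, rfl⟩

theorem addStrand_one : (1 : AbacusDiagram d n).addStrand = 1 := by
  refine (eq_addStrand_of (fun p => ?_) rfl rfl).symm
  rcases p with p | p <;> exact ⟨rfl, rfl⟩

theorem addStrand_mul (D E : AbacusDiagram d n) :
    (D * E).addStrand = D.addStrand * E.addStrand := by
  symm
  refine mul_eq_of_curve fun p => ?_
  rcases eq_liftPt_or p with ⟨p, rfl⟩ | rfl | rfl
  · rw [addStrand_arc_liftPt, addStrand_deco_liftPt]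
    have ho : ∀ p : BPt n, outTwo (liftPt p) = Prod.map id liftPt (outTwo p) := by
      rintro (p | p) <;> rfl
    unfold Curve
    rw [ho, ho]
    refine (ArcWalk.embed (Prod.map id liftPt) ?_ ?_ ?_ ?_ (mul_curve D E p)).1 ?_
    · rintro ⟨_ | _, p | p⟩ _ <;> rfl
    · exact Function.injective_id.prodMap liftPt_injective
    · rintro ⟨_ | _, p⟩ <;> simp [arcs, pair, addStrand_arc_liftPt]
    · rintro ⟨_ | _, p⟩ <;> simp [decos, pair, addStrand_deco_liftPt]
    · rw [← ho, glueTwo_outTwo]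
  · rw [addStrand_arc_topLast, addStrand_deco_topLast]
    refine ArcWalk.step' (y := (false, botLast n)) (y' := (true, topLast n)) (k := 1)
      (congrArg (Prod.mk false) D.addStrand_arc_topLast) rfl (by simp) ?_
      (by rw [mul_one]; exact addStrand_deco_topLast D)
    exact ArcWalk.last' (congrArg (Prod.mk true) E.addStrand_arc_topLast)
      (addStrand_deco_topLast E) rfl
  · rw [addStrand_arc_botLast, addStrand_deco_botLast]
    refine ArcWalk.step' (y := (true, topLast n)) (y' := (false, botLast n)) (k := 1)
      (congrArg (Prod.mk true) E.addStrand_arc_botLast) rfl (by simp) ?_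
      (by rw [mul_one]; exact addStrand_deco_botLast E)
    exact ArcWalk.last' (congrArg (Prod.mk false) D.addStrand_arc_botLast)
      (addStrand_deco_botLast D) rfl

/-- Adding an undecorated vertical arc on the right, as a homomorphism. -/
noncomputable def addStrandHom (d n : ℕ) : AbacusDiagram d n →* AbacusDiagram d (n + 1) where
  toFun := addStrand
  map_one' := addStrand_one
  map_mul' := addStrand_mul

theorem addStrand_strands (c : Fin n → Deco d) (c' : Fin (n + 1) → Deco d)
    (hc : ∀ j, (c j).HasBlob → (j : ℕ) = 0) (hc' : ∀ j, (c' j).HasBlob → (j : ℕ) = 0)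
    (h : ∀ j, c' (Fin.castSucc j) = c j) (h' : c' (Fin.last n) = 1) :
    (strands c hc).addStrand = strands c' hc' := by
  refine (eq_addStrand_of (fun p => ?_) rfl h').symm
  rcases p with p | p
  · exact ⟨rfl, h p⟩
  · exact ⟨rfl, congrArg Deco.rev (h p)⟩

theorem addStrand_u {i : ℕ} (h : i < n) : (u d i h).addStrand = u d i (by omega : i < n + 1) := by
  rcases Nat.eq_zero_or_pos i with rfl | h1
  · rw [u_zero, u_zero, uZero, uZero]
    refine addStrand_strands _ _ _ _ (fun j => rfl) ?_
    rw [if_neg (by simp; omega)]; rfl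
  · rw [u_of_pos h1, u_of_pos h1]
    refine (eq_addStrand_of (fun p => ⟨?_, rfl⟩) ?_ rfl).symm
    · rcases p with p | p
      · simp only [liftPt, Sum.map_inl, uSucc_arc_inl, Fin.val_castSucc]
        split_ifs <;> rfl
      · simp only [liftPt, Sum.map_inr, uSucc_arc_inr, Fin.val_castSucc]
        split_ifs <;> rfl
    · simp only [topLast, uSucc_arc_inl, Fin.val_last]
      rw [if_neg (by omega), if_neg (by omega)]; rfl

theorem addStrand_z {i : ℕ} (h1 : 1 ≤ i) (h2 : i ≤ n) :
    (z d i h1 h2).addStrand = z d i h1 (by omega : i ≤ n + 1) := by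
  refine addStrand_strands _ _ _ _ (fun j => rfl) ?_
  rw [if_neg (by simp; omega)]; rfl

/-- The boundary points of `n + 1` strands without the last two bottom points, in the order of the
boundary: the last bottom point of `n` strands is bent to the top. -/
def bendPt : BPt n → BPt (n + 1)
  | .inl j => .inl j.castSucc
  | .inr j => if (j : ℕ) + 1 = n then topLast n else .inr j.castSucc

theorem pos_bendPt (p : BPt n) : (bendPt p).pos = if p.pos ≤ n then p.pos else p.pos + 2 := by
  rcases p with ⟨j, hj⟩ | ⟨j, hj⟩
  · rw [if_pos (show BPt.pos (.inl ⟨j, hj⟩ : BPt n) ≤ n from hj.le)]; rfl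
  · simp only [bendPt, Fin.castSucc_mk]
    split_ifs with h h' h'
    · simp only [BPt.pos_inr, pos_topLast]; omega
    · simp only [BPt.pos_inr] at h'; omega
    · simp only [BPt.pos_inr] at h'; omega
    · simp only [BPt.pos_inr]; omega

theorem bendPt_injective : Function.Injective (bendPt (n := n)) := fun p q h => by
  have := congrArg BPt.pos h
  rw [pos_bendPt, pos_bendPt] at this
  refine BPt.pos_injective ?_
  split_ifs at this <;> omega

theorem botR_self : botR (Nat.lt_succ_self n) = botLast n := rfl

theorem liftPt_eq_botL (h1 : 1 ≤ n) (p : BPt n) :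
    liftPt p = botL (Nat.lt_succ_self n) ↔ p = .inr ⟨n - 1, by omega⟩ :=
  ⟨fun h => liftPt_injective h, fun h => h ▸ rfl⟩

theorem bendPt_last (h1 : 1 ≤ n) : bendPt (.inr ⟨n - 1, by omega⟩ : BPt n) = topLast n :=
  if_pos (Nat.sub_add_cancel h1)

theorem bendPt_of_ne (h1 : 1 ≤ n) {p : BPt n} (h : p ≠ .inr ⟨n - 1, by omega⟩) :
    bendPt p = liftPt p := by
  rcases p with j | j
  · rfl
  · refine if_neg fun h' => h ?_
    congr 1; ext; simp only; omega

/-- Multiplication of `D.addStrand` by the last generator bends the last strand of `D`. -/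
theorem addStrand_mul_uSucc (D : AbacusDiagram d n) (h1 : 1 ≤ n) (p : BPt n) :
    (D.addStrand * uSucc d n h1 (Nat.lt_succ_self n)).arc (bendPt p) = bendPt (D.arc p) ∧
      (D.addStrand * uSucc d n h1 (Nat.lt_succ_self n)).deco (bendPt p) = D.deco p := by
  have hbot : botL (Nat.lt_succ_self n) = liftPt (.inr ⟨n - 1, by omega⟩ : BPt n) := rfl
  by_cases hp : p = .inr ⟨n - 1, by omega⟩
  · subst hp
    rw [bendPt_last h1, bendPt_of_ne h1 (D.arc_ne _)]
    have := D.addStrand.mul_uSucc_of_eq_botR h1 (Nat.lt_succ_self n) (p := topLast n)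
      (by simp [topLast, botL]) (D.addStrand_arc_topLast)
    rw [hbot, addStrand_arc_liftPt, addStrand_deco_liftPt, addStrand_deco_topLast, one_mul] at this
    exact this
  · have hl : liftPt p ≠ botL (Nat.lt_succ_self n) := fun h => hp (liftPt_injective h)
    have hr : liftPt p ≠ botR (Nat.lt_succ_self n) := liftPt_ne_botLast p
    rw [bendPt_of_ne h1 hp]
    by_cases hq : D.arc p = .inr ⟨n - 1, by omega⟩
    · have := D.addStrand.mul_uSucc_of_eq_botL h1 (Nat.lt_succ_self n) hr
        (by rw [addStrand_arc_liftPt, hq, hbot])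
      rw [botR_self, addStrand_arc_botLast, addStrand_deco_botLast, addStrand_deco_liftPt,
        mul_one] at this
      rwa [hq, bendPt_last h1]
    · have := D.addStrand.mul_uSucc_of_ne h1 (Nat.lt_succ_self n) hl hr
        (by rw [addStrand_arc_liftPt]; exact fun h => hq (liftPt_injective h))
        (by rw [addStrand_arc_liftPt]; exact liftPt_ne_botLast _)
      rw [addStrand_arc_liftPt, addStrand_deco_liftPt] at this
      rwa [bendPt_of_ne h1 hq]

theorem addStrand_mul_uSucc_injective (h1 : 1 ≤ n) {D E : AbacusDiagram d n}
    (h : D.addStrand * uSucc d n h1 (Nat.lt_succ_self n) =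
      E.addStrand * uSucc d n h1 (Nat.lt_succ_self n)) : D = E := by
  have hD := D.addStrand_mul_uSucc h1
  have hE := E.addStrand_mul_uSucc h1
  rw [h] at hD
  ext p : 2
  · exact bendPt_injective ((hD p).1.symm.trans (hE p).1)
  · exact (hD p).2.symm.trans (hE p).2

end AbacusDiagram

namespace FramedBlobMonoid

open AbacusDiagram

variable {d n : ℕ}

theorem toDiagram_succHom (x : FramedBlobMonoid d n) :
    toDiagram d (n + 1) (succHom d n x) = (toDiagram d n x).addStrand := by
  have : (toDiagram d (n + 1)).comp (succHom d n) = (addStrandHom d n).comp (toDiagram d n) := by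
    refine PresentedMonoid.ext _ ?_
    rintro (⟨i, h⟩ | ⟨i, h1, h2⟩)
    · exact (addStrand_u h).symm
    · exact (addStrand_z h1 h2).symm
  exact DFunLike.congr_fun this x

theorem toDiagram_gu {i : ℕ} (h1 : 1 ≤ i) (h : i < n) :
    toDiagram d n (gu i) = uSucc d i h1 h := by
  rw [gu_eq h, toDiagram_u, u_of_pos h1]

theorem toDiagram_gu_zero (h : 0 < n) : toDiagram d n (gu 0) = uZero d n := by
  rw [gu_eq h, toDiagram_u, u_zero]

theorem toDiagram_eq_of_succHom_mul_gu (h1 : 1 ≤ n) {x y : FramedBlobMonoid d n}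
    (h : toDiagram d (n + 1) (succHom d n x * gu n) =
      toDiagram d (n + 1) (succHom d n y * gu n)) : toDiagram d n x = toDiagram d n y := by
  rw [map_mul, map_mul, toDiagram_gu h1 (Nat.lt_succ_self n), toDiagram_succHom,
    toDiagram_succHom] at h
  exact addStrand_mul_uSucc_injective h1 h

/-! ### Reading off the last arc of a diagram -/

theorem toDiagram_gz_pow {k : ℕ} (h1 : 1 ≤ k) (h2 : k ≤ n) (c : ℕ) :
    toDiagram d n (gz k ^ c) =
      strands (fun j => if (j : ℕ) + 1 = k then .plain (c : ZMod d) else 1) (by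
        intro j h
        split_ifs at h <;> exact h.elim) := by
  rw [map_pow, gz_eq h1 h2, toDiagram_z, z_pow_eq]

theorem toDiagram_blob (h : 0 < n) (a b : ℕ) :
    toDiagram d n (gz 1 ^ a * gu 0 * gz 1 ^ b) =
      strands (fun j => if (j : ℕ) = 0 then .blob (a : ZMod d) b else 1) (by
        intro j h
        split_ifs at h with h'
        · exact h'
        · exact h.elim) := by
  rw [map_mul, map_mul, toDiagram_gz_pow le_rfl h, toDiagram_gz_pow le_rfl h, toDiagram_gu_zero h,
    uZero, strands_mul_strands, strands_mul_strands]
  refine strands_congr ?_ _ _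
  ext j
  simp only [Pi.mul_apply, ← Deco.one_def, Nat.add_eq_right]
  split_ifs
  · simp [Deco.plain_mul_blob, Deco.blob_mul_plain]
  · simp

theorem toDiagram_mul_desc_arc (x : FramedBlobMonoid d n) {k r : ℕ} (hk : 1 ≤ k) (h : k + r < n) :
    (toDiagram d n (x * desc k (r + 1))).arc (botL (show k < n by omega)) =
        botR (show k < n by omega) ∧
      (toDiagram d n (x * desc k (r + 1))).deco (botL (show k < n by omega)) = 1 := by
  rw [desc_succ', ← mul_assoc, map_mul, toDiagram_gu hk (by omega)]
  exact mul_uSucc_botL _ _ _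

/-- The arc through the `k`-th bottom point carries the beads of the tail, and its other end is the
next bottom point, or a top point if there is none. -/
theorem toDiagram_cup (x : FramedBlobMonoid d n) {k r : ℕ} (c : ℕ) (hk : 1 ≤ k)
    (h : k + r = n + 1) :
    (toDiagram d (n + 1) (succHom d n x * (desc k r * gz k ^ c))).deco (.inr ⟨k - 1, by omega⟩) =
        .plain c ∧
      (∀ j : Fin (n + 1), (j : ℕ) < k →
        (toDiagram d (n + 1) (succHom d n x * (desc k r * gz k ^ c))).arc
          (.inr ⟨k - 1, by omega⟩) ≠ .inr j) ∧
      (∀ hk : k < n + 1,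
        (toDiagram d (n + 1) (succHom d n x * (desc k r * gz k ^ c))).arc
          (.inr ⟨k - 1, by omega⟩) = .inr ⟨k, hk⟩) := by
  rw [← mul_assoc, map_mul, toDiagram_gz_pow hk (by omega), mul_strands_arc, mul_strands_deco]
  have e1 : k - 1 + 1 = k := by omega
  rcases r with _ | r
  · obtain rfl : k = n + 1 := by omega
    rw [desc_zero, mul_one, toDiagram_succHom]
    have e : (.inr ⟨n + 1 - 1, by omega⟩ : BPt (n + 1)) = botLast n := rfl
    rw [e, addStrand_arc_botLast, addStrand_deco_botLast, mul_one]
    refine ⟨?_, fun j _ => by simp [topLast], fun h => by omega⟩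
    simp [belowDeco, botLast, topLast, Deco.rev]
  · have e : (.inr ⟨k - 1, by omega⟩ : BPt (n + 1)) = botL (show k < n + 1 by omega) := rfl
    obtain ⟨h1, h2⟩ := toDiagram_mul_desc_arc (succHom d n x) hk (r := r) (by omega)
    rw [e, h1, h2, mul_one]
    refine ⟨?_, fun j hj he => ?_, fun _ => (mul_strands_arc _ _ _ _).trans h1⟩
    · simp [belowDeco, botL, botR, Deco.rev, e1]
    · simp only [botR, Sum.inr.injEq, Fin.ext_iff] at he
      omega

/-- The arc through the first bottom point carries the blob and the beads of the tail, and its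
other end is the second bottom point, if there is one. -/
theorem toDiagram_tail_blob (x : FramedBlobMonoid d n) (a b : ℕ) :
    (toDiagram d (n + 1) (succHom d n x * (desc 1 n * (gz 1 ^ a * gu 0 * gz 1 ^ b)))).deco
        (.inr 0) = .blob b a ∧
      (∀ h : 1 < n + 1,
        (toDiagram d (n + 1) (succHom d n x * (desc 1 n * (gz 1 ^ a * gu 0 * gz 1 ^ b)))).arc
          (.inr 0) = .inr ⟨1, h⟩) := by
  rw [← mul_assoc, map_mul, toDiagram_blob (by omega), mul_strands_arc, mul_strands_deco]
  rcases n with _ | n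
  · rw [desc_zero, mul_one, toDiagram_succHom]
    have e : (.inr 0 : BPt (0 + 1)) = botLast 0 := rfl
    rw [e, addStrand_arc_botLast, addStrand_deco_botLast, mul_one]
    refine ⟨?_, fun h => by omega⟩
    simp [belowDeco, botLast, topLast, Deco.rev]
  · have e : (.inr 0 : BPt (n + 1 + 1)) = botL (show 1 < n + 1 + 1 by omega) := rfl
    obtain ⟨h1, h2⟩ := toDiagram_mul_desc_arc (succHom d (n + 1) x) le_rfl (r := n) (by omega)
    rw [e, h1, h2, mul_one]
    refine ⟨?_, fun _ => rfl⟩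
    simp [belowDeco, botL, botR, Deco.rev]

theorem gz_pow_eq_of_natCast_eq {a b : ℕ} (h : (a : ZMod d) = b) (i : ℕ) :
    (gz i : FramedBlobMonoid d n) ^ a = gz i ^ b :=
  pow_eq_pow_of_modEq ((ZMod.natCast_eq_natCast_iff _ _ _).1 h) (gz_pow i)

/-! ### Cancellation -/

/-- Closed curves between a descending word and its reverse can be dropped. -/
theorem desc_mul_mul_asc {k r : ℕ} (hn : k + r < n) {w : FramedBlobMonoid d n}
    (hw : gu k * w * gu k = gu k) : desc k (r + 1) * w * asc k (r + 1) = gu (k + r) := by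
  rw [← desc_mul_asc hn, desc_succ', asc_succ']
  calc desc (k + 1) r * gu k * w * (gu k * asc (k + 1) r)
      = desc (k + 1) r * (gu k * w * gu k) * asc (k + 1) r := by simp only [mul_assoc]
    _ = desc (k + 1) r * (gu k * gu k) * asc (k + 1) r := by rw [hw, gu_mul_self]
    _ = _ := by simp only [mul_assoc]

theorem eq_of_succHom_mul_gu (H : Function.Injective (toDiagram d n)) {x y : FramedBlobMonoid d n}
    (h : toDiagram d (n + 1) (succHom d n x * gu n) =
      toDiagram d (n + 1) (succHom d n y * gu n)) : x = y := by
  refine H ?_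
  rcases n with _ | n
  · ext p : 2 <;> rcases p with p | p <;> exact p.elim0
  · exact toDiagram_eq_of_succHom_mul_gu (by omega) h

theorem eq_of_succHom_mul_desc (H : Function.Injective (toDiagram d n)) {k r : ℕ}
    (h : k + r = n + 1) {x y : FramedBlobMonoid d n}
    (e : toDiagram d (n + 1) (succHom d n x * desc k r) =
      toDiagram d (n + 1) (succHom d n y * desc k r)) : x = y := by
  refine eq_of_succHom_mul_gu H ?_
  rcases r with _ | r
  · rw [desc_zero, mul_one, mul_one] at e
    rw [map_mul, map_mul, e]
  · have e' := congrArg (· * toDiagram d (n + 1) (asc k (r + 1))) e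
    obtain rfl : n = k + r := by omega
    simpa only [← map_mul, mul_assoc, desc_mul_asc (show k + r < k + r + 1 by omega)] using e'

/-- Two products with descending words of different lengths that have the same diagram are equal,
if the last arcs are at a distance. -/
theorem succHom_mul_desc_eq (H : Function.Injective (toDiagram d n)) {l m r : ℕ}
    (h : l + m + 2 + r = n + 1) (hlm : 1 ≤ l + m) {x y : FramedBlobMonoid d n}
    (e : toDiagram d (n + 1) (succHom d n x * desc l (m + 2 + r)) =
      toDiagram d (n + 1) (succHom d n y * desc (l + m + 2) r)) :
    succHom d n x * desc l (m + 2 + r) = succHom d n y * desc (l + m + 2) r := by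
  have cancel : ∀ (w : FramedBlobMonoid d (n + 1)) (x' y' : FramedBlobMonoid d n),
      succHom d n x * desc l (m + 2 + r) * w = succHom d n x' * gu n →
      succHom d n y * desc (l + m + 2) r * w = succHom d n y' * gu n → x' = y' := by
    intro w x' y' h1 h2
    refine eq_of_succHom_mul_gu H ?_
    rw [← h1, ← h2, map_mul, e, ← map_mul]
  rcases r with _ | r
  · obtain rfl : n = l + m + 1 := by omega
    have b1 : (gu (l + m + 1) * gu (l + m) * gu (l + m + 1) :
        FramedBlobMonoid d (l + m + 1 + 1)) = gu (l + m + 1) :=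
      gu_succ_mul_gu_mul_gu_succ (by omega)
    have b2 : (gu (l + m) * gu (l + m + 1) * gu (l + m) :
        FramedBlobMonoid d (l + m + 1 + 1)) = gu (l + m) := gu_mul_gu_succ_mul_gu hlm
    have c1 : Commute (gu (l + m + 1) : FramedBlobMonoid d (l + m + 1 + 1)) (desc l m) :=
      gu_commute_desc (by omega)
    have hy : x * desc l m = y := by
      refine cancel (gu (l + m + 1)) _ _ ?_ ?_
      · rw [add_zero, desc_succ, desc_succ, map_mul, succHom_desc (by omega), mul_assoc, mul_assoc,
          mul_assoc, ← c1.eq, ← add_assoc, ← mul_assoc (gu (l + m)), ← mul_assoc (gu (l + m + 1)),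
          ← mul_assoc (gu (l + m + 1)), b1, mul_assoc, c1.eq]
      · rw [desc_zero, mul_one]
    have hx : x = y * asc l (m + 1) := by
      refine cancel (asc l (m + 2)) _ _ ?_ ?_
      · rw [add_zero, mul_assoc, desc_mul_asc (by omega), ← add_assoc]
      · rw [desc_zero, mul_one, map_mul, succHom_asc (by omega), mul_assoc, asc_succ l (m + 1),
          ← add_assoc]
    rw [desc_zero, mul_one, add_zero, desc_succ, desc_succ]
    calc succHom d _ x * (gu (l + (m + 1)) * (gu (l + m) * desc l m))
        = succHom d _ y * asc l m * (gu (l + m) * gu (l + m + 1) * gu (l + m)) * desc l m := by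
          rw [hx, map_mul, succHom_asc (by omega), asc_succ, ← add_assoc]
          simp only [mul_assoc]
      _ = succHom d _ x * desc l m := by
          rw [b2, hx, map_mul, succHom_asc (by omega), asc_succ]
          simp only [mul_assoc]
      _ = succHom d _ y := by
          rw [← hy, map_mul, succHom_desc (by omega)]
  · set k := l + m + 2 with hk
    obtain rfl : n = k + r := by omega
    have b1 : (gu k * gu (l + m + 1) * gu k : FramedBlobMonoid d (k + r + 1)) = gu k :=
      gu_succ_mul_gu_mul_gu_succ (by omega)
    have b2 : (gu (l + m) * gu (l + m + 1) * gu (l + m) : FramedBlobMonoid d (k + r + 1)) =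
      gu (l + m) := gu_mul_gu_succ_mul_gu hlm
    have b3 : (gu (l + m + 1) * gu (l + m) * gu (l + m + 1) : FramedBlobMonoid d (k + r + 1)) =
      gu (l + m + 1) := gu_succ_mul_gu_mul_gu_succ (by omega)
    have split : (desc l (m + 2 + (r + 1)) : FramedBlobMonoid d (k + r + 1)) =
        desc k (r + 1) * (gu (l + m + 1) * desc l (m + 1)) := by
      rw [desc_add, desc_succ l (m + 1), hk, ← add_assoc, ← add_assoc]
    have comm : ∀ i j, i ≤ l + m → k ≤ j →
        Commute (gu j : FramedBlobMonoid d (k + r + 1)) (gu i) :=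
      fun i j hi hj => (gu_commute (by omega)).symm
    -- the indices to the left and to the right of `gu (l + m + 1)` in `split` differ by at least `2`
    have c1 : Commute (desc l (m + 1) : FramedBlobMonoid d (k + r + 1)) (asc k (r + 1)) :=
      commute_asc fun j hj _ => (commute_desc fun i _ hi => comm i j (by omega) hj).symm
    have c2 : Commute (desc l (m + 1) : FramedBlobMonoid d (k + r + 1)) (desc k (r + 1)) :=
      commute_desc fun j hj _ => (commute_desc fun i _ hi => comm i j (by omega) hj).symm
    have c3 : Commute (asc l (m + 1) : FramedBlobMonoid d (k + r + 1)) (desc k (r + 1)) :=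
      commute_desc fun j hj _ => (commute_asc fun i _ hi => comm i j (by omega) hj).symm
    have c4 : Commute (gu (k + r) : FramedBlobMonoid d (k + r + 1)) (desc l (m + 1)) :=
      commute_desc fun i _ hi => comm i _ (by omega) (by omega)
    have c5 : Commute (gu (l + m) : FramedBlobMonoid d (k + r + 1)) (desc k (r + 1)) :=
      commute_desc fun j hj _ => (comm _ j (by omega) hj).symm
    have a1 : (desc k (r + 1) * gu (l + m + 1) * asc k (r + 1) : FramedBlobMonoid d (k + r + 1)) =
        gu (k + r) := desc_mul_mul_asc (by omega) b1
    have hy : x * desc l (m + 1) = y := by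
      refine cancel (asc k (r + 1)) _ _ ?_ ?_
      · calc succHom d _ x * desc l (m + 2 + (r + 1)) * asc k (r + 1)
            = succHom d _ x * (desc k (r + 1) * gu (l + m + 1) * asc k (r + 1)) *
                desc l (m + 1) := by
              rw [split]; simp only [mul_assoc]; rw [c1.eq]
          _ = succHom d _ (x * desc l (m + 1)) * gu (k + r) := by
              rw [a1, map_mul, succHom_desc (by omega), mul_assoc, c4.eq, mul_assoc]
      · rw [mul_assoc, desc_mul_asc (by omega)]
    have hx : x = y * asc l (m + 1) := by
      refine cancel (asc l (m + 1) * gu (l + m + 1) * asc k (r + 1)) _ _ ?_ ?_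
      · calc succHom d _ x * desc l (m + 2 + (r + 1)) *
              (asc l (m + 1) * gu (l + m + 1) * asc k (r + 1))
            = succHom d _ x * (desc k (r + 1) * (gu (l + m + 1) *
                (desc l (m + 1) * asc l (m + 1)) * gu (l + m + 1)) * asc k (r + 1)) := by
              rw [split]; simp only [mul_assoc]
          _ = succHom d _ x * gu (k + r) := by
              rw [desc_mul_asc (by omega), b3, a1]
      · calc succHom d _ y * desc k (r + 1) * (asc l (m + 1) * gu (l + m + 1) * asc k (r + 1))
            = succHom d _ y * (desc k (r + 1) * asc l (m + 1)) * gu (l + m + 1) *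
                asc k (r + 1) := by simp only [mul_assoc]
          _ = succHom d _ y * asc l (m + 1) *
                (desc k (r + 1) * gu (l + m + 1) * asc k (r + 1)) := by
              rw [← c3.eq]; simp only [mul_assoc]
          _ = succHom d _ (y * asc l (m + 1)) * gu (k + r) := by
              rw [a1, map_mul, succHom_asc (by omega)]
    have hxx : x = x * gu (l + m) := by
      conv_lhs => rw [hx, ← hy, mul_assoc, desc_mul_asc (by omega)]
    calc succHom d _ x * desc l (m + 2 + (r + 1))
        = succHom d _ x * (gu (l + m) * desc k (r + 1)) * (gu (l + m + 1) * desc l (m + 1)) := by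
          conv_lhs => rw [hxx, map_mul, succHom_gu (by omega), split]
          simp only [mul_assoc]
      _ = succHom d _ x * desc k (r + 1) * (gu (l + m) * gu (l + m + 1) * gu (l + m)) *
            desc l m := by
          rw [c5.eq, desc_succ l m]; simp only [mul_assoc]
      _ = succHom d _ x * (desc k (r + 1) * desc l (m + 1)) := by
          rw [b2, desc_succ l m]; simp only [mul_assoc]
      _ = succHom d _ y * desc k (r + 1) := by
          rw [← c2.eq, ← hy, map_mul, succHom_desc (by omega), mul_assoc]

/-! ### Injectivity -/

/-- Neighbouring cups share a bottom point, so that their diagrams differ; for the other ones the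
beads are removed and `succHom_mul_desc_eq` applies. -/
theorem cup_eq_cup_of_lt (hd : 1 ≤ d) (H : Function.Injective (toDiagram d n)) {k r l s b c : ℕ}
    (hl : 1 ≤ l) (hs : l + s = n + 1) (hr : k + r = n + 1) (hlk : l < k)
    {x y : FramedBlobMonoid d n}
    (e : toDiagram d (n + 1) (succHom d n x * (desc l s * gz l ^ b)) =
      toDiagram d (n + 1) (succHom d n y * (desc k r * gz k ^ c))) :
    succHom d n x * (desc l s * gz l ^ b) = succHom d n y * (desc k r * gz k ^ c) := by
  obtain ⟨-, -, hx⟩ := toDiagram_cup x b hl hs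
  obtain ⟨-, hy, -⟩ := toDiagram_cup y c (by omega) hr
  have hx := hx (by omega)
  rw [e] at hx
  have hlk' : l + 1 ≠ k := by
    rintro rfl
    refine hy ⟨l - 1, by omega⟩ (by simp only; omega) ?_
    have h2 : (⟨l + 1 - 1, by omega⟩ : Fin (n + 1)) = ⟨l, by omega⟩ := rfl
    rw [h2, ← hx, AbacusDiagram.arc_arc]
  obtain ⟨m, rfl⟩ : ∃ m, k = l + m + 2 := ⟨k - l - 2, by omega⟩
  obtain rfl : s = m + 2 + r := by omega
  -- the beads on the last arcs are removed by multiplication from the right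
  have hu : IsUnit (gz l ^ ((d - 1) * b) * gz (l + m + 2) ^ ((d - 1) * c) :
      FramedBlobMonoid d (n + 1)) := ((isUnit_gz hd _).pow _).mul ((isUnit_gz hd _).pow _)
  have ex : succHom d n x * (desc l (m + 2 + r) * gz l ^ b) *
      (gz l ^ ((d - 1) * b) * gz (l + m + 2) ^ ((d - 1) * c)) =
      succHom d n (x * gz (l + m) ^ ((d - 1) * c)) * desc l (m + 2 + r) := by
    rw [map_mul, map_pow, succHom_gz (by omega), mul_assoc, mul_assoc, ← mul_assoc (gz l ^ b),
      gz_pow_mul_gz_pow_inv hd, one_mul, desc_mul_gz_pow hl (by omega) (by omega) (by omega),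
      mul_assoc]
  have ey : succHom d n y * (desc (l + m + 2) r * gz (l + m + 2) ^ c) *
      (gz l ^ ((d - 1) * b) * gz (l + m + 2) ^ ((d - 1) * c)) =
      succHom d n (y * gz l ^ ((d - 1) * b)) * desc (l + m + 2) r := by
    rw [((gz_commute l (l + m + 2)).pow_pow _ _).eq, mul_assoc, mul_assoc,
      ← mul_assoc (gz (l + m + 2) ^ c), gz_pow_mul_gz_pow_inv hd, one_mul, map_mul, map_pow,
      succHom_gz (by omega), mul_assoc, ((gz_commute_desc (by omega)).pow_left _).eq]
  refine hu.mul_left_injective ?_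
  change _ * _ = _ * _
  rw [ex, ey]
  refine succHom_mul_desc_eq H (by omega) (by omega) ?_
  rw [← ex, ← ey, map_mul, e, ← map_mul]

/-- The first two cups share a bottom point with the arc of the blob, so that the diagrams differ;
for the other ones the beads are removed and `succHom_mul_desc_eq` applies. -/
theorem blob_eq_cup (hd : 1 ≤ d) (H : Function.Injective (toDiagram d n)) {k r a b c : ℕ}
    (hk : 1 ≤ k) (hr : k + r = n + 1) {x y : FramedBlobMonoid d n}
    (e : toDiagram d (n + 1) (succHom d n x * (desc 1 n * (gz 1 ^ a * gu 0 * gz 1 ^ b))) =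
      toDiagram d (n + 1) (succHom d n y * (desc k r * gz k ^ c))) :
    succHom d n x * (desc 1 n * (gz 1 ^ a * gu 0 * gz 1 ^ b)) =
      succHom d n y * (desc k r * gz k ^ c) := by
  obtain ⟨hx1, hx2⟩ := toDiagram_tail_blob x a b
  obtain ⟨hy1, hy2, -⟩ := toDiagram_cup y c hk hr
  rw [e] at hx1 hx2
  have k1 : k ≠ 1 := by
    rintro rfl
    exact absurd (hx1.symm.trans hy1) (by simp)
  have k2 : k ≠ 2 := by
    rintro rfl
    refine hy2 0 (by simp) ?_
    have h2 : 1 < n + 1 := by omega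
    have h3 : (⟨2 - 1, by omega⟩ : Fin (n + 1)) = ⟨1, h2⟩ := rfl
    rw [h3, ← hx2 h2, AbacusDiagram.arc_arc]
  obtain ⟨m, rfl⟩ : ∃ m, k = 0 + (m + 1) + 2 := ⟨k - 3, by omega⟩
  obtain ⟨n, rfl⟩ : ∃ s, n = s + 1 := ⟨n - 1, by omega⟩
  set k := 0 + (m + 1) + 2 with hk
  have hu : IsUnit (gz 1 ^ ((d - 1) * b) * (gz 2 ^ ((d - 1) * a) * gz k ^ ((d - 1) * c)) :
      FramedBlobMonoid d (n + 1 + 1)) :=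
    ((isUnit_gz hd _).pow _).mul (((isUnit_gz hd _).pow _).mul ((isUnit_gz hd _).pow _))
  have ex : succHom d (n + 1) x * (desc 1 (n + 1) * (gz 1 ^ a * gu 0 * gz 1 ^ b)) *
      (gz 1 ^ ((d - 1) * b) * (gz 2 ^ ((d - 1) * a) * gz k ^ ((d - 1) * c))) =
      succHom d (n + 1) (x * gz (m + 1) ^ ((d - 1) * c)) * desc 0 (m + 1 + 2 + r) := by
    have c2 : Commute (gu 0 : FramedBlobMonoid d (n + 1 + 1)) (gz 2) :=
      gu_gz_commute (by omega) (by omega)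
    have ck : Commute (gu 0 : FramedBlobMonoid d (n + 1 + 1)) (gz k) :=
      gu_gz_commute (by omega) (by omega)
    have e1 : (desc 1 (n + 1) * gz 1 ^ a : FramedBlobMonoid d (n + 1 + 1)) =
        desc 1 (n + 1) * gz 2 ^ a := by
      rw [desc_succ', mul_assoc, gu_mul_gz_pow le_rfl (by omega), mul_assoc]
    have e2 : (desc 1 (n + 1) * gz k ^ ((d - 1) * c) : FramedBlobMonoid d (n + 1 + 1)) =
        gz (m + 1) ^ ((d - 1) * c) * desc 1 (n + 1) := by
      have := desc_mul_gz_pow (d := d) (n := n + 1 + 1) (j := m + 1) (k := 1) (r := n + 1) le_rfl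
        (by omega) (by omega) (by omega) ((d - 1) * c)
      rw [hk, zero_add]; exact this
    have e3 : m + 1 + 2 + r = n + 1 + 1 := by omega
    calc _ = succHom d (n + 1) x * (desc 1 (n + 1) * gz 1 ^ a) * (gu 0 *
          ((gz 1 ^ b * gz 1 ^ ((d - 1) * b)) * (gz 2 ^ ((d - 1) * a) * gz k ^ ((d - 1) * c)))) := by
          simp only [mul_assoc]
      _ = succHom d (n + 1) x * desc 1 (n + 1) * (gz 2 ^ a * gz 2 ^ ((d - 1) * a)) *
            gz k ^ ((d - 1) * c) * gu 0 := by
          rw [gz_pow_mul_gz_pow_inv hd, one_mul, e1,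
            ((c2.pow_right _).mul_right (ck.pow_right _)).eq]
          simp only [mul_assoc]
      _ = succHom d (n + 1) x * (desc 1 (n + 1) * gz k ^ ((d - 1) * c)) * gu 0 := by
          rw [gz_pow_mul_gz_pow_inv hd, mul_one]; simp only [mul_assoc]
      _ = _ := by
          rw [e2, map_mul, map_pow, succHom_gz (by omega), e3, desc_succ' 0]
          simp only [mul_assoc]
  have ey : succHom d (n + 1) y * (desc k r * gz k ^ c) *
      (gz 1 ^ ((d - 1) * b) * (gz 2 ^ ((d - 1) * a) * gz k ^ ((d - 1) * c))) =
      succHom d (n + 1) (y * (gz 1 ^ ((d - 1) * b) * gz 2 ^ ((d - 1) * a))) * desc k r := by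
    have h1 : Commute (gz 1 ^ ((d - 1) * b) * gz 2 ^ ((d - 1) * a)) (gz k ^ ((d - 1) * c) :
        FramedBlobMonoid d (n + 1 + 1)) :=
      ((gz_commute _ _).pow_pow _ _).mul_left ((gz_commute _ _).pow_pow _ _)
    have h2 : Commute (gz 1 ^ ((d - 1) * b) * gz 2 ^ ((d - 1) * a)) (desc k r :
        FramedBlobMonoid d (n + 1 + 1)) :=
      ((gz_commute_desc (by omega)).pow_left _).mul_left ((gz_commute_desc (by omega)).pow_left _)
    rw [← mul_assoc (gz 1 ^ _), h1.eq, mul_assoc, mul_assoc, ← mul_assoc (gz k ^ c),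
      gz_pow_mul_gz_pow_inv hd, one_mul, ← h2.eq, map_mul, map_mul, map_pow, map_pow,
      succHom_gz (by omega), succHom_gz (by omega)]
    simp only [mul_assoc]
  refine hu.mul_left_injective ?_
  change _ * _ = _ * _
  rw [ex, ey]
  refine succHom_mul_desc_eq H (by omega) (by omega) ?_
  rw [← ex, ← ey, map_mul, e, ← map_mul]

theorem cup_eq_cup_of_eq (hd : 1 ≤ d) (H : Function.Injective (toDiagram d n)) {k r b c : ℕ}
    (hk : 1 ≤ k) (hr : k + r = n + 1) {x y : FramedBlobMonoid d n}
    (e : toDiagram d (n + 1) (succHom d n x * (desc k r * gz k ^ b)) =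
      toDiagram d (n + 1) (succHom d n y * (desc k r * gz k ^ c))) :
    succHom d n x * (desc k r * gz k ^ b) = succHom d n y * (desc k r * gz k ^ c) := by
  have hx := (toDiagram_cup x b hk hr).1
  have hy := (toDiagram_cup y c hk hr).1
  rw [e] at hx
  have hbc : (b : ZMod d) = c := by simpa using hx.symm.trans hy
  rw [gz_pow_eq_of_natCast_eq hbc] at e ⊢
  rw [← mul_assoc, ← mul_assoc, map_mul, map_mul _ (_ * _)] at e
  have hu : IsUnit (toDiagram d (n + 1) (gz k ^ c)) := ((isUnit_gz hd k).pow c).map _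
  rw [eq_of_succHom_mul_desc H hr (hu.mul_left_injective e)]

theorem blob_eq_blob (H : Function.Injective (toDiagram d n)) {a b a' b' : ℕ}
    {x y : FramedBlobMonoid d n}
    (e : toDiagram d (n + 1) (succHom d n x * (desc 1 n * (gz 1 ^ a * gu 0 * gz 1 ^ b))) =
      toDiagram d (n + 1) (succHom d n y * (desc 1 n * (gz 1 ^ a' * gu 0 * gz 1 ^ b')))) :
    succHom d n x * (desc 1 n * (gz 1 ^ a * gu 0 * gz 1 ^ b)) =
      succHom d n y * (desc 1 n * (gz 1 ^ a' * gu 0 * gz 1 ^ b')) := by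
  have hx := (toDiagram_tail_blob x a b).1
  have hy := (toDiagram_tail_blob y a' b').1
  rw [e] at hx
  have hab := hx.symm.trans hy
  rw [Deco.blob.injEq] at hab
  rw [gz_pow_eq_of_natCast_eq hab.1, gz_pow_eq_of_natCast_eq hab.2] at e ⊢
  congr 2
  rcases n with _ | n
  · refine H ?_
    ext p : 2 <;> rcases p with p | p <;> exact p.elim0
  · refine eq_of_succHom_mul_desc H (k := 1) (r := n + 1) (by omega) ?_
    have key : (desc 1 (n + 1) * (gz 1 ^ a' * gu 0 * gz 1 ^ b') * gu 1 :
        FramedBlobMonoid d (n + 1 + 1)) = desc 1 (n + 1) := by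
      rw [desc_succ', mul_assoc, mul_assoc, ← mul_assoc (gu 1),
        gu_one_mul_blob_mul_gu_one (by omega)]
    rw [← key, ← mul_assoc, ← mul_assoc (succHom d (n + 1) y), map_mul, e, map_mul _ (_ * _)]

theorem toDiagram_injective (hd : 1 ≤ d) (n : ℕ) : Function.Injective (toDiagram d n) := by
  induction n with
  | zero =>
    have h : ∀ x : FramedBlobMonoid d 0, x = 1 := by
      intro x
      have hx : x ∈ Submonoid.closure (Set.range gu ∪ Set.range gz) := by
        rw [closure_gens]; trivial
      have hs : (Set.range gu ∪ Set.range gz : Set (FramedBlobMonoid d 0)) ⊆ {1} := by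
        rintro _ (⟨i, rfl⟩ | ⟨i, rfl⟩)
        · exact gu_eq_one (by omega)
        · exact gz_eq_one (by omega)
      have := (Submonoid.closure_mono hs) hx
      rwa [Submonoid.closure_singleton_one, Submonoid.mem_bot] at this
    exact fun x y _ => (h x).trans (h y).symm
  | succ n H =>
    intro x y e
    obtain ⟨x, t, ht, rfl⟩ := exists_tail x
    obtain ⟨y, t', ht', rfl⟩ := exists_tail y
    cases ht with
    | cup k r c hk h =>
      cases ht' with
      | cup k' r' c' hk' h' =>
        rcases lt_trichotomy k k' with hkk | rfl | hkk
        · exact cup_eq_cup_of_lt hd H hk h h' hkk e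
        · obtain rfl : r = r' := by omega
          exact cup_eq_cup_of_eq hd H hk h e
        · exact (cup_eq_cup_of_lt hd H hk' h' h hkk e.symm).symm
      | blob a b => exact (blob_eq_cup hd H hk h e.symm).symm
    | blob a b =>
      cases ht' with
      | cup k r c hk h => exact blob_eq_cup hd H hk h e
      | blob a' b' => exact blob_eq_blob H e

end FramedBlobMonoid

namespace AbacusDiagram

variable {d n : ℕ}

/-! ### Surjectivity -/

theorem exists_pos_eq {t : ℕ} (h : t < 2 * n) : ∃ p : BPt n, p.pos = t := by
  rcases Nat.lt_or_ge t n with h' | h'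
  · exact ⟨.inl ⟨t, h'⟩, rfl⟩
  · exact ⟨.inr ⟨2 * n - 1 - t, by omega⟩, by simp only [BPt.pos_inr]; omega⟩

theorem pos_lt (p : BPt n) : p.pos < 2 * n := by
  rcases p with ⟨j, hj⟩ | ⟨j, hj⟩ <;> simp only [BPt.pos_inl, BPt.pos_inr] <;> omega

/-- The diagram formed by the arcs of `F` between the points of the image of `e`. -/
def pullback {m : ℕ} (F : AbacusDiagram d m) (e : BPt n → BPt m)
    (he : ∀ p q, (e p).pos < (e q).pos ↔ p.pos < q.pos) (a : BPt n → BPt n)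
    (ha : ∀ p, F.arc (e p) = e (a p)) : AbacusDiagram d n :=
  have einj : Function.Injective e := fun p q h => BPt.pos_injective (by
    have h1 := he p q
    have h2 := he q p
    rw [h] at h1 h2
    omega)
  { arc := a
    deco := fun p => F.deco (e p)
    arc_arc := fun p => einj (by rw [← ha, ← ha, F.arc_arc])
    arc_ne := fun p h => F.arc_ne (e p) (by rw [ha, h])
    deco_arc := fun p => by rw [← ha, F.deco_arc]
    noncrossing := fun p q => by
      have := F.noncrossing (e p) (e q)
      rwa [ha, ha, he, he, he] at this
    exposed := fun p hb q => by
      have := F.exposed (e p) hb (e q)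
      rwa [ha, ha, he, he, he, he] at this }

/-- A diagram with a vertical arc at the last strand. -/
theorem exists_eq_addStrand_mul_strands {D : AbacusDiagram d (n + 1)}
    (h : D.arc (topLast n) = botLast n) (c : Fin (n + 1) → Deco d)
    (hc : ∀ j, (c j).HasBlob → (j : ℕ) = 0) (hl : c (Fin.last n) = D.deco (topLast n))
    (hc' : ∀ j : Fin n, c j.castSucc = 1) :
    ∃ E : AbacusDiagram d n, D = E.addStrand * strands c hc := by
  have ha : ∀ p : BPt n, ∃ q, D.arc (liftPt p) = liftPt q := by
    intro p
    rcases eq_liftPt_or (D.arc (liftPt p)) with hq | hq | hq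
    · exact hq
    · exact absurd (by rw [← h, ← hq, D.arc_arc]) (liftPt_ne_botLast p)
    · rw [← h] at hq
      exact absurd (by rw [← D.arc_arc (liftPt p), hq, D.arc_arc]) (liftPt_ne_topLast p)
  choose a ha using ha
  let E := D.pullback liftPt (fun p q => by
    rw [pos_liftPt, pos_liftPt]; split_ifs <;> omega) a ha
  have hb : ∀ p : BPt n, belowDeco c (liftPt p) = 1 := by
    rintro (j | j)
    · rfl
    · exact hc' j
  refine ⟨E, ext_liftPt (fun p => ?_) ?_ ?_⟩
  · rw [mul_strands_arc, mul_strands_deco, addStrand_arc_liftPt, addStrand_deco_liftPt, hb, hb,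
      Deco.rev_one, one_mul, mul_one]
    exact ⟨ha p, rfl⟩
  · rw [mul_strands_arc, mul_strands_deco, addStrand_arc_topLast, addStrand_deco_topLast, mul_one]
    refine ⟨h, ?_⟩
    rw [← hl]
    exact (one_mul _).symm
  · rw [mul_strands_arc, mul_strands_deco, addStrand_arc_botLast, addStrand_deco_botLast, mul_one,
      ← h, D.arc_arc, D.deco_arc, h, ← hl]
    exact ⟨rfl, (mul_one _).symm⟩

/-- A diagram with the lower arc of the last generator is bent back to one with fewer strands. -/
theorem exists_eq_addStrand_mul_uSucc {F : AbacusDiagram d (n + 1)} (h1 : 1 ≤ n)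
    (h : F * uSucc d n h1 (Nat.lt_succ_self n) = F) :
    ∃ E : AbacusDiagram d n, F = E.addStrand * uSucc d n h1 (Nat.lt_succ_self n) := by
  obtain ⟨hL, hL'⟩ := F.mul_uSucc_botL h1 (Nat.lt_succ_self n)
  obtain ⟨hR, hR'⟩ := F.mul_uSucc_botR h1 (Nat.lt_succ_self n)
  rw [h] at hL hL' hR hR'
  have hne : ∀ p : BPt n, bendPt p ≠ botL (Nat.lt_succ_self n) ∧
      bendPt p ≠ botR (Nat.lt_succ_self n) := by
    intro p
    by_cases hp : p = .inr ⟨n - 1, by omega⟩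
    · rw [hp, bendPt_last h1]; exact ⟨by simp [topLast, botL], by simp [topLast, botR]⟩
    · rw [bendPt_of_ne h1 hp]
      exact ⟨fun e => hp ((liftPt_eq_botL h1 p).1 e), liftPt_ne_botLast p⟩
  have hcov : ∀ p : BPt (n + 1), p ≠ botL (Nat.lt_succ_self n) → p ≠ botR (Nat.lt_succ_self n) →
      ∃ q, p = bendPt q := by
    intro p hp hp'
    rcases eq_liftPt_or p with ⟨q, rfl⟩ | rfl | rfl
    · exact ⟨q, (bendPt_of_ne h1 fun e => hp ((liftPt_eq_botL h1 q).2 e)).symm⟩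
    · exact ⟨_, (bendPt_last h1).symm⟩
    · exact absurd rfl hp'
  have ha : ∀ p : BPt n, ∃ q, F.arc (bendPt p) = bendPt q := by
    intro p
    refine hcov _ (fun e => (hne p).2 ?_) (fun e => (hne p).1 ?_)
    · rw [← F.arc_arc (bendPt p), e, hL]
    · rw [← F.arc_arc (bendPt p), e, hR]
  choose a ha using ha
  let E := F.pullback bendPt (fun p q => by
    rw [pos_bendPt, pos_bendPt]; split_ifs <;> omega) a ha
  have hE := E.addStrand_mul_uSucc h1
  refine ⟨E, ?_⟩
  ext p : 2
  · by_cases hp : p = botL (Nat.lt_succ_self n)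
    · rw [hp, hL, (mul_uSucc_botL _ _ _).1]
    by_cases hp' : p = botR (Nat.lt_succ_self n)
    · rw [hp', hR, (mul_uSucc_botR _ _ _).1]
    obtain ⟨q, rfl⟩ := hcov p hp hp'
    rw [(hE q).1]; exact ha q
  · by_cases hp : p = botL (Nat.lt_succ_self n)
    · rw [hp, hL', (mul_uSucc_botL _ _ _).2]
    by_cases hp' : p = botR (Nat.lt_succ_self n)
    · rw [hp', hR', (mul_uSucc_botR _ _ _).2]
    obtain ⟨q, rfl⟩ := hcov p hp hp'
    rw [(hE q).2]; rfl

/-- The decoration of a lower arc of neighbouring points is restored from below. -/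
theorem eq_mul_uSucc_mul_strands {D : AbacusDiagram d n} {k : ℕ} (h1 : 1 ≤ k) (h : k < n)
    (hD : D.arc (botL h) = botR h) (c : Fin n → Deco d)
    (hc : ∀ j, (c j).HasBlob → (j : ℕ) = 0) (hl : (belowDeco c (botL h)).rev = D.deco (botL h))
    (hc' : ∀ j : Fin n, (j : ℕ) + 1 ≠ k → c j = 1) :
    D = D * uSucc d k h1 h * strands c hc := by
  have hD' : D.arc (botR h) = botL h := by rw [← hD, D.arc_arc]
  have hb : ∀ p : BPt n, p ≠ botL h → belowDeco c p = 1 := by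
    rintro (j | j) hp
    · rfl
    · exact hc' j fun e => hp ((inr_eq_botL h1 h j).2 e)
  have hne := botL_ne_botR h1 h
  ext p : 2
  · rw [mul_strands_arc, mul_uSucc_arc]
    split_ifs with a b e f
    · rw [a, hD]
    · rw [b, hD']
    · exact absurd (by rw [← D.arc_arc p, e, hD]) b
    · exact absurd (by rw [← D.arc_arc p, f, hD']) a
    · rfl
  · rw [mul_strands_deco, mul_uSucc_arc, mul_uSucc_deco]
    split_ifs with a b e f
    · rw [a, hb _ hne.symm, hl, mul_one, mul_one]
    · rw [b, hb _ hne.symm, Deco.rev_one, one_mul, one_mul, ← hD, D.deco_arc, ← hl]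
      cases belowDeco c (botL h) <;> rfl
    · exact absurd (by rw [← D.arc_arc p, e, hD]) b
    · exact absurd (by rw [← D.arc_arc p, f, hD']) a
    · rw [hb p a, hb _ e, Deco.rev_one, one_mul, mul_one]

/-- Among the last `n + 2` boundary points, two neighbours are joined by an arc without a blob, or
the last two points are joined. -/
theorem exists_adjacent (D : AbacusDiagram d (n + 1)) :
    ∃ p, n ≤ p.pos ∧ (D.arc p).pos = p.pos + 1 ∧ (¬ (D.deco p).HasBlob ∨ p.pos = 2 * n) := by
  classical
  -- `n + 1` bottom points cannot all be joined to the first `n` points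
  obtain ⟨p₀, h₀, h₀'⟩ : ∃ p, n ≤ p.pos ∧ p.pos < (D.arc p).pos := by
    by_contra! hcon
    have key : ∀ j : Fin (n + 1), ∃ i : Fin n, D.arc (.inr j) = .inl i.castSucc := by
      intro j
      have hj : n ≤ (BPt.pos (.inr j : BPt (n + 1))) := by simp only [BPt.pos_inr]; omega
      have h1 := hcon _ hj
      have h2 : (D.arc (.inr j)).pos < n := by
        by_contra! h3
        have h4 := hcon _ h3
        rw [D.arc_arc] at h4
        exact D.arc_ne _ (BPt.pos_injective (le_antisymm h1 h4))
      rcases h : D.arc (.inr j) with i | i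
      · rw [h, BPt.pos_inl] at h2
        exact ⟨⟨i, h2⟩, rfl⟩
      · rw [h, BPt.pos_inr] at h2; omega
    choose f hf using key
    have hinj : Function.Injective f := by
      intro i j hij
      have : D.arc (.inr i) = D.arc (.inr j) := by rw [hf, hf, hij]
      have := congrArg D.arc this
      rw [D.arc_arc, D.arc_arc] at this
      exact Sum.inr_injective this
    have := Fintype.card_le_of_injective f hinj
    simp at this
  -- the point after `p` starts an arc inside that of `p`
  have inner : ∀ p, p.pos < (D.arc p).pos → (D.arc p).pos ≠ p.pos + 1 →
      ∃ r, r.pos = p.pos + 1 ∧ r.pos < (D.arc r).pos ∧ (D.arc r).pos < (D.arc p).pos := by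
    intro p hp hp'
    have hlt := pos_lt (D.arc p)
    obtain ⟨r, hr⟩ := exists_pos_eq (n := n + 1) (t := p.pos + 1) (by omega)
    have h1 : (D.arc r).pos ≠ r.pos := fun e => D.arc_ne r (BPt.pos_injective e)
    have h2 : (D.arc r).pos ≠ p.pos := fun e => by
      have := BPt.pos_injective e
      rw [← this, D.arc_arc] at hp'
      omega
    have h3 : (D.arc r).pos ≠ (D.arc p).pos := fun e => by
      have := congrArg D.arc (BPt.pos_injective e)
      rw [D.arc_arc, D.arc_arc] at this
      rw [this] at hr; omega
    have n1 := D.noncrossing p r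
    have n2 := D.noncrossing (D.arc r) p
    rw [D.arc_arc] at n2
    exact ⟨r, hr, by omega, by omega⟩
  by_cases hex : ∃ p, n ≤ p.pos ∧ p.pos < (D.arc p).pos ∧ ¬ (D.deco p).HasBlob
  · -- a shortest arc without a blob
    obtain ⟨p, hp, hmin⟩ := Finset.exists_min_image
      (Finset.univ.filter fun p => n ≤ p.pos ∧ p.pos < (D.arc p).pos ∧ ¬ (D.deco p).HasBlob)
      (fun p => (D.arc p).pos - p.pos) (by
        obtain ⟨p, hp⟩ := hex
        exact ⟨p, by simpa using hp⟩)
    simp only [Finset.mem_filter, Finset.mem_univ, true_and] at hp hmin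
    refine ⟨p, hp.1, ?_, Or.inl hp.2.2⟩
    by_contra hne
    obtain ⟨r, h1, h2, h3⟩ := inner p hp.2.1 hne
    have := hmin r ⟨by omega, h2, fun hb => D.exposed r hb p ⟨by omega, by omega, by omega, h3⟩⟩
    omega
  · -- the last arc, which has a blob
    push Not at hex
    obtain ⟨p, hp, hmax⟩ := Finset.exists_max_image
      (Finset.univ.filter fun p => n ≤ p.pos ∧ p.pos < (D.arc p).pos) BPt.pos
      ⟨p₀, by simpa using ⟨h₀, h₀'⟩⟩
    simp only [Finset.mem_filter, Finset.mem_univ, true_and] at hp hmax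
    have hadj : (D.arc p).pos = p.pos + 1 := by
      by_contra hne
      obtain ⟨r, h1, h2, h3⟩ := inner p hp.2 hne
      have := hmax r ⟨by omega, h2⟩
      omega
    refine ⟨p, hp.1, hadj, Or.inr ?_⟩
    have hlt := pos_lt (D.arc p)
    by_contra hne
    obtain ⟨s, hs⟩ := exists_pos_eq (n := n + 1) (t := p.pos + 2) (by omega)
    have h1 : (D.arc s).pos ≠ s.pos := fun e => D.arc_ne s (BPt.pos_injective e)
    have h2 : (D.arc s).pos ≠ p.pos := fun e => by
      have := BPt.pos_injective e
      rw [← this, D.arc_arc] at hadj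
      rw [this] at hadj; omega
    have h3 : (D.arc s).pos ≠ (D.arc p).pos := fun e => by
      have := congrArg D.arc (BPt.pos_injective e)
      rw [D.arc_arc, D.arc_arc] at this
      rw [this] at hs; omega
    rcases Nat.lt_or_ge s.pos (D.arc s).pos with h4 | h4
    · have := hmax s ⟨by omega, h4⟩
      omega
    · refine D.exposed p (hex p hp.1 hp.2) (D.arc s) ?_
      rw [D.arc_arc]
      exact ⟨by omega, by omega, by omega, by omega⟩

end AbacusDiagram

namespace FramedBlobMonoid

open AbacusDiagram

variable {d n : ℕ}

/-- `D * u k = (D * asc k) * desc k`, and `D * asc k` ends with the last generator, so that it comes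
from a diagram with fewer strands by bending. -/
theorem mul_uSucc_mem_mrange (H : Function.Surjective (toDiagram d n)) {k : ℕ} (h1 : 1 ≤ k)
    (h : k < n + 1) (D : AbacusDiagram d (n + 1)) :
    D * uSucc d k h1 h ∈ MonoidHom.mrange (toDiagram d (n + 1)) := by
  obtain ⟨r, rfl⟩ : ∃ r, n = k + r := ⟨n - k, by omega⟩
  have hF : D * toDiagram d _ (asc k (r + 1)) * uSucc d (k + r) (by omega) (Nat.lt_succ_self _) =
      D * toDiagram d _ (asc k (r + 1)) := by
    rw [← toDiagram_gu (by omega) (Nat.lt_succ_self _), mul_assoc, ← map_mul, asc_succ, mul_assoc,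
      gu_mul_self]
  obtain ⟨E, hE⟩ := exists_eq_addStrand_mul_uSucc (by omega) hF
  obtain ⟨x, rfl⟩ := H E
  refine ⟨succHom d _ x * gu (k + r) * desc k (r + 1), ?_⟩
  rw [map_mul, map_mul, toDiagram_gu (by omega) (Nat.lt_succ_self _), toDiagram_succHom, ← hE,
    mul_assoc, ← map_mul, asc_mul_desc h1, toDiagram_gu h1 h]

theorem toDiagram_surjective (hd : 1 ≤ d) (n : ℕ) : Function.Surjective (toDiagram d n) := by
  have : NeZero d := ⟨by omega⟩
  induction n with
  | zero =>
    intro D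
    refine ⟨1, ?_⟩
    ext p : 2 <;> rcases p with p | p <;> exact p.elim0
  | succ n H =>
    intro D
    change D ∈ MonoidHom.mrange (toDiagram d (n + 1))
    obtain ⟨p, hp, hadj, hb⟩ := D.exists_adjacent
    rcases Nat.eq_or_lt_of_le hp with hpn | hpn
    · -- the last arc is vertical
      obtain rfl : p = topLast n := BPt.pos_injective (by rw [pos_topLast]; exact hpn.symm)
      have harc : D.arc (topLast n) = botLast n :=
        BPt.pos_injective (by rw [hadj, pos_topLast, pos_botLast])
      rcases hm : D.deco (topLast n) with c | ⟨a, b⟩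
      · obtain ⟨hc, hz⟩ : ∃ hc, toDiagram d (n + 1) (gz (n + 1) ^ c.val) =
            strands (fun j => if (j : ℕ) + 1 = n + 1 then .plain (c.val : ZMod d) else 1) hc :=
          ⟨_, toDiagram_gz_pow (by omega) le_rfl c.val⟩
        obtain ⟨E, hE⟩ := exists_eq_addStrand_mul_strands harc _ hc (by
            rw [Fin.val_last, if_pos rfl, hm, ZMod.natCast_zmod_val c]) fun j =>
          if_neg (by rw [Fin.val_castSucc]; omega)
        obtain ⟨x, rfl⟩ := H E
        rw [hE, ← hz, ← toDiagram_succHom, ← map_mul]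
        exact ⟨_, rfl⟩
      · have hn : n = 0 := by
          rcases hb with hb | hb
          · rw [hm] at hb; exact absurd trivial hb
          · rw [pos_topLast] at hb; omega
        subst hn
        obtain ⟨hc, hz⟩ : ∃ hc, toDiagram d 1 (gz 1 ^ a.val * gu 0 * gz 1 ^ b.val) =
            strands (fun j => if (j : ℕ) = 0 then .blob (a.val : ZMod d) b.val else 1) hc :=
          ⟨_, toDiagram_blob (by omega) a.val b.val⟩
        obtain ⟨E, hE⟩ := exists_eq_addStrand_mul_strands harc _ hc (by
            rw [Fin.val_last, if_pos rfl, hm, ZMod.natCast_zmod_val a,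
              ZMod.natCast_zmod_val b]) fun j =>
          j.elim0
        obtain ⟨x, rfl⟩ := H E
        rw [hE, ← hz, ← toDiagram_succHom, ← map_mul]
        exact ⟨_, rfl⟩
    · -- the points `k` and `k + 1` at the bottom are joined
      have hlt := pos_lt (D.arc p)
      obtain ⟨k, hk⟩ : ∃ k, k + p.pos = 2 * n + 1 := ⟨2 * n + 1 - p.pos, by omega⟩
      have h1 : 1 ≤ k := by omega
      have h : k < n + 1 := by omega
      obtain rfl : p = botR h := BPt.pos_injective (by simp only [botR, BPt.pos_inr]; omega)
      have harc : D.arc (botR h) = botL h :=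
        BPt.pos_injective (by rw [hadj]; simp only [botR, botL, BPt.pos_inr]; omega)
      have harc' : D.arc (botL h) = botR h := by rw [← harc, D.arc_arc]
      have hdeco : D.deco (botL h) = (D.deco (botR h)).rev := by rw [← harc, D.deco_arc]
      have hmem := mul_uSucc_mem_mrange H h1 h D
      rcases hm : D.deco (botR h) with c | ⟨a, b⟩
      · obtain ⟨hc, hz⟩ : ∃ hc, toDiagram d (n + 1) (gz k ^ c.val) =
            strands (fun j => if (j : ℕ) + 1 = k then .plain (c.val : ZMod d) else 1) hc :=
          ⟨_, toDiagram_gz_pow h1 h.le c.val⟩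
        rw [eq_mul_uSucc_mul_strands h1 h harc' _ hc (by
            rw [hdeco, hm, botL, belowDeco, if_pos (Nat.sub_add_cancel h1),
              ZMod.natCast_zmod_val c]) fun j hj => if_neg hj, ← hz]
        exact mul_mem hmem ⟨_, rfl⟩
      · have hk1 : k = 1 := by
          rcases hb with hb | hb
          · rw [hm] at hb; exact absurd trivial hb
          · omega
        subst hk1
        obtain ⟨hc, hz⟩ : ∃ hc, toDiagram d (n + 1) (gz 1 ^ a.val * gu 0 * gz 1 ^ b.val) =
            strands (fun j => if (j : ℕ) = 0 then .blob (a.val : ZMod d) b.val else 1) hc :=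
          ⟨_, toDiagram_blob (by omega) a.val b.val⟩
        rw [eq_mul_uSucc_mul_strands h1 h harc' _ hc (by
            rw [hdeco, hm, botL, belowDeco, if_pos rfl,
              ZMod.natCast_zmod_val a, ZMod.natCast_zmod_val b]) fun j hj =>
                if_neg (by omega), ← hz]
        exact mul_mem hmem ⟨_, rfl⟩

end FramedBlobMonoid

theorem mainTheorem5 (d n : ℕ) (hd : 1 ≤ d) (hn : 1 ≤ n) :
    ∃ Φ : FramedBlobMonoid d n ≃* AbacusDiagram d n,
      (∀ (i : ℕ) (h : i < n), Φ (FramedBlobMonoid.u d i h) = AbacusDiagram.u d i h) ∧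
      (∀ (i : ℕ) (h1 : 1 ≤ i) (h2 : i ≤ n),
        Φ (FramedBlobMonoid.z d i h1 h2) = AbacusDiagram.z d i h1 h2) := by
  refine ⟨MulEquiv.ofBijective (FramedBlobMonoid.toDiagram d n)
    ⟨FramedBlobMonoid.toDiagram_injective hd n, FramedBlobMonoid.toDiagram_surjective hd n⟩,
    fun i h => ?_, fun i h1 h2 => ?_⟩
  · exact FramedBlobMonoid.toDiagram_u i h
  · exact FramedBlobMonoid.toDiagram_z i h1 h2
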